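/- Let $\mathbb D$ be the open unit disk in $\mathbb C$, $\mathbb T=\partial\mathbb D$, $\Delta=\frac{\partial^2}{\partial z\,\partial\bar z}=\frac14\big(\frac{\partial^2}{\partial x^2}+\frac{\partial^2}{\partial y^2}\big)$, $dA=\frac1\pi\,dx\,dy$, and let $\mathfrak D'(\mathbb T)$ be the space of distributions on $\mathbb T$; a function $v\in C(\mathbb T)$ is identified with the distribution $\varphi\mapsto\frac1{2\pi}\int_0^{2\pi}v(e^{i\theta})\varphi(e^{i\theta})\,d\theta$. For $f,h\in\mathfrak D'(\mathbb T)$ and $g\in L^1_{\rm loc}(\mathbb D)$, a continuous function $\Phi:\mathbb D\to\mathbb C$ is said to solve the problem $$\Delta^2\Phi=g\ \text{ in }\mathbb D,\qquad \Phi=f\ \text{ on }\mathbb T,\qquad \partial_n\Phi=h\ \text{ on }\mathbb T \tag{D}$$ if $\Delta^2\Phi=g$ holds in the sense of distributions in $\mathbb D$ and, with $\Phi_r(e^{i\theta})=\Phi(re^{i\theta})$, one has $\Phi_r\to f$ and $\frac{\Phi_r-f}{1-r}\to h$ in $\mathfrak D'(\mathbb T)$ as $r\to1^-$ (so $\partial_n$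 is the inward normal derivative). Let $$H_0(z)=\frac12\frac{(1-|z|^2)^2}{|1-z|^2},\qquad F_0(z)=H_0(z)+\frac12\frac{(1-|z|^2)^3}{|1-z|^4},$$ $$F_0[f](z)=\frac1{2\pi}\int_0^{2\pi}F_0(ze^{-i\theta})f(e^{i\theta})\,d\theta,\qquad H_0[h](z)=\frac1{2\pi}\int_0^{2\pi}H_0(ze^{-i\theta})h(e^{i\theta})\,d\theta\qquad(z\in\mathbb D),$$ in the sense of the action of $f$ and $h$ on test functions, and $$G(z,\zeta)=|z-\zeta|^2\log\left|\frac{1-\bar\zeta z}{z-\zeta}\right|^2-(1-|z|^2)(1-|\zeta|^2),\qquad G[g](z)=\int_{\mathbb D}G(z,\zeta)g(\zeta)\,dA(\zeta).$$ **Theorem 1.1.** (1) Let $f,h\in\mathfrak D'(\mathbb T)$ and $g\in L^1_{\rm loc}(\mathbb D)$. Suppose that $u$ solves (D) with $0$ in place of $g$ (that is, $\Delta^2u=0$, $u=f$, $\partial_nu=h$), and that $w\in C^\infty(\overline{\mathbb D})$ solves (D) with $0$ in place of both $f$ and $h$ (that is, $\Delta^2w=g$, $w=0$, $\partial_nw=0$).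 Then in $\mathbb D$ $$u=F_0[f]+H_0[h]\qquad\text{and}\qquad w=-G[g]$$ (the integral defining $G[g]$ converging absolutely), and $\Phi=u+w$ is a solution of (D) and the only one. (2) Let $f,h\in\mathfrak D'(\mathbb T)$ and $g\in C(\overline{\mathbb D})$. Then the integral defining $G[g]$ converges absolutely in $\mathbb D$, and $$\Phi=F_0[f]+H_0[h]-G[g]$$ solves (D). -/

import Mathlib

open Set Filter Topology MeasureTheory Metric
open scoped ContDiff Laplacian

noncomputable section

/-- The Laplacian `Δ = ∂²/∂z∂z̄ = (1/4) (∂²/∂x² + ∂²/∂y²)`; on the right stands Mathlib's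
Laplacian of the real inner product space `ℂ`. -/
def dLaplacian (φ : ℂ → ℂ) : ℂ → ℂ := fun z => (1 / 4 : ℂ) * (Δ φ) z

/-- The normalized area measure `dA = (1/π) dx dy` (the unit disk has mass one). -/
def normalizedArea : Measure ℂ := ENNReal.ofReal (1 / Real.pi) • (volume : Measure ℂ)

/-! ### Distributions on the unit circle -/

/-- Test functions on the unit circle: smooth `2π`-periodic functions of the angle `θ`,
`φ θ` standing for the value at `e^{iθ}`. -/
def CircleTest : Submodule ℂ (ℝ → ℂ) where
  carrier := {φ | ContDiff ℝ ∞ φ ∧ Function.Periodic φ (2 * Real.pi)}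
  zero_mem' := ⟨contDiff_const, fun _ => rfl⟩
  add_mem' := fun ha hb => ⟨ha.1.add hb.1, ha.2.add hb.2⟩
  smul_mem' := fun c _ ha => ⟨contDiff_const.smul ha.1, ha.2.smul c⟩

/-- The space of distributions on the unit circle: the linear functionals `T` on the test
functions that are continuous, which means that for some order `N` and some constant `C`,
`|T φ| ≤ C max_{k ≤ N} sup_θ |φ^{(k)}(θ)|` for every test function `φ`. -/
def CircleDistribution : Submodule ℂ (CircleTest →ₗ[ℂ] ℂ) where
  carrier := {T | ∃ (N : ℕ) (C : ℝ), ∀ (φ : CircleTest) (M : ℝ),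
    (∀ k ≤ N, ∀ θ : ℝ, ‖iteratedDeriv k (φ : ℝ → ℂ) θ‖ ≤ M) → ‖T φ‖ ≤ C * M}
  zero_mem' := ⟨0, 0, fun _ _ _ => by simp⟩
  add_mem' := by
    rintro S T ⟨N, C, hS⟩ ⟨N', C', hT⟩
    refine ⟨max N N', C + C', fun φ M h => ?_⟩
    have h1 := hS φ M fun k hk => h k (hk.trans (le_max_left _ _))
    have h2 := hT φ M fun k hk => h k (hk.trans (le_max_right _ _))
    calc ‖(S + T) φ‖ ≤ ‖S φ‖ + ‖T φ‖ := norm_add_le _ _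
      _ ≤ (C + C') * M := by linarith
  smul_mem' := by
    rintro c T ⟨N, C, hT⟩
    refine ⟨N, ‖c‖ * C, fun φ M h => ?_⟩
    have h1 := mul_le_mul_of_nonneg_left (hT φ M h) (norm_nonneg c)
    calc ‖(c • T) φ‖ = ‖c‖ * ‖T φ‖ := norm_mul _ _
      _ ≤ ‖c‖ * C * M := by linarith

/-- The action `(1/2π) ∫₀^{2π} Φ(re^{iθ}) φ(θ) dθ` on `φ` of the function
`Φ_r : e^{iθ} ↦ Φ(re^{iθ})`, seen as a distribution on the circle. -/
def dilatePairing (Φ : ℂ → ℂ) (r : ℝ) (φ : CircleTest) : ℂ :=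
  (1 / (2 * Real.pi) : ℂ) * ∫ θ in (0 : ℝ)..(2 * Real.pi),
    Φ (r * Complex.exp (θ * Complex.I)) * (φ : ℝ → ℂ) θ

/-- `Φ = f` on the circle: `Φ_r → f` in the space of distributions as `r → 1⁻`. -/
def HasBoundaryValue (Φ : ℂ → ℂ) (f : CircleDistribution) : Prop :=
  ∀ φ : CircleTest, Tendsto (fun r : ℝ => dilatePairing Φ r φ) (𝓝[<] 1) (𝓝 (f.1 φ))

/-- `Φ = f` has inward normal derivative `h` on the circle:
`(Φ_r - f) / (1 - r) → h` in the space of distributions as `r → 1⁻`. -/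
def HasInwardNormalDerivative (Φ : ℂ → ℂ) (f h : CircleDistribution) : Prop :=
  ∀ φ : CircleTest,
    Tendsto (fun r : ℝ => (dilatePairing Φ r φ - f.1 φ) / (1 - r : ℂ)) (𝓝[<] 1) (𝓝 (h.1 φ))

/-! ### The inhomogeneous biharmonic Dirichlet problem -/

/-- `Δ² Φ = g` in the unit disk, in the sense of distributions:
`∫ Φ Δ²φ dA = ∫ g φ dA` for every smooth `φ` with compact support in the disk. -/
def WeakBilaplacianEq (Φ g : ℂ → ℂ) : Prop :=
  ∀ φ : ℂ → ℂ, ContDiff ℝ ∞ φ → HasCompactSupport φ → tsupport φ ⊆ ball (0 : ℂ) 1 →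
    ∫ z in ball (0 : ℂ) 1, Φ z * dLaplacian (dLaplacian φ) z ∂normalizedArea =
      ∫ z in ball (0 : ℂ) 1, g z * φ z ∂normalizedArea

/-- `Φ` solves `Δ²Φ = g` in the unit disk, `Φ = f` and `∂_n Φ = h` on the unit circle.
Only the values of `Φ` and `g` in the open disk matter. -/
structure SolvesBiharmonicDirichlet (g : ℂ → ℂ) (f h : CircleDistribution) (Φ : ℂ → ℂ) :
    Prop where
  locallyIntegrable_rhs : LocallyIntegrableOn g (ball (0 : ℂ) 1)
  continuousOn : ContinuousOn Φ (ball (0 : ℂ) 1)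
  bilaplacian : WeakBilaplacianEq Φ g
  boundaryValue : HasBoundaryValue Φ f
  normalDerivative : HasInwardNormalDerivative Φ f h

/-! ### Kernels -/

/-- `H₀(z) = (1/2) (1 - |z|²)² / |1 - z|²`. -/
def kernelH (z : ℂ) : ℝ := 1 / 2 * ((1 - ‖z‖ ^ 2) ^ 2 / ‖1 - z‖ ^ 2)

/-- `F₀(z) = H₀(z) + (1/2) (1 - |z|²)³ / |1 - z|⁴`. -/
def kernelF (z : ℂ) : ℝ := kernelH z + 1 / 2 * ((1 - ‖z‖ ^ 2) ^ 3 / ‖1 - z‖ ^ 4)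

lemma norm_one_sub_rot_ne {z : ℂ} (hz : ‖z‖ < 1) (θ : ℝ) :
    ‖1 - z * Complex.exp (-(θ * Complex.I))‖ ^ 2 ≠ 0 := by
  have h : ‖z * Complex.exp (-(θ * Complex.I))‖ < 1 := by
    have : ‖Complex.exp (-(θ * Complex.I))‖ = 1 := by
      rw [← neg_mul, ← Complex.ofReal_neg, Complex.norm_exp_ofReal_mul_I]
    rwa [norm_mul, this, mul_one]
  intro h0
  have h1 : 1 - z * Complex.exp (-(θ * Complex.I)) = 0 := by simpa using h0
  rw [← sub_eq_zero.1 h1] at h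
  simp at h

lemma contDiff_rot (z : ℂ) : ContDiff ℝ ∞ fun θ : ℝ => z * Complex.exp (-(θ * Complex.I)) :=
  contDiff_const.mul ((Complex.ofRealCLM.contDiff.mul contDiff_const).neg.cexp)

lemma periodic_rot (K : ℂ → ℝ) (z : ℂ) :
    Function.Periodic (fun θ : ℝ => (K (z * Complex.exp (-(θ * Complex.I))) : ℂ))
      (2 * Real.pi) := by
  intro θ
  have h : Complex.exp (-(((θ + 2 * Real.pi : ℝ) : ℂ) * Complex.I)) =
      Complex.exp (-(θ * Complex.I)) := by
    rw [← Complex.exp_periodic (-(((θ + 2 * Real.pi : ℝ) : ℂ) * Complex.I))]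
    congr 1
    push_cast
    ring
  simp only [h]

lemma contDiff_kernelH_rot {z : ℂ} (hz : ‖z‖ < 1) :
    ContDiff ℝ ∞ fun θ : ℝ => kernelH (z * Complex.exp (-(θ * Complex.I))) := by
  have h1 := (contDiff_rot z).norm_sq ℝ
  have h2 := ((contDiff_const (c := (1 : ℂ))).sub (contDiff_rot z)).norm_sq ℝ
  exact contDiff_const.mul (((contDiff_const.sub h1).pow 2).div h2 (norm_one_sub_rot_ne hz))

lemma contDiff_kernelF_rot {z : ℂ} (hz : ‖z‖ < 1) :
    ContDiff ℝ ∞ fun θ : ℝ => kernelF (z * Complex.exp (-(θ * Complex.I))) := by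
  have h1 := (contDiff_rot z).norm_sq ℝ
  have h2 := ((contDiff_const (c := (1 : ℂ))).sub (contDiff_rot z)).norm_sq ℝ
  have h3 := contDiff_const (c := (1 / 2 : ℝ)) |>.mul (((contDiff_const (c := (1 : ℝ))
    |>.sub h1).pow 3).div (h2.pow 2) fun θ => pow_ne_zero 2 (norm_one_sub_rot_ne hz θ))
  have h4 := (contDiff_kernelH_rot hz).add h3
  simp only [← pow_mul] at h4
  exact h4

/-- For `|z| < 1`, the test function `e^{iθ} ↦ H₀(z e^{-iθ})`. -/
def kernelHTest (z : ℂ) (hz : ‖z‖ < 1) : CircleTest :=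
  ⟨fun θ : ℝ => (kernelH (z * Complex.exp (-(θ * Complex.I))) : ℂ),
    Complex.ofRealCLM.contDiff.comp (contDiff_kernelH_rot hz), periodic_rot kernelH z⟩

/-- For `|z| < 1`, the test function `e^{iθ} ↦ F₀(z e^{-iθ})`. -/
def kernelFTest (z : ℂ) (hz : ‖z‖ < 1) : CircleTest :=
  ⟨fun θ : ℝ => (kernelF (z * Complex.exp (-(θ * Complex.I))) : ℂ),
    Complex.ofRealCLM.contDiff.comp (contDiff_kernelF_rot hz), periodic_rot kernelF z⟩

open Classical in
/-- `H₀[h](z) = (1/2π) ∫₀^{2π} H₀(z e^{-iθ}) h(e^{iθ}) dθ` for `|z| < 1`, that is, `h` applied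
to the test function `H₀(z e^{-iθ})`; the value outside the disk is irrelevant. -/
def operatorH (h : CircleDistribution) (z : ℂ) : ℂ :=
  if hz : ‖z‖ < 1 then h.1 (kernelHTest z hz) else 0

open Classical in
/-- `F₀[f](z) = (1/2π) ∫₀^{2π} F₀(z e^{-iθ}) f(e^{iθ}) dθ` for `|z| < 1`, that is, `f` applied
to the test function `F₀(z e^{-iθ})`; the value outside the disk is irrelevant. -/
def operatorF (f : CircleDistribution) (z : ℂ) : ℂ :=
  if hz : ‖z‖ < 1 then f.1 (kernelFTest z hz) else 0

/-- `G(z, ζ) = |z - ζ|² log |(1 - ζ̄ z) / (z - ζ)|² - (1 - |z|²) (1 - |ζ|²)`; at `ζ = z` the first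
term is `0`, its limit. -/
def biharmonicGreen (z ζ : ℂ) : ℝ :=
  ‖z - ζ‖ ^ 2 * Real.log (‖(1 - (starRingEnd ℂ) ζ * z) / (z - ζ)‖ ^ 2)
    - (1 - ‖z‖ ^ 2) * (1 - ‖ζ‖ ^ 2)

/-- `G[g](z) = ∫ G(z, ζ) g(ζ) dA(ζ)`, the integral being over the unit disk. -/
def greenPotential (g : ℂ → ℂ) (z : ℂ) : ℂ :=
  ∫ ζ in ball (0 : ℂ) 1, (biharmonicGreen z ζ : ℂ) * g ζ ∂normalizedArea

end

/-!
Everything is tested against the Fourier modes `e^{inθ}` of the circle.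

*Uniqueness.* For `n ≥ 0` and a test function `Q` on `(0, 1)` let `χ'' = Q / s^(n+2)`. With
`s = |z|²` one finds `Δ² (z̄ⁿ χ(s)) = z̄ⁿ s^(-n) Q''(s)` (`exists_radial_test`). In polar coordinates
the weak equation `Δ²Φ = 0` then says that the `(-n)`-th circle coefficient of `Φ`, divided by `rⁿ`
and written in the variable `s = r²`, has vanishing second derivative in the sense of distributions,
so it is affine and the coefficient is `rⁿ (c + d r²)` (`WeakBilaplacianEq.exists_dilatePairing_eq`).
Zero boundary data make it `o(1 - r)` as `r → 1`, whence `c = d = 0`; conjugation takes care of the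
other modes, and a continuous function on a circle whose Fourier coefficients all vanish is zero
(`SolvesBiharmonicDirichlet.eqOn_zero`).

*The homogeneous equation.* With `p_n` the harmonic extension of `e^{inθ}`, the kernels expand as
`H₀ = ∑ p_n · (1 - |z|²) / 2` and `F₀ = ∑ p_n · (1 + |n| (1 - |z|²) / 2)`. A distribution has Fourier
coefficients of polynomial growth and is the sum of its Fourier series
(`CircleDistribution.hasSum`), so `F₀[f]` and `H₀[h]` are series `∑ p_n (α_n + β_n (1 - |z|²))` that
converge locally uniformly in the disk. Such a series is biharmonic, with boundary value `∑ α_n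
e^{inθ}` and inward normal derivative `∑ (2 β_n - |n| α_n) e^{inθ}` (`solves_biharmonicSeries`).

*The Green potential.* The function `|z - ζ|² log |z - ζ|²` is a fundamental solution of `Δ²`, as
the limit of the smooth functions `(s + ε) log (s + ε)`, whose bilaplacians `2 ε² / (s + ε)³` form an
approximate identity (`integral_fundamentalSolution`). `G(·, ζ)` is the difference of a
function `2 Re (z̄ F + E)` with `F` and `E` holomorphic, which is biharmonic, and this fundamental
solution. The bound `|G(z, ζ)| ≤ 16 (1 - |z|²)²`,
uniform in `ζ` (`abs_biharmonicGreen_le_sq`), gives `G[g] = O((1 - r)²)` and so zero boundary data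
for `-G[g]` when `g` is continuous up to the boundary. If a solution `w` with zero boundary data is
smooth up to the boundary, then `g` agrees almost everywhere with the continuous function `Δ²w`, and
`w = -G[g]` follows from uniqueness.
-/


/-! ### The Laplacian: smoothness, locality and integration by parts -/

theorem dLaplacian_eq_fderiv (f : ℂ → ℂ) (z : ℂ) :
    dLaplacian f z = 1 / 4 * (fderiv ℝ (fderiv ℝ f) z 1 1 +
      fderiv ℝ (fderiv ℝ f) z Complex.I Complex.I) := by
  simp only [dLaplacian, InnerProductSpace.laplacian_eq_iteratedFDeriv_complexPlane,
    iteratedFDeriv_two_apply]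
  simp

theorem dLaplacian_congr_of_eventuallyEq {f g : ℂ → ℂ} {z : ℂ} (h : f =ᶠ[𝓝 z] g) :
    dLaplacian f =ᶠ[𝓝 z] dLaplacian g := by
  filter_upwards [InnerProductSpace.laplacian_congr_nhds h] with y hy
  simp only [dLaplacian, hy]

theorem dLaplacian_eqOn_of_isOpen {f g : ℂ → ℂ} {U : Set ℂ} (hU : IsOpen U) (h : EqOn f g U) :
    EqOn (dLaplacian f) (dLaplacian g) U := fun _ hz =>
  (dLaplacian_congr_of_eventuallyEq (h.eventuallyEq_of_mem (hU.mem_nhds hz))).eq_of_nhds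

theorem ContDiffOn.fderiv_apply_const {f : ℂ → ℂ} {U : Set ℂ} (hU : IsOpen U)
    (hf : ContDiffOn ℝ ∞ f U) (v : ℂ) : ContDiffOn ℝ ∞ (fun z => fderiv ℝ f z v) U :=
  (hf.fderiv_of_isOpen hU (m := ∞) (by simp)).clm_apply contDiffOn_const

theorem fderiv_fderiv_apply_const {f : ℂ → ℂ} {z : ℂ} (hf : ContDiffAt ℝ ∞ f z) (v w : ℂ) :
    fderiv ℝ (fun y => fderiv ℝ f y v) z w = fderiv ℝ (fderiv ℝ f) z w v := by
  have h : DifferentiableAt ℝ (fderiv ℝ f) z :=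
    (hf.fderiv_right (m := ∞) (by simp)).differentiableAt (by simp)
  rw [fderiv_clm_apply h (differentiableAt_const v)]
  simp

theorem dLaplacian_eqOn {f : ℂ → ℂ} {U : Set ℂ} (hU : IsOpen U) (hf : ContDiffOn ℝ ∞ f U) :
    EqOn (dLaplacian f) (fun z => 1 / 4 * (fderiv ℝ (fun y => fderiv ℝ f y 1) z 1 +
      fderiv ℝ (fun y => fderiv ℝ f y Complex.I) z Complex.I)) U := by
  intro z hz
  have h := hf.contDiffAt (hU.mem_nhds hz)
  simp only [dLaplacian_eq_fderiv, fderiv_fderiv_apply_const h]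

theorem ContDiffOn.dLaplacian {f : ℂ → ℂ} {U : Set ℂ} (hU : IsOpen U) (hf : ContDiffOn ℝ ∞ f U) :
    ContDiffOn ℝ ∞ (dLaplacian f) U := by
  refine ContDiffOn.congr ?_ (dLaplacian_eqOn hU hf)
  exact contDiffOn_const.mul (((hf.fderiv_apply_const hU _).fderiv_apply_const hU _).add
    ((hf.fderiv_apply_const hU _).fderiv_apply_const hU _))

theorem ContDiff.dLaplacian {f : ℂ → ℂ} (hf : ContDiff ℝ ∞ f) : ContDiff ℝ ∞ (dLaplacian f) :=
  contDiffOn_univ.1 (hf.contDiffOn.dLaplacian isOpen_univ)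

theorem tsupport_dLaplacian_subset (f : ℂ → ℂ) : tsupport (dLaplacian f) ⊆ tsupport f := by
  intro z hz
  by_contra h
  have h1 := dLaplacian_congr_of_eventuallyEq (notMem_tsupport_iff_eventuallyEq.1 h)
  have h2 : dLaplacian (0 : ℂ → ℂ) = 0 := by
    ext y
    simp only [dLaplacian, Pi.zero_def, InnerProductSpace.laplacian_const]
    simp
  rw [h2] at h1
  exact (notMem_tsupport_iff_eventuallyEq.2 h1) hz

theorem HasCompactSupport.dLaplacian {f : ℂ → ℂ} (hf : HasCompactSupport f) :
    HasCompactSupport (dLaplacian f) :=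
  hf.of_isClosed_subset (isClosed_tsupport _) (tsupport_dLaplacian_subset f)

/-- A locally integrable function times a continuous function with compact support in its domain is
integrable on the plane, whatever its values off the domain. -/
theorem MeasureTheory.LocallyIntegrableOn.integrable_mul {g φ : ℂ → ℂ} {U : Set ℂ}
    (hg : LocallyIntegrableOn g U) (hφ : Continuous φ) (hc : HasCompactSupport φ)
    (hs : tsupport φ ⊆ U) : Integrable (fun z => g z * φ z) := by
  have h1 : IntegrableOn (fun z => g z * φ z) (tsupport φ) :=
    (hg.integrableOn_compact_subset hs hc).mul_continuousOn hφ.continuousOn hc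
  refine (integrableOn_iff_integrable_of_support_subset fun z hz => ?_).1 h1
  exact subset_tsupport _ (right_ne_zero_of_mul hz)

theorem ContinuousOn.integrable_mul {g φ : ℂ → ℂ} {U : Set ℂ} (hU : IsOpen U)
    (hg : ContinuousOn g U) (hφ : Continuous φ) (hc : HasCompactSupport φ)
    (hs : tsupport φ ⊆ U) : Integrable (fun z => g z * φ z) :=
  (hg.locallyIntegrableOn hU.measurableSet).integrable_mul hφ hc hs

theorem integral_mul_fderiv_of_tsupport_subset {f φ : ℂ → ℂ} {U : Set ℂ} (hU : IsOpen U)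
    (hf : ContDiffOn ℝ ∞ f U) (hφ : ContDiff ℝ ∞ φ) (hc : HasCompactSupport φ)
    (hs : tsupport φ ⊆ U) (v : ℂ) :
    ∫ z, f z * fderiv ℝ φ z v = -∫ z, fderiv ℝ f z v * φ z := by
  have hφ' : Continuous fun z => fderiv ℝ φ z v :=
    (contDiffOn_univ.1 ((hφ.contDiffOn (s := univ)).fderiv_apply_const isOpen_univ v)).continuous
  refine integral_mul_fderiv_eq_neg_fderiv_mul_of_integrable
    ((hf.fderiv_apply_const hU v).continuousOn.integrable_mul hU hφ.continuous hc hs)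
    (hf.continuousOn.integrable_mul hU hφ' ?_ ?_)
    (hf.continuousOn.integrable_mul hU hφ.continuous hc hs) (fun z hz => ?_)
    (fun z _ => hφ.differentiable (by simp) z)
  · exact hc.fderiv_apply (𝕜 := ℝ) v
  · exact (tsupport_fderiv_apply_subset ℝ v).trans hs
  · exact (hf.contDiffAt (hU.mem_nhds (hs hz))).differentiableAt (by simp)

theorem integral_mul_dLaplacian {f φ : ℂ → ℂ} {U : Set ℂ} (hU : IsOpen U)
    (hf : ContDiffOn ℝ ∞ f U) (hφ : ContDiff ℝ ∞ φ) (hc : HasCompactSupport φ)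
    (hs : tsupport φ ⊆ U) :
    ∫ z, f z * dLaplacian φ z = ∫ z, dLaplacian f z * φ z := by
  have key : ∀ v : ℂ, ∫ z, f z * fderiv ℝ (fun y => fderiv ℝ φ y v) z v =
      ∫ z, fderiv ℝ (fun y => fderiv ℝ f y v) z v * φ z := by
    intro v
    rw [integral_mul_fderiv_of_tsupport_subset hU hf
      (contDiffOn_univ.1 ((hφ.contDiffOn (s := univ)).fderiv_apply_const isOpen_univ v))
      (hc.fderiv_apply (𝕜 := ℝ) v) ((tsupport_fderiv_apply_subset ℝ v).trans hs),
      integral_mul_fderiv_of_tsupport_subset hU (hf.fderiv_apply_const hU v) hφ hc hs, neg_neg]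
  have e1 : ∀ z, f z * dLaplacian φ z = 1 / 4 * (f z * fderiv ℝ (fun y => fderiv ℝ φ y 1) z 1 +
      f z * fderiv ℝ (fun y => fderiv ℝ φ y Complex.I) z Complex.I) := by
    intro z
    rw [dLaplacian_eqOn isOpen_univ hφ.contDiffOn (mem_univ z)]
    ring
  have e2 : ∀ z, dLaplacian f z * φ z =
      1 / 4 * (fderiv ℝ (fun y => fderiv ℝ f y 1) z 1 * φ z +
        fderiv ℝ (fun y => fderiv ℝ f y Complex.I) z Complex.I * φ z) := by
    intro z
    by_cases hz : z ∈ tsupport φ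
    · rw [dLaplacian_eqOn hU hf (hs hz)]
      ring
    · simp [image_eq_zero_of_notMem_tsupport hz]
  have i1 : ∀ v : ℂ, Integrable fun z => f z * fderiv ℝ (fun y => fderiv ℝ φ y v) z v := by
    intro v
    have h1 : ContDiff ℝ ∞ fun y => fderiv ℝ φ y v :=
      contDiffOn_univ.1 ((hφ.contDiffOn (s := univ)).fderiv_apply_const isOpen_univ v)
    refine hf.continuousOn.integrable_mul hU (contDiffOn_univ.1
      ((h1.contDiffOn (s := univ)).fderiv_apply_const isOpen_univ v)).continuous
      ((hc.fderiv_apply (𝕜 := ℝ) v).fderiv_apply (𝕜 := ℝ) v)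
      (((tsupport_fderiv_apply_subset ℝ v).trans (tsupport_fderiv_apply_subset ℝ v)).trans hs)
  have i2 : ∀ v : ℂ, Integrable fun z => fderiv ℝ (fun y => fderiv ℝ f y v) z v * φ z := fun v =>
    ((hf.fderiv_apply_const hU v).fderiv_apply_const hU v).continuousOn.integrable_mul hU
      hφ.continuous hc hs
  simp only [e1, e2]
  rw [integral_const_mul, integral_const_mul, integral_add (i1 1) (i1 Complex.I),
    integral_add (i2 1) (i2 Complex.I), key, key]

theorem integral_mul_dLaplacian_dLaplacian {f φ : ℂ → ℂ} {U : Set ℂ} (hU : IsOpen U)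
    (hf : ContDiffOn ℝ ∞ f U) (hφ : ContDiff ℝ ∞ φ) (hc : HasCompactSupport φ)
    (hs : tsupport φ ⊆ U) :
    ∫ z, f z * dLaplacian (dLaplacian φ) z = ∫ z, dLaplacian (dLaplacian f) z * φ z := by
  rw [integral_mul_dLaplacian hU hf hφ.dLaplacian hc.dLaplacian
    ((tsupport_dLaplacian_subset φ).trans hs),
    integral_mul_dLaplacian hU (hf.dLaplacian hU) hφ hc hs]

/-! ### Wirtinger derivatives -/

/-- The real-linear form `dz` on the plane. -/
noncomputable def wirtingerDz : ℂ →L[ℝ] ℂ := ContinuousLinearMap.id ℝ ℂ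

/-- The real-linear form `dz̄` on the plane. -/
noncomputable def wirtingerDzbar : ℂ →L[ℝ] ℂ := (Complex.conjCLE : ℂ →L[ℝ] ℂ)

/-- `f` is real differentiable at `z` with `∂f/∂z = a` and `∂f/∂z̄ = b`. -/
def HasWirtingerAt (f : ℂ → ℂ) (a b z : ℂ) : Prop :=
  HasFDerivAt f (a • wirtingerDz + b • wirtingerDzbar) z

theorem wirtinger_apply (a b v : ℂ) :
    (a • wirtingerDz + b • wirtingerDzbar) v = a * v + b * (starRingEnd ℂ) v := by
  simp [wirtingerDz, wirtingerDzbar]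

namespace HasWirtingerAt

variable {f g : ℂ → ℂ} {a b c d z : ℂ}

theorem add (hf : HasWirtingerAt f a b z) (hg : HasWirtingerAt g c d z) :
    HasWirtingerAt (fun y => f y + g y) (a + c) (b + d) z := by
  refine (HasFDerivAt.add hf hg).congr_fderiv ?_
  ext <;> simp [wirtingerDz, wirtingerDzbar] <;> ring

theorem mul (hf : HasWirtingerAt f a b z) (hg : HasWirtingerAt g c d z) :
    HasWirtingerAt (fun y => f y * g y) (f z * c + g z * a) (f z * d + g z * b) z := by
  refine (HasFDerivAt.mul hf hg).congr_fderiv ?_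
  ext <;> simp [wirtingerDz, wirtingerDzbar] <;> ring

theorem conj (z : ℂ) : HasWirtingerAt (fun y => (starRingEnd ℂ) y) 0 1 z := by
  refine ((Complex.conjCLE : ℂ →L[ℝ] ℂ).hasFDerivAt (x := z)).congr_fderiv ?_
  ext <;> simp [wirtingerDzbar]

theorem of_hasDerivAt (hf : HasDerivAt f a z) : HasWirtingerAt f a 0 z := by
  refine (hf.hasFDerivAt.restrictScalars ℝ).congr_fderiv ?_
  ext; simp [wirtingerDz, mul_comm]

theorem conj_pow (n : ℕ) (z : ℂ) : HasWirtingerAt (fun y => (starRingEnd ℂ) y ^ n) 0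
    (n * (starRingEnd ℂ) z ^ (n - 1)) z := by
  refine (((HasDerivAt.hasFDerivAt (hasDerivAt_pow n ((starRingEnd ℂ) z))).restrictScalars ℝ).comp
    z (Complex.conjCLE : ℂ →L[ℝ] ℂ).hasFDerivAt).congr_fderiv ?_
  ext; simp [wirtingerDzbar, mul_comm]

theorem congr (hf : HasWirtingerAt f a b z) (ha : a = c) (hb : b = d) :
    HasWirtingerAt f c d z := ha ▸ hb ▸ hf

/-- The chain rule for a radial function, written as a function of `|z|²`. -/
theorem radial {χ : ℝ → ℂ} {χ' : ℂ} (h : HasDerivAt χ χ' (‖z‖ ^ 2)) :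
    HasWirtingerAt (fun y => χ (‖y‖ ^ 2)) ((starRingEnd ℂ) z * χ') (z * χ') z := by
  have h1 : HasFDerivAt (fun y : ℂ => ‖y‖ ^ 2) (2 • (innerSL ℝ z)) z :=
    (hasStrictFDerivAt_norm_sq z).hasFDerivAt
  refine (h.hasFDerivAt.comp z h1).congr_fderiv ?_
  ext
  simp [wirtingerDz, wirtingerDzbar, Complex.inner]
  apply Complex.ext <;> simp <;> ring

end HasWirtingerAt

/-- `Δ = ∂²/∂z̄∂z`: the Laplacian is the `z̄`-derivative of the `z`-derivative. -/
theorem dLaplacian_eq_of_hasWirtingerAt {f a b : ℂ → ℂ} {p q z : ℂ} (hf : ContDiffAt ℝ 2 f z)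
    (h1 : ∀ᶠ y in 𝓝 z, HasWirtingerAt f (a y) (b y) y) (h2 : HasWirtingerAt a p q z) :
    dLaplacian f z = q := by
  have hd : DifferentiableAt ℝ (fderiv ℝ f) z :=
    (hf.fderiv_right (m := 1) (by norm_num)).differentiableAt (by simp)
  have hsymm : IsSymmSndFDerivAt ℝ f z := hf.isSymmSndFDerivAt (by simp)
  have hv : ∀ v w, fderiv ℝ (fun y => fderiv ℝ f y v) z w = fderiv ℝ (fderiv ℝ f) z w v := by
    intro v w
    rw [fderiv_clm_apply hd (differentiableAt_const v)]
    simp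
  have hdv : ∀ v, DifferentiableAt ℝ (fun y => fderiv ℝ f y v) z := fun v =>
    hd.clm_apply (differentiableAt_const v)
  -- `2a = f_x - i f_y` near `z`
  have ha : ∀ᶠ y in 𝓝 z, a y = 1 / 2 * (fderiv ℝ f y 1 - Complex.I * fderiv ℝ f y Complex.I) := by
    filter_upwards [h1] with y hy
    rw [HasFDerivAt.fderiv hy, wirtinger_apply, wirtinger_apply]
    simp
    linear_combination ((a y) / 2 - b y / 2) * Complex.I_mul_I
  have h3 := (HasFDerivAt.congr_of_eventuallyEq h2 (EventuallyEq.symm ha)).fderiv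
  have h4 : ∀ w, fderiv ℝ (fun y => 1 / 2 * (fderiv ℝ f y 1 -
      Complex.I * fderiv ℝ f y Complex.I)) z w = 1 / 2 * (fderiv ℝ (fderiv ℝ f) z w 1 -
      Complex.I * fderiv ℝ (fderiv ℝ f) z w Complex.I) := by
    intro w
    have e := (((hdv 1).hasFDerivAt.sub ((hdv Complex.I).hasFDerivAt.const_mul Complex.I)).const_mul
      (1 / 2)).fderiv
    simp only [Pi.sub_apply] at e
    rw [e]
    simp [hv]
  rw [h3] at h4
  have e1 := h4 1
  have e2 := h4 Complex.I
  rw [wirtinger_apply] at e1 e2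
  have hs := hsymm.eq 1 Complex.I
  simp only [map_one, mul_one, Complex.conj_I] at e1 e2
  rw [dLaplacian_eq_fderiv]
  rw [hs] at e1
  linear_combination (-1 / 2) * e1 - (Complex.I / 2) * e2 +
    (p/2 - q/2 + fderiv ℝ (fderiv ℝ f) z Complex.I Complex.I / 4) * Complex.I_mul_I

/-! ### The weak biharmonic equation -/

theorem setIntegral_normalizedArea (F : ℂ → ℂ) (s : Set ℂ) :
    ∫ z in s, F z ∂normalizedArea = (1 / Real.pi : ℝ) • ∫ z in s, F z := by
  rw [normalizedArea, Measure.restrict_smul, integral_smul_measure,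
    ENNReal.toReal_ofReal (by positivity)]

/-- The weak equation with Lebesgue measure on the whole plane in place of `dA` on the disk: the
factors `1 / π` cancel. -/
theorem weakBilaplacianEq_iff {Φ g : ℂ → ℂ} :
    WeakBilaplacianEq Φ g ↔ ∀ φ : ℂ → ℂ, ContDiff ℝ ∞ φ → HasCompactSupport φ →
      tsupport φ ⊆ ball (0 : ℂ) 1 →
        ∫ z, Φ z * dLaplacian (dLaplacian φ) z = ∫ z, g z * φ z := by
  have key : ∀ F φ : ℂ → ℂ, tsupport φ ⊆ ball (0 : ℂ) 1 →
      ∫ z in ball (0 : ℂ) 1, F z * φ z ∂normalizedArea =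
        (1 / Real.pi : ℝ) • ∫ z, F z * φ z := by
    intro F φ hφ
    rw [setIntegral_normalizedArea, setIntegral_eq_integral_of_forall_compl_eq_zero]
    intro z hz
    rw [image_eq_zero_of_notMem_tsupport fun h => hz (hφ h), mul_zero]
  refine forall_congr' fun φ => forall_congr' fun _ => forall_congr' fun _ =>
    forall_congr' fun hs => ?_
  rw [key _ _ (((tsupport_dLaplacian_subset _).trans (tsupport_dLaplacian_subset φ)).trans hs),
    key _ _ hs]
  exact (smul_right_injective ℂ (by positivity : (1 / Real.pi : ℝ) ≠ 0)).eq_iff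

theorem integrable_mul_dLaplacian_dLaplacian {Φ φ : ℂ → ℂ} {U : Set ℂ} (hU : IsOpen U)
    (hΦ : ContinuousOn Φ U) (hφ : ContDiff ℝ ∞ φ) (hc : HasCompactSupport φ)
    (hs : tsupport φ ⊆ U) : Integrable fun z => Φ z * dLaplacian (dLaplacian φ) z :=
  hΦ.integrable_mul hU hφ.dLaplacian.dLaplacian.continuous hc.dLaplacian.dLaplacian
    (((tsupport_dLaplacian_subset _).trans (tsupport_dLaplacian_subset φ)).trans hs)

namespace WeakBilaplacianEq

variable {Φ Ψ g k : ℂ → ℂ}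

theorem add (h1 : WeakBilaplacianEq Φ g) (h2 : WeakBilaplacianEq Ψ k)
    (hΦ : ContinuousOn Φ (ball 0 1)) (hΨ : ContinuousOn Ψ (ball 0 1))
    (hg : LocallyIntegrableOn g (ball (0 : ℂ) 1)) (hk : LocallyIntegrableOn k (ball (0 : ℂ) 1)) :
    WeakBilaplacianEq (Φ + Ψ) (g + k) := by
  rw [weakBilaplacianEq_iff] at *
  intro φ hφ hc hs
  simp only [Pi.add_apply, add_mul]
  rw [integral_add (integrable_mul_dLaplacian_dLaplacian isOpen_ball hΦ hφ hc hs)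
    (integrable_mul_dLaplacian_dLaplacian isOpen_ball hΨ hφ hc hs),
    integral_add (hg.integrable_mul hφ.continuous hc hs) (hk.integrable_mul hφ.continuous hc hs),
    h1 φ hφ hc hs, h2 φ hφ hc hs]

theorem const_mul (h1 : WeakBilaplacianEq Φ g) (c : ℂ) :
    WeakBilaplacianEq (fun z => c * Φ z) (fun z => c * g z) := by
  rw [weakBilaplacianEq_iff] at *
  intro φ hφ hc hs
  simp only [mul_assoc, integral_const_mul, h1 φ hφ hc hs]

theorem congr (h1 : WeakBilaplacianEq Φ g) (h : EqOn Φ Ψ (ball 0 1)) : WeakBilaplacianEq Ψ g := by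
  intro φ hφ hc hs
  rw [← h1 φ hφ hc hs]
  exact setIntegral_congr_fun measurableSet_ball fun z hz => by simp only [h hz]

theorem of_contDiffOn (hΦ : ContDiffOn ℝ ∞ Φ (ball 0 1)) :
    WeakBilaplacianEq Φ (dLaplacian (dLaplacian Φ)) := by
  rw [weakBilaplacianEq_iff]
  exact fun φ hφ hc hs => integral_mul_dLaplacian_dLaplacian isOpen_ball hΦ hφ hc hs

end WeakBilaplacianEq

theorem dLaplacian_conj (f : ℂ → ℂ) (z : ℂ) :
    dLaplacian (fun y => (starRingEnd ℂ) (f y)) z = (starRingEnd ℂ) (dLaplacian f z) := by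
  have h := congrFun (InnerProductSpace.laplacian_CLE_comp_left (f := f)
    (l := (Complex.conjCLE : ℂ ≃L[ℝ] ℂ))) z
  simp only [dLaplacian, map_mul, map_div₀, map_one, map_ofNat]
  exact congrArg _ h

theorem contDiff_conj : ContDiff ℝ ∞ fun z : ℂ => (starRingEnd ℂ) z :=
  (Complex.conjCLE : ℂ →L[ℝ] ℂ).contDiff

theorem WeakBilaplacianEq.conj {Φ g : ℂ → ℂ} (h : WeakBilaplacianEq Φ g) :
    WeakBilaplacianEq (fun z => (starRingEnd ℂ) (Φ z)) (fun z => (starRingEnd ℂ) (g z)) := by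
  rw [weakBilaplacianEq_iff] at *
  intro φ hφ hc hs
  have hsub : tsupport (fun z => (starRingEnd ℂ) (φ z)) ⊆ tsupport φ :=
    closure_mono fun z hz => by simpa using hz
  have h1 := h (fun z => (starRingEnd ℂ) (φ z)) (contDiff_conj.comp hφ)
    (hc.of_isClosed_subset (isClosed_tsupport _) hsub) (hsub.trans hs)
  have h2 := congrArg (starRingEnd ℂ) h1
  rw [← integral_conj, ← integral_conj] at h2
  simp only [funext fun z => dLaplacian_conj φ z, dLaplacian_conj, map_mul, Complex.conj_conj] at h2
  exact h2

/-! ### Functions of the form `z̄ⁿ χ(|z|²)` -/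

theorem contDiffAt_conj_pow_mul_radial (n : ℕ) {χ : ℝ → ℂ} {z : ℂ} {m : ℕ∞}
    (hχ : ContDiffAt ℝ m χ (‖z‖ ^ 2)) :
    ContDiffAt ℝ m (fun y => (starRingEnd ℂ) y ^ n * χ (‖y‖ ^ 2)) z :=
  (((contDiff_conj.of_le (by exact_mod_cast le_top)).pow n).contDiffAt).mul
    (hχ.comp z (contDiff_norm_sq ℝ).contDiffAt)

theorem dLaplacian_conj_pow_mul_radial (n : ℕ) {χ χ' : ℝ → ℂ} {χ'' : ℂ} {z : ℂ}
    (hχ : ContDiffAt ℝ 2 χ (‖z‖ ^ 2)) (h1 : ∀ᶠ s in 𝓝 (‖z‖ ^ 2), HasDerivAt χ (χ' s) s)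
    (h2 : HasDerivAt χ' χ'' (‖z‖ ^ 2)) :
    dLaplacian (fun y => (starRingEnd ℂ) y ^ n * χ (‖y‖ ^ 2)) z =
      (starRingEnd ℂ) z ^ n * ((‖z‖ ^ 2 : ℝ) * χ'' + (n + 1) * χ' (‖z‖ ^ 2)) := by
  have hcont : ContinuousAt (fun y : ℂ => ‖y‖ ^ 2) z := by fun_prop
  have hw : ∀ᶠ y in 𝓝 z, HasWirtingerAt (fun y => (starRingEnd ℂ) y ^ n * χ (‖y‖ ^ 2))
      ((starRingEnd ℂ) y ^ (n + 1) * χ' (‖y‖ ^ 2))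
      ((starRingEnd ℂ) y ^ n * (y * χ' (‖y‖ ^ 2)) +
        χ (‖y‖ ^ 2) * (n * (starRingEnd ℂ) y ^ (n - 1))) y := by
    filter_upwards [hcont.eventually h1] with y hy
    exact ((HasWirtingerAt.conj_pow n y).mul (HasWirtingerAt.radial hy)).congr (by ring) rfl
  refine (dLaplacian_eq_of_hasWirtingerAt (contDiffAt_conj_pow_mul_radial n hχ) hw
    ((HasWirtingerAt.conj_pow (n + 1) z).mul (HasWirtingerAt.radial h2))).trans ?_
  have h3 : (starRingEnd ℂ) z * z = ((‖z‖ ^ 2 : ℝ) : ℂ) := by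
    rw [Complex.conj_mul']
    push_cast
    rfl
  push_cast at h3 ⊢
  rw [← h3]
  ring

/-! ### Primitives and quotients of test functions on the half-line -/

theorem hasDerivAt_primitive {f : ℝ → ℂ} (hf : Continuous f) (c s : ℝ) :
    HasDerivAt (fun s => ∫ t in c..s, f t) (f s) s :=
  intervalIntegral.integral_hasDerivAt_right (hf.intervalIntegrable _ _)
    (hf.stronglyMeasurableAtFilter _ _) hf.continuousAt

theorem contDiff_primitive {f : ℝ → ℂ} (hf : ContDiff ℝ ∞ f) (c : ℝ) :
    ContDiff ℝ ∞ (fun s => ∫ t in c..s, f t) := by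
  rw [contDiff_infty_iff_deriv]
  have h := hasDerivAt_primitive hf.continuous c
  refine ⟨fun s => (h s).differentiableAt, ?_⟩
  rwa [funext fun s => (h s).deriv]

theorem contDiff_div_pow {f : ℝ → ℂ} {a : ℝ} (ha : 0 < a) (hf : ContDiff ℝ ∞ f)
    (h0 : ∀ s ≤ a, f s = 0) (m : ℕ) : ContDiff ℝ ∞ fun s : ℝ => f s / (s : ℂ) ^ m := by
  rw [contDiff_iff_contDiffAt]
  intro s
  rcases lt_or_ge s a with hs | hs
  · have : (fun s : ℝ => f s / (s : ℂ) ^ m) =ᶠ[𝓝 s] fun _ => 0 := by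
      filter_upwards [Iio_mem_nhds hs] with t ht
      rw [h0 t (le_of_lt ht), zero_div]
    exact contDiffAt_const.congr_of_eventuallyEq this
  · have h1 : ContDiff ℝ ∞ fun s : ℝ => (s : ℂ) ^ m := Complex.ofRealCLM.contDiff.pow m
    have h2 := h1.contDiffAt.inv (x := s)
      (pow_ne_zero m (Complex.ofReal_ne_zero.2 (ha.trans_le hs).ne'))
    simp only [div_eq_mul_inv]
    exact hf.contDiffAt.mul h2

theorem hasDerivAt_div_pow {f : ℝ → ℂ} {a : ℝ} (ha : 0 < a) (hf : ContDiff ℝ ∞ f)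
    (h0 : ∀ s ≤ a, f s = 0) (m : ℕ) (s : ℝ) :
    HasDerivAt (fun s : ℝ => f s / (s : ℂ) ^ m)
      (deriv f s / (s : ℂ) ^ m - m * (f s / (s : ℂ) ^ (m + 1))) s := by
  rcases lt_or_ge s a with hs | hs
  · have h1 : f =ᶠ[𝓝 s] fun _ => 0 := by
      filter_upwards [Iio_mem_nhds hs] with t ht using h0 t (le_of_lt ht)
    have h2 : (fun s : ℝ => f s / (s : ℂ) ^ m) =ᶠ[𝓝 s] fun _ => 0 := by
      filter_upwards [h1] with t ht
      rw [ht, zero_div]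
    rw [h1.deriv_eq, h1.eq_of_nhds]
    simpa using (hasDerivAt_const s (0 : ℂ)).congr_of_eventuallyEq h2
  · have hs0 : (s : ℂ) ≠ 0 := Complex.ofReal_ne_zero.2 (ha.trans_le hs).ne'
    have h1 : HasDerivAt (fun s : ℝ => (s : ℂ) ^ m) (m * (s : ℂ) ^ (m - 1)) s :=
      (hasDerivAt_pow m (s : ℂ)).comp_ofReal
    refine ((hf.differentiable (by simp) s).hasDerivAt.div h1 (pow_ne_zero _ hs0)).congr_deriv ?_
    rcases m with _ | m
    · simp
    · field_simp
      simp
      ring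

theorem deriv_eq_zero_of_le {f : ℝ → ℂ} {a : ℝ} (h0 : ∀ s ≤ a, f s = 0) (hf : ContDiff ℝ ∞ f) :
    ∀ s ≤ a, deriv f s = 0 := by
  intro s hs
  have hc : Continuous (deriv f) := (contDiff_infty_iff_deriv.1 hf).2.continuous
  have : closure (Iio a) ⊆ {s | deriv f s = 0} := by
    refine closure_minimal (fun t ht => ?_) (isClosed_eq hc continuous_const)
    have : f =ᶠ[𝓝 t] fun _ => 0 := by
      filter_upwards [Iio_mem_nhds ht] with u hu using h0 u (le_of_lt hu)
    simp [this.deriv_eq]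
  rw [closure_Iio] at this
  exact this hs

/-- A test function whose bilaplacian is prescribed: if `Q` is supported in `[a, b] ⊆ (0, ∞)` and
`χ'' = Q / s^(n+2)`, then `Δ² (z̄ⁿ χ(|z|²)) = z̄ⁿ s^(-n) Q''(s)` at `s = |z|²`. -/
theorem exists_radial_test (n : ℕ) {Q : ℝ → ℂ} {a b : ℝ} (ha : 0 < a) (hb : b < 1)
    (hQ : ContDiff ℝ ∞ Q) (hQa : ∀ s ≤ a, Q s = 0) (hQb : ∀ s, b ≤ s → Q s = 0) :
    ∃ χ : ℝ → ℂ, ContDiff ℝ ∞ χ ∧ (∀ s, b ≤ s → χ s = 0) ∧ ∀ z : ℂ,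
      dLaplacian (dLaplacian fun y => (starRingEnd ℂ) y ^ n * χ (‖y‖ ^ 2)) z =
        (starRingEnd ℂ) z ^ n *
          (deriv (deriv Q) (‖z‖ ^ 2) / ((‖z‖ ^ 2 : ℝ) : ℂ) ^ n) := by
  have hQ' : ContDiff ℝ ∞ (deriv Q) := (contDiff_infty_iff_deriv.1 hQ).2
  have hQa' := deriv_eq_zero_of_le hQa hQ
  set p : ℝ → ℂ := fun s => Q s / (s : ℂ) ^ (n + 2) with hp
  have hps : ContDiff ℝ ∞ p := contDiff_div_pow ha hQ hQa _
  set q : ℝ → ℂ := fun s => ∫ t in (1 : ℝ)..s, p t with hq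
  have hqs : ContDiff ℝ ∞ q := contDiff_primitive hps 1
  have hqd : ∀ s, HasDerivAt q (p s) s := hasDerivAt_primitive hps.continuous 1
  set χ : ℝ → ℂ := fun s => ∫ t in (1 : ℝ)..s, q t with hχ
  have hχs : ContDiff ℝ ∞ χ := contDiff_primitive hqs 1
  have hχd : ∀ s, HasDerivAt χ (q s) s := hasDerivAt_primitive hqs.continuous 1
  have hvan : ∀ f : ℝ → ℂ, (∀ s, b ≤ s → f s = 0) → ∀ s, b ≤ s → ∫ t in (1 : ℝ)..s, f t = 0 := by
    intro f hf s hs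
    rw [intervalIntegral.integral_congr (g := fun _ => (0 : ℂ)), intervalIntegral.integral_zero]
    intro t ht
    exact hf t ((le_min hb.le hs).trans ht.1)
  have hpb : ∀ s, b ≤ s → p s = 0 := fun s hs => by simp [hp, hQb s hs]
  refine ⟨χ, hχs, hvan q (hvan p hpb), fun z => ?_⟩
  -- one Laplacian leaves the profile `ρ = s χ'' + (n + 1) χ'`, for which `ρ' = Q' / s^(n+1)`
  set ρ : ℝ → ℂ := fun s => Q s / (s : ℂ) ^ (n + 1) + (n + 1) * q s with hρ
  have hρs : ContDiff ℝ ∞ ρ := (contDiff_div_pow ha hQ hQa _).add (contDiff_const.mul hqs)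
  have hρd : ∀ s, HasDerivAt ρ (deriv Q s / (s : ℂ) ^ (n + 1)) s := by
    intro s
    refine ((hasDerivAt_div_pow ha hQ hQa (n + 1) s).add ((hqd s).const_mul _)).congr_deriv ?_
    simp only [hp]
    push_cast
    ring
  have h1 : (dLaplacian fun y => (starRingEnd ℂ) y ^ n * χ (‖y‖ ^ 2)) =
      fun y => (starRingEnd ℂ) y ^ n * ρ (‖y‖ ^ 2) := by
    ext y
    rw [dLaplacian_conj_pow_mul_radial n ((contDiff_infty.1 hχs 2).contDiffAt)
      (Eventually.of_forall hχd) (hqd _)]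
    rcases eq_or_ne y 0 with rfl | hy
    · simp [hρ, hQa 0 ha.le]
    · have : ((‖y‖ : ℝ) : ℂ) ≠ 0 := by simpa using hy
      simp only [hρ, hp]
      push_cast
      congr 2
      field_simp
      ring
  rw [h1, dLaplacian_conj_pow_mul_radial n ((contDiff_infty.1 hρs 2).contDiffAt)
    (Eventually.of_forall hρd) (hasDerivAt_div_pow ha hQ' hQa' (n + 1) _)]
  rcases eq_or_ne z 0 with rfl | hz
  · simp [hQa' 0 ha.le, deriv_eq_zero_of_le hQa' hQ' 0 ha.le]
  · have : ((‖z‖ : ℝ) : ℂ) ≠ 0 := by simpa using hz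
    congr 1
    push_cast
    field_simp
    ring

/-! ### The second-order du Bois-Reymond lemma -/

theorem IsCompact.exists_subset_Icc_of_subset_Ioo {K : Set ℝ} (hK : IsCompact K) {c d : ℝ}
    (hcd : c < d) (hs : K ⊆ Ioo c d) : ∃ a b, c < a ∧ a ≤ b ∧ b < d ∧ K ⊆ Icc a b := by
  obtain ⟨m, hm⟩ := exists_between hcd
  have hK' : IsCompact (insert m K) := hK.insert m
  have hs' : insert m K ⊆ Ioo c d := insert_subset hm hs
  obtain ⟨a, ha, ha'⟩ := hK'.exists_isLeast ⟨m, mem_insert _ _⟩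
  obtain ⟨b, hb, hb'⟩ := hK'.exists_isGreatest ⟨m, mem_insert _ _⟩
  exact ⟨a, b, (hs' ha).1, ha' hb, (hs' hb).2, fun x hx =>
    ⟨ha' (mem_insert_of_mem _ hx), hb' (mem_insert_of_mem _ hx)⟩⟩

/-- The test functions on the interval `(0, 1)`. -/
def intervalTest : Submodule ℂ (ℝ → ℂ) where
  carrier := {η | ContDiff ℝ ∞ η ∧ HasCompactSupport η ∧ tsupport η ⊆ Ioo 0 1}
  zero_mem' := ⟨contDiff_const, HasCompactSupport.zero, by simp [tsupport]⟩
  add_mem' := fun ha hb => ⟨ha.1.add hb.1, ha.2.1.add hb.2.1,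
    (tsupport_add _ _).trans (union_subset ha.2.2 hb.2.2)⟩
  smul_mem' := fun c _ ha => ⟨contDiff_const.smul ha.1, ha.2.1.smul_left,
    (tsupport_smul_subset_right (fun _ => c) _).trans ha.2.2⟩

theorem integrable_mul_intervalTest {B : ℝ → ℂ} (hB : ContinuousOn B (Ioo 0 1)) {η : ℝ → ℂ}
    (hη : η ∈ intervalTest) : Integrable fun s => B s * η s := by
  have h1 : IntegrableOn (fun z => B z * η z) (tsupport η) :=
    ((hB.mono hη.2.2).mul hη.1.continuous.continuousOn).integrableOn_compact hη.2.1
  refine (integrableOn_iff_integrable_of_support_subset fun z hz => ?_).1 h1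
  exact subset_tsupport _ (right_ne_zero_of_mul hz)

/-- Integration against a function continuous on `(0, 1)`. -/
noncomputable def intervalMoment (B : ℝ → ℂ) (hB : ContinuousOn B (Ioo 0 1)) :
    intervalTest →ₗ[ℂ] ℂ where
  toFun η := ∫ s, B s * (η : ℝ → ℂ) s
  map_add' η ξ := by
    simp only [Submodule.coe_add, Pi.add_apply, mul_add]
    exact integral_add (integrable_mul_intervalTest hB η.2) (integrable_mul_intervalTest hB ξ.2)
  map_smul' c η := by
    simp only [Submodule.coe_smul, Pi.smul_apply, smul_eq_mul, RingHom.id_apply,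
      ← integral_const_mul]
    exact integral_congr_ae (Eventually.of_forall fun s => by ring)

theorem exists_intervalTest_deriv_eq {η : ℝ → ℂ} (hη : η ∈ intervalTest) (h0 : ∫ s, η s = 0) :
    ∃ P ∈ intervalTest, deriv P = η := by
  obtain ⟨a, b, ha, hab, hb, hK⟩ := hη.2.1.exists_subset_Icc_of_subset_Ioo one_pos hη.2.2
  have hz : ∀ s, s ∉ Icc a b → η s = 0 := fun s hs =>
    image_eq_zero_of_notMem_tsupport fun h => hs (hK h)
  have hd := hasDerivAt_primitive hη.1.continuous a
  have hsub : tsupport (fun s => ∫ t in a..s, η t) ⊆ Icc a b := by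
    refine closure_minimal (fun s hs => ?_) isClosed_Icc
    by_contra hsI
    refine hs ?_
    rcases lt_or_ge s a with hsa | hsa
    · simp only
      rw [intervalIntegral.integral_symm, neg_eq_zero,
        intervalIntegral.integral_of_le hsa.le, integral_Ioc_eq_integral_Ioo,
        setIntegral_eq_zero_of_forall_eq_zero]
      exact fun t ht => hz t fun h => not_lt.2 h.1 ht.2
    · have hbs : b < s := by
        by_contra h
        exact hsI ⟨hsa, not_lt.1 h⟩
      simp only
      rw [intervalIntegral.integral_of_le hsa, ← integral_Icc_eq_integral_Ioc,
        setIntegral_eq_integral_of_forall_compl_eq_zero, h0]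
      exact fun t ht => hz t fun h => ht ⟨h.1, h.2.trans hbs.le⟩
  exact ⟨fun s => ∫ t in a..s, η t, ⟨contDiff_primitive hη.1 a,
    isCompact_Icc.of_isClosed_subset (isClosed_tsupport _) hsub,
    hsub.trans fun t ht => ⟨ha.trans_le ht.1, ht.2.trans_lt hb⟩⟩, funext fun s => (hd s).deriv⟩

/-- A continuous function with vanishing second derivative in the sense of distributions is affine.
A test function with vanishing moments of order `0` and `1` is the second derivative of a test
function, so the functional "integrate against `B`" is a combination of these two moments. -/
theorem exists_affine_of_integral_mul_deriv_deriv_eq_zero {B : ℝ → ℂ}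
    (hB : ContinuousOn B (Ioo 0 1))
    (h : ∀ Q ∈ intervalTest, ∫ s, B s * deriv (deriv Q) s = 0) :
    ∃ c d : ℂ, ∀ s ∈ Ioo (0 : ℝ) 1, B s = c + d * s := by
  have h1c : ContinuousOn (fun _ : ℝ => (1 : ℂ)) (Ioo 0 1) := continuousOn_const
  have hidc : ContinuousOn (fun s : ℝ => (s : ℂ)) (Ioo 0 1) :=
    Complex.continuous_ofReal.continuousOn
  set L : Fin 2 → intervalTest →ₗ[ℂ] ℂ := ![intervalMoment _ h1c, intervalMoment _ hidc] with hL
  have hker : ⨅ i, LinearMap.ker (L i) ≤ LinearMap.ker (intervalMoment B hB) := by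
    intro η hη
    have e0 : ∫ s, (1 : ℂ) * (η : ℝ → ℂ) s = 0 := (Submodule.mem_iInf _).1 hη 0
    have e1 : ∫ s, ((s : ℝ) : ℂ) * (η : ℝ → ℂ) s = 0 := (Submodule.mem_iInf _).1 hη 1
    simp only [one_mul] at e0
    obtain ⟨P, hP, hPη⟩ := exists_intervalTest_deriv_eq η.2 e0
    have hPd : ∀ s, HasDerivAt P ((η : ℝ → ℂ) s) s := fun s => by
      rw [← hPη]
      exact (hP.1.differentiable (by simp) s).hasDerivAt
    have e2 : ∫ s, P s = 0 := by
      have := integral_mul_deriv_eq_deriv_mul_of_integrable (u := fun s : ℝ => (s : ℂ)) (v := P)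
        (u' := fun _ => 1) (v' := η) (fun s _ => (hasDerivAt_id s).ofReal_comp) (fun s _ => hPd s)
        (integrable_mul_intervalTest hidc η.2) (integrable_mul_intervalTest h1c hP)
        (integrable_mul_intervalTest hidc hP)
      rw [e1] at this
      simpa using this.symm
    obtain ⟨Q, hQ, hQP⟩ := exists_intervalTest_deriv_eq hP e2
    have := h Q hQ
    rw [hQP, hPη] at this
    exact this
  obtain ⟨c, hc⟩ := (Submodule.mem_span_range_iff_exists_fun ℂ).1
    (mem_span_of_iInf_ker_le_ker hker)
  have hCc : ContinuousOn (fun s : ℝ => B s - (c 0 + c 1 * s)) (Ioo 0 1) :=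
    hB.sub (continuousOn_const.add (continuousOn_const.mul hidc))
  have hae : ∀ᵐ s : ℝ, s ∈ Ioo (0 : ℝ) 1 → B s - (c 0 + c 1 * s) = 0 := by
    refine isOpen_Ioo.ae_eq_zero_of_integral_contDiff_smul_eq_zero
      (hCc.locallyIntegrableOn measurableSet_Ioo) fun g hg hgc hgs => ?_
    have hsub : tsupport (fun s => (g s : ℂ)) ⊆ tsupport g :=
      closure_mono fun s hs => by simpa using hs
    have hη : (fun s => (g s : ℂ)) ∈ intervalTest :=
      ⟨Complex.ofRealCLM.contDiff.comp hg,
        hgc.of_isClosed_subset (isClosed_tsupport _) hsub, hsub.trans hgs⟩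
    have e := LinearMap.congr_fun hc ⟨_, hη⟩
    have e' : c 0 * (∫ s : ℝ, (1 : ℂ) * (g s : ℂ)) + c 1 * ∫ s : ℝ, (s : ℂ) * (g s : ℂ) =
        ∫ s : ℝ, B s * (g s : ℂ) := by
      simpa [hL, Fin.sum_univ_two, intervalMoment] using e
    have i0 := integrable_mul_intervalTest h1c hη
    have i1 := integrable_mul_intervalTest hidc hη
    have iB := integrable_mul_intervalTest hB hη
    rw [← integral_const_mul, ← integral_const_mul, ← integral_add (i0.const_mul _)
      (i1.const_mul _)] at e'
    have i2 : Integrable fun s : ℝ => c 0 * (1 * (g s : ℂ)) + c 1 * ((s : ℂ) * (g s : ℂ)) :=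
      (i0.const_mul _).add (i1.const_mul _)
    rw [← sub_eq_zero, ← integral_sub i2 iB] at e'
    rw [← neg_eq_zero, ← integral_neg, ← e']
    refine integral_congr_ae (Eventually.of_forall fun s => ?_)
    simp only [Complex.real_smul]
    ring
  refine ⟨c 0, c 1, fun s hs => ?_⟩
  have h2 := Measure.eqOn_open_of_ae_eq (μ := volume) (f := fun s : ℝ => B s - (c 0 + c 1 * s))
    (g := fun _ => 0) (U := Ioo (0 : ℝ) 1)
    ((ae_restrict_iff' measurableSet_Ioo).2 hae) isOpen_Ioo hCc continuousOn_const
  exact sub_eq_zero.1 (h2 hs)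

/-! ### Circle means in polar coordinates -/

theorem integral_eq_polar {F : ℂ → ℂ} (hF : Continuous F) (hc : HasCompactSupport F) :
    ∫ z, F z = ∫ r in Ioi (0 : ℝ), r * ∫ θ in (0 : ℝ)..(2 * Real.pi),
      F (r * Complex.exp (θ * Complex.I)) := by
  have hexp : ∀ p : ℝ × ℝ, Complex.polarCoord.symm p = p.1 * Complex.exp (p.2 * Complex.I) := by
    intro p
    rw [Complex.polarCoord_symm_apply, Complex.exp_mul_I]
    push_cast
    rfl
  rw [← Complex.integral_comp_polarCoord_symm]
  simp only [hexp, polarCoord_target]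
  obtain ⟨R, hR⟩ := hc.isBounded.subset_closedBall (0 : ℂ)
  have hcont : Continuous fun p : ℝ × ℝ => p.1 • F (p.1 * Complex.exp (p.2 * Complex.I)) := by
    fun_prop
  have hint : IntegrableOn (fun p : ℝ × ℝ => p.1 • F (p.1 * Complex.exp (p.2 * Complex.I)))
      (Ioi 0 ×ˢ Ioo (-Real.pi) Real.pi) := by
    have h1 : IntegrableOn (fun p : ℝ × ℝ => p.1 • F (p.1 * Complex.exp (p.2 * Complex.I)))
        (Icc 0 R ×ˢ Icc (-Real.pi) Real.pi) :=
      hcont.continuousOn.integrableOn_compact (isCompact_Icc.prod isCompact_Icc)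
    refine h1.of_forall_sdiff_eq_zero (measurableSet_Ioi.prod measurableSet_Ioo) fun p hp => ?_
    have : R < p.1 := by
      by_contra h
      exact hp.2 ⟨⟨le_of_lt hp.1.1, not_lt.1 h⟩, Ioo_subset_Icc_self hp.1.2⟩
    rw [image_eq_zero_of_notMem_tsupport (f := F), smul_zero]
    intro h
    have := hR h
    rw [mem_closedBall_zero_iff, norm_mul, Complex.norm_exp_ofReal_mul_I, mul_one,
      Complex.norm_real, Real.norm_eq_abs] at this
    exact absurd (le_abs_self p.1) (by linarith)
  rw [Measure.volume_eq_prod] at hint ⊢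
  rw [setIntegral_prod _ hint]
  refine setIntegral_congr_fun measurableSet_Ioi fun r _ => ?_
  have hper : Function.Periodic (fun θ : ℝ => F (r * Complex.exp (θ * Complex.I)))
      (2 * Real.pi) := by
    intro θ
    have : Complex.exp (((θ + 2 * Real.pi : ℝ) : ℂ) * Complex.I) =
        Complex.exp (θ * Complex.I) := by
      rw [← Complex.exp_periodic (θ * Complex.I)]
      congr 1
      push_cast
      ring
    simp only [this]
  have h2 := hper.intervalIntegral_add_eq (-Real.pi) 0
  rw [zero_add, show -Real.pi + 2 * Real.pi = Real.pi by ring] at h2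
  simp only [Complex.real_smul]
  rw [integral_const_mul, ← h2, intervalIntegral.integral_of_le (by linarith [Real.pi_pos]),
    integral_Ioc_eq_integral_Ioo]

/-- The test function `e^{iθ} ↦ e^{inθ}` on the circle. -/
noncomputable def circleMode (n : ℤ) : CircleTest :=
  ⟨fun θ : ℝ => Complex.exp (n * θ * Complex.I),
    ((contDiff_const.mul Complex.ofRealCLM.contDiff).mul contDiff_const).cexp, fun θ => by
      have h := (Complex.exp_periodic.int_mul n) (n * θ * Complex.I)
      have e : (n * ((θ + 2 * Real.pi : ℝ) : ℂ)) * Complex.I =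
          n * θ * Complex.I + n * (2 * Real.pi * Complex.I) := by
        push_cast
        ring
      change Complex.exp (n * ((θ + 2 * Real.pi : ℝ) : ℂ) * Complex.I) = _
      rw [e, h]⟩

theorem circleMode_apply (n : ℤ) (θ : ℝ) :
    (circleMode n : ℝ → ℂ) θ = Complex.exp (n * θ * Complex.I) := rfl

theorem circleMode_eq_pow (n : ℕ) (θ : ℝ) :
    (circleMode n : ℝ → ℂ) θ = Complex.exp (θ * Complex.I) ^ n := by
  rw [circleMode_apply, ← Complex.exp_nat_mul]
  congr 1
  push_cast
  ring

theorem conj_circleMode (n : ℤ) (θ : ℝ) :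
    (starRingEnd ℂ) ((circleMode n : ℝ → ℂ) θ) = (circleMode (-n) : ℝ → ℂ) θ := by
  rw [circleMode_apply, circleMode_apply, ← Complex.exp_conj]
  congr 1
  simp

theorem circleMode_neg_eq_pow (n : ℕ) (θ : ℝ) :
    (circleMode (-n) : ℝ → ℂ) θ = (starRingEnd ℂ) (Complex.exp (θ * Complex.I)) ^ n := by
  rw [← conj_circleMode, circleMode_eq_pow, map_pow]

theorem norm_circle_mul {r : ℝ} (hr : 0 ≤ r) (θ : ℝ) :
    ‖(r : ℂ) * Complex.exp (θ * Complex.I)‖ = r := by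
  rw [norm_mul, Complex.norm_exp_ofReal_mul_I, mul_one, Complex.norm_real, Real.norm_eq_abs,
    abs_of_nonneg hr]

theorem circle_mul_mem_ball {r : ℝ} (hr : r ∈ Ico (0 : ℝ) 1) (θ : ℝ) :
    (r : ℂ) * Complex.exp (θ * Complex.I) ∈ ball (0 : ℂ) 1 := by
  rw [mem_ball_zero_iff, norm_circle_mul hr.1]
  exact hr.2

theorem continuous_circle_slice {Φ : ℂ → ℂ} (hΦ : ContinuousOn Φ (ball 0 1)) {r : ℝ}
    (hr : r ∈ Ico (0 : ℝ) 1) : Continuous fun θ : ℝ => Φ (r * Complex.exp (θ * Complex.I)) :=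
  hΦ.comp_continuous (by fun_prop) (circle_mul_mem_ball hr)

theorem continuousOn_dilatePairing {Φ : ℂ → ℂ} (hΦ : ContinuousOn Φ (ball 0 1)) (φ : CircleTest) :
    ContinuousOn (fun r => dilatePairing Φ r φ) (Ioo 0 1) := by
  intro r hr
  obtain ⟨R, hrR, hR⟩ := exists_between hr.2
  have hR0 : (0 : ℝ) ≤ R := hr.1.le.trans hrR.le
  -- on `[0, R]` the pairing agrees with that of the globally continuous `t ↦ Φ_{proj t}`
  have hcont : Continuous fun t : ℝ => ∫ θ in (0 : ℝ)..(2 * Real.pi),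
      Φ ((projIcc 0 R hR0 t : ℝ) * Complex.exp (θ * Complex.I)) * (φ : ℝ → ℂ) θ := by
    refine intervalIntegral.continuous_parametric_intervalIntegral_of_continuous' ?_ _ _
    refine Continuous.mul (hΦ.comp_continuous ?_ fun p => ?_) ?_
    · have := continuous_projIcc (h := hR0)
      fun_prop
    · exact circle_mul_mem_ball ⟨(projIcc 0 R hR0 p.1).2.1,
        (projIcc 0 R hR0 p.1).2.2.trans_lt hR⟩ _
    · exact φ.2.1.continuous.comp continuous_snd
  have heq : (fun t => dilatePairing Φ t φ) =ᶠ[𝓝 r] fun t => (1 / (2 * Real.pi) : ℂ) *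
      ∫ θ in (0 : ℝ)..(2 * Real.pi),
        Φ ((projIcc 0 R hR0 t : ℝ) * Complex.exp (θ * Complex.I)) * (φ : ℝ → ℂ) θ := by
    filter_upwards [Ioo_mem_nhds hr.1 hrR] with t ht
    simp only [dilatePairing, projIcc_of_mem hR0 (Ioo_subset_Icc_self ht)]
  exact ((continuous_const.mul hcont).continuousAt.congr heq.symm).continuousWithinAt

/-! ### Fourier coefficients of solutions with zero data -/

/-- The nonpositive Fourier coefficients of a weakly biharmonic function on the circle of radius
`r` are `rⁿ (c + d r²)`. -/
theorem WeakBilaplacianEq.exists_dilatePairing_eq {Φ : ℂ → ℂ} (hΦ : ContinuousOn Φ (ball 0 1))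
    (hw : WeakBilaplacianEq Φ 0) (n : ℕ) :
    ∃ c d : ℂ, ∀ r ∈ Ioo (0 : ℝ) 1,
      dilatePairing Φ r (circleMode (-n)) = r ^ n * (c + d * r ^ 2) := by
  set B : ℝ → ℂ := fun s => dilatePairing Φ (√s) (circleMode (-n)) / ((√s : ℝ) : ℂ) ^ n with hB
  have hBc : ContinuousOn B (Ioo 0 1) := by
    refine ContinuousOn.div ((continuousOn_dilatePairing hΦ _).comp
      Real.continuous_sqrt.continuousOn fun s hs => ⟨Real.sqrt_pos.2 hs.1, ?_⟩)
      (by fun_prop) fun s hs => pow_ne_zero _ (Complex.ofReal_ne_zero.2 (Real.sqrt_pos.2 hs.1).ne')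
    rw [Real.sqrt_lt' one_pos]
    simpa using hs.2
  obtain ⟨c, d, hcd⟩ := exists_affine_of_integral_mul_deriv_deriv_eq_zero hBc fun Q hQ => by
    obtain ⟨a, b, ha, hab, hb, hK⟩ := hQ.2.1.exists_subset_Icc_of_subset_Ioo one_pos hQ.2.2
    have hQz : ∀ s, s ∉ tsupport Q → deriv (deriv Q) s = 0 := fun s hs => by
      have h1 : tsupport (deriv (deriv Q)) ⊆ tsupport Q :=
        tsupport_deriv_subset.trans tsupport_deriv_subset
      exact image_eq_zero_of_notMem_tsupport fun h => hs (h1 h)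
    have hQa : ∀ s ≤ a, Q s = 0 := by
      intro s hs
      have h1 : closure (Iio a) ⊆ {s | Q s = 0} :=
        closure_minimal (fun t ht => image_eq_zero_of_notMem_tsupport fun h =>
          not_lt.2 (hK h).1 ht) (isClosed_eq hQ.1.continuous continuous_const)
      rw [closure_Iio] at h1
      exact h1 hs
    have hQb : ∀ s, b ≤ s → Q s = 0 := by
      intro s hs
      have h1 : closure (Ioi b) ⊆ {s | Q s = 0} :=
        closure_minimal (fun t ht => image_eq_zero_of_notMem_tsupport fun h =>
          not_lt.2 (hK h).2 ht) (isClosed_eq hQ.1.continuous continuous_const)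
      rw [closure_Ioi] at h1
      exact h1 hs
    obtain ⟨χ, hχ, hχb, hχL⟩ := exists_radial_test n ha hb hQ.1 hQa hQb
    set φ : ℂ → ℂ := fun y => (starRingEnd ℂ) y ^ n * χ (‖y‖ ^ 2) with hφ
    have hφs : ContDiff ℝ ∞ φ := contDiff_iff_contDiffAt.2 fun z =>
      contDiffAt_conj_pow_mul_radial n (m := ⊤) hχ.contDiffAt
    have hφsub : tsupport φ ⊆ closedBall 0 (√b) := by
      refine closure_minimal (fun z hz => ?_) isClosed_closedBall
      by_contra h
      rw [mem_closedBall_zero_iff, not_le, Real.sqrt_lt' ((Real.sqrt_nonneg _).trans_lt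
        (by simpa using h))] at h
      exact hz (by simp [hφ, hχb _ h.le])
    have hb1 : √b < 1 := by
      rw [Real.sqrt_lt' one_pos]
      simpa using hb
    have hφball : tsupport φ ⊆ ball 0 1 := hφsub.trans (closedBall_subset_ball hb1)
    have hφc : HasCompactSupport φ :=
      (isCompact_closedBall _ _).of_isClosed_subset (isClosed_tsupport _) hφsub
    have h0 := weakBilaplacianEq_iff.1 hw φ hφs hφc hφball
    simp only [Pi.zero_apply, zero_mul, integral_zero] at h0
    have hFs : tsupport (fun z => Φ z * dLaplacian (dLaplacian φ) z) ⊆ tsupport φ :=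
      (tsupport_mul_subset_right (f := Φ)).trans
        ((tsupport_dLaplacian_subset _).trans (tsupport_dLaplacian_subset φ))
    have hFc : Continuous fun z => Φ z * dLaplacian (dLaplacian φ) z := by
      refine continuous_of_tsupport fun z hz => ?_
      exact (hΦ.continuousAt (isOpen_ball.mem_nhds (hφball (hFs hz)))).mul
        hφs.dLaplacian.dLaplacian.continuous.continuousAt
    rw [integral_eq_polar hFc (hφc.of_isClosed_subset (isClosed_tsupport _) hFs)] at h0
    have h1 : ∀ r ∈ Ioi (0 : ℝ), r * ∫ θ in (0 : ℝ)..(2 * Real.pi),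
        Φ (r * Complex.exp (θ * Complex.I)) *
          dLaplacian (dLaplacian φ) (r * Complex.exp (θ * Complex.I)) =
        Real.pi * ((2 * r ^ ((2 : ℝ) - 1)) •
          (B (r ^ (2 : ℝ)) * deriv (deriv Q) (r ^ (2 : ℝ)))) := by
      intro r hr
      have hr0 : (r : ℂ) ≠ 0 := Complex.ofReal_ne_zero.2 (ne_of_gt hr)
      have hpi : (Real.pi : ℂ) ≠ 0 := Complex.ofReal_ne_zero.2 Real.pi_ne_zero
      have h2 : ∀ θ : ℝ, Φ (r * Complex.exp (θ * Complex.I)) *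
          dLaplacian (dLaplacian φ) (r * Complex.exp (θ * Complex.I)) =
          (deriv (deriv Q) (r ^ 2) / (r : ℂ) ^ n) *
          (Φ (r * Complex.exp (θ * Complex.I)) * (circleMode (-n) : ℝ → ℂ) θ) := by
        intro θ
        rw [hχL, norm_circle_mul (le_of_lt hr), circleMode_neg_eq_pow, map_mul, mul_pow,
          Complex.conj_ofReal]
        push_cast
        field_simp
        ring
      have h3 : ∫ θ in (0 : ℝ)..(2 * Real.pi), Φ (r * Complex.exp (θ * Complex.I)) *
          (circleMode (-n) : ℝ → ℂ) θ = 2 * Real.pi * dilatePairing Φ r (circleMode (-n)) := by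
        rw [dilatePairing, ← mul_assoc, mul_one_div_cancel (mul_ne_zero two_ne_zero hpi), one_mul]
      simp only [h2]
      rw [intervalIntegral.integral_const_mul, h3]
      norm_num
      simp only [hB, Real.sqrt_sq (le_of_lt hr)]
      field_simp
    rw [setIntegral_congr_fun measurableSet_Ioi h1, integral_const_mul,
      integral_comp_rpow_Ioi_of_pos (g := fun s => B s * deriv (deriv Q) s) two_pos,
      mul_eq_zero, or_iff_right (Complex.ofReal_ne_zero.2 Real.pi_ne_zero)] at h0
    rwa [setIntegral_eq_integral_of_forall_compl_eq_zero] at h0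
    intro s hs
    rw [hQz s fun h => hs (ha.trans_le (hK h).1), mul_zero]
  refine ⟨c, d, fun r hr => ?_⟩
  have h := hcd (r ^ 2) ⟨pow_pos hr.1 2, pow_lt_one₀ hr.1.le hr.2 two_ne_zero⟩
  have hr0 : (r : ℂ) ^ n ≠ 0 := pow_ne_zero _ (Complex.ofReal_ne_zero.2 hr.1.ne')
  simp only [hB, Real.sqrt_sq hr.1.le] at h
  rw [div_eq_iff hr0] at h
  rw [h]
  push_cast
  ring

theorem eventually_mem_Ioo_nhdsLT_one : ∀ᶠ r in 𝓝[<] (1 : ℝ), r ∈ Ioo (0 : ℝ) 1 :=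
  Ioo_mem_nhdsLT one_pos

/-- The boundary conditions force `c + d = 0` and `2 c = 0` in the formula `rⁿ (c + d r²)`. -/
theorem SolvesBiharmonicDirichlet.dilatePairing_neg_eq_zero {Φ : ℂ → ℂ}
    (h : SolvesBiharmonicDirichlet 0 0 0 Φ) (n : ℕ) {r : ℝ} (hr : r ∈ Ioo (0 : ℝ) 1) :
    dilatePairing Φ r (circleMode (-n)) = 0 := by
  obtain ⟨c, d, hcd⟩ := h.bilaplacian.exists_dilatePairing_eq h.continuousOn n
  have hco : Tendsto (fun r : ℝ => (r : ℂ)) (𝓝[<] 1) (𝓝 1) :=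
    (Complex.continuous_ofReal.tendsto' 1 1 (by simp)).mono_left nhdsWithin_le_nhds
  have h1 : Tendsto (fun r : ℝ => (r : ℂ) ^ n * (c + d * (r : ℂ) ^ 2)) (𝓝[<] 1)
      (𝓝 (1 ^ n * (c + d * 1 ^ 2))) := (hco.pow n).mul ((hco.pow 2).const_mul d |>.const_add c)
  have h2 : Tendsto (fun r : ℝ => dilatePairing Φ r (circleMode (-n))) (𝓝[<] 1) (𝓝 0) :=
    h.boundaryValue (circleMode (-n))
  have hd : d = -c := by
    have := tendsto_nhds_unique (h1.congr' (eventually_mem_Ioo_nhdsLT_one.mono fun r hr =>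
      (hcd r hr).symm)) h2
    simp only [one_pow, one_mul, mul_one] at this
    exact (neg_eq_of_add_eq_zero_right this).symm
  have h3 : Tendsto (fun r : ℝ => (r : ℂ) ^ n * (c * (1 + r))) (𝓝[<] 1)
      (𝓝 (1 ^ n * (c * (1 + 1)))) := (hco.pow n).mul ((hco.const_add 1).const_mul c)
  have h4 : Tendsto (fun r : ℝ => (dilatePairing Φ r (circleMode (-n)) - 0) / (1 - r : ℂ))
      (𝓝[<] 1) (𝓝 0) := h.normalDerivative (circleMode (-n))
  have hc : c = 0 := by
    have := tendsto_nhds_unique (h3.congr' (eventually_mem_Ioo_nhdsLT_one.mono fun r hr => ?_)) h4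
    · simpa [one_add_one_eq_two] using this
    · have h5 : (1 - r : ℂ) ≠ 0 := sub_ne_zero.2 (by exact_mod_cast hr.2.ne')
      rw [hcd r hr, hd, sub_zero, eq_div_iff h5]
      ring
  rw [hcd r hr, hd, hc]
  simp

theorem SolvesBiharmonicDirichlet.conj {Φ : ℂ → ℂ} (h : SolvesBiharmonicDirichlet 0 0 0 Φ) :
    SolvesBiharmonicDirichlet 0 0 0 fun z => (starRingEnd ℂ) (Φ z) := by
  have key : ∀ (φ : CircleTest), ∃ ψ : CircleTest, ∀ r,
      dilatePairing (fun z => (starRingEnd ℂ) (Φ z)) r φ =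
        (starRingEnd ℂ) (dilatePairing Φ r ψ) := by
    intro φ
    refine ⟨⟨fun θ => (starRingEnd ℂ) ((φ : ℝ → ℂ) θ), contDiff_conj.comp φ.2.1,
      fun θ => congrArg _ (φ.2.2 θ)⟩, fun r => ?_⟩
    simp only [dilatePairing, map_mul, map_div₀, map_one, map_ofNat, Complex.conj_ofReal]
    rw [intervalIntegral.integral_of_le (by positivity),
      intervalIntegral.integral_of_le (by positivity), ← integral_conj]
    simp
  refine ⟨h.locallyIntegrable_rhs, Complex.continuous_conj.comp_continuousOn h.continuousOn, ?_,
    fun φ => ?_, fun φ => ?_⟩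
  · have := h.bilaplacian.conj
    simp only [Pi.zero_apply, map_zero] at this
    exact this
  · obtain ⟨ψ, hψ⟩ := key φ
    simp only [hψ]
    have h1 : Tendsto (fun r => dilatePairing Φ r ψ) (𝓝[<] 1) (𝓝 0) := h.boundaryValue ψ
    have h2 := (Complex.continuous_conj.tendsto 0).comp h1
    rw [map_zero] at h2
    exact h2
  · obtain ⟨ψ, hψ⟩ := key φ
    simp only [hψ]
    have h1 : Tendsto (fun r : ℝ => (dilatePairing Φ r ψ - 0) / (1 - r : ℂ)) (𝓝[<] 1) (𝓝 0) :=
      h.normalDerivative ψ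
    have h2 := (Complex.continuous_conj.tendsto 0).comp h1
    rw [map_zero] at h2
    refine h2.congr fun r => ?_
    simp

theorem SolvesBiharmonicDirichlet.dilatePairing_eq_zero {Φ : ℂ → ℂ}
    (h : SolvesBiharmonicDirichlet 0 0 0 Φ) (n : ℤ) {r : ℝ} (hr : r ∈ Ioo (0 : ℝ) 1) :
    dilatePairing Φ r (circleMode n) = 0 := by
  obtain ⟨m, rfl | rfl⟩ := n.eq_nat_or_neg
  · have h1 := congrArg (starRingEnd ℂ) (h.conj.dilatePairing_neg_eq_zero m hr)
    simp only [dilatePairing, map_mul, map_div₀, map_one, map_ofNat, Complex.conj_ofReal,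
      map_zero] at h1
    rw [intervalIntegral.integral_of_le (by positivity), ← integral_conj] at h1
    simp only [map_mul, Complex.conj_conj, conj_circleMode, neg_neg] at h1
    rw [dilatePairing, intervalIntegral.integral_of_le (by positivity)]
    exact h1
  · exact h.dilatePairing_neg_eq_zero m hr

/-! ### Fourier series of test functions and distributions on the circle -/

/-- The Fourier coefficient `(1/2π) ∫₀^{2π} φ(θ) e^{-inθ} dθ`. -/
noncomputable def circleCoeff (φ : ℝ → ℂ) (n : ℤ) : ℂ :=
  (1 / (2 * Real.pi) : ℂ) * ∫ θ in (0 : ℝ)..(2 * Real.pi), φ θ * (circleMode (-n) : ℝ → ℂ) θ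

theorem dilatePairing_circleMode (Φ : ℂ → ℂ) (r : ℝ) (n : ℤ) :
    dilatePairing Φ r (circleMode n) =
      circleCoeff (fun θ => Φ (r * Complex.exp (θ * Complex.I))) (-n) := by
  rw [circleCoeff, neg_neg, dilatePairing]

theorem norm_circleMode (n : ℤ) (θ : ℝ) : ‖(circleMode n : ℝ → ℂ) θ‖ = 1 := by
  rw [circleMode_apply]
  convert Complex.norm_exp_ofReal_mul_I (n * θ) using 3
  push_cast
  rfl

theorem hasDerivAt_circleMode (n : ℤ) (θ : ℝ) :
    HasDerivAt (circleMode n : ℝ → ℂ) (Complex.I * n * (circleMode n : ℝ → ℂ) θ) θ := by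
  have h : HasDerivAt (fun z : ℂ => Complex.exp (n * z * Complex.I))
      (Complex.exp (n * θ * Complex.I) * (n * 1 * Complex.I)) θ :=
    (((hasDerivAt_id (θ : ℂ)).const_mul (n : ℂ)).mul_const Complex.I).cexp
  refine h.comp_ofReal.congr_deriv ?_
  rw [circleMode_apply]
  ring

instance fact_two_pi_pos : Fact (0 < 2 * Real.pi) := ⟨Real.two_pi_pos⟩

theorem fourier_coe_eq_circleMode (n : ℤ) (θ : ℝ) :
    fourier n (θ : AddCircle (2 * Real.pi)) = (circleMode n : ℝ → ℂ) θ := by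
  rw [fourier_coe_apply, circleMode_apply]
  congr 1
  have : (Real.pi : ℂ) ≠ 0 := Complex.ofReal_ne_zero.2 Real.pi_ne_zero
  push_cast
  field_simp

theorem fourierCoeff_eq_circleCoeff (F : AddCircle (2 * Real.pi) → ℂ) (n : ℤ) :
    fourierCoeff F n = circleCoeff (fun θ : ℝ => F θ) n := by
  rw [fourierCoeff_eq_intervalIntegral F n 0, zero_add, circleCoeff, Complex.real_smul]
  push_cast
  congr 1
  refine intervalIntegral.integral_congr fun θ _ => ?_
  simp only [fourier_coe_eq_circleMode, smul_eq_mul]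
  ring

theorem hasSum_circleCoeff {φ : ℝ → ℂ} (hc : Continuous φ)
    (hp : Function.Periodic φ (2 * Real.pi)) (hs : Summable (circleCoeff φ)) (θ : ℝ) :
    HasSum (fun n => circleCoeff φ n * (circleMode n : ℝ → ℂ) θ) (φ θ) := by
  have hcont : Continuous (hp.lift : AddCircle (2 * Real.pi) → ℂ) :=
    continuous_coinduced_dom.2 hc
  set F : C(AddCircle (2 * Real.pi), ℂ) := ⟨hp.lift, hcont⟩
  have hF : ∀ n, fourierCoeff F n = circleCoeff φ n := fun n => fourierCoeff_eq_circleCoeff F n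
  have h := has_pointwise_sum_fourier_series_of_summable (f := F)
    (hs.congr fun n => (hF n).symm) (θ : AddCircle (2 * Real.pi))
  simp only [hF, fourier_coe_eq_circleMode, smul_eq_mul] at h
  exact h

theorem circleCoeff_circleMode (m n : ℤ) :
    circleCoeff (circleMode m) n = if n = m then 1 else 0 := by
  have h := congrFun (fourierCoeff_fourier (T := 2 * Real.pi) m) n
  rw [fourierCoeff_eq_circleCoeff] at h
  simp only [fourier_coe_eq_circleMode] at h
  rw [h, Pi.single_apply]

theorem norm_circleCoeff_le {φ : ℝ → ℂ} {M : ℝ} (h : ∀ θ, ‖φ θ‖ ≤ M) (n : ℤ) :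
    ‖circleCoeff φ n‖ ≤ M := by
  have h1 := intervalIntegral.norm_integral_le_of_norm_le_const (a := 0) (b := 2 * Real.pi)
    (f := fun θ => φ θ * (circleMode (-n) : ℝ → ℂ) θ) (C := M) fun θ _ => by
      rw [norm_mul, norm_circleMode, mul_one]
      exact h θ
  rw [sub_zero, abs_of_pos Real.two_pi_pos] at h1
  rw [circleCoeff, norm_mul]
  have h2 : ‖(1 / (2 * Real.pi) : ℂ)‖ = 1 / (2 * Real.pi) := by
    rw [show (1 / (2 * Real.pi) : ℂ) = ((1 / (2 * Real.pi) : ℝ) : ℂ) by push_cast; rfl,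
      Complex.norm_real, Real.norm_eq_abs, abs_of_pos (by positivity)]
  rw [h2]
  calc 1 / (2 * Real.pi) * _ ≤ 1 / (2 * Real.pi) * (M * (2 * Real.pi)) := by gcongr
    _ = M := by field_simp

/-- Uniqueness of the coefficients of an absolutely convergent trigonometric series. -/
theorem circleCoeff_eq_of_hasSum {φ : ℝ → ℂ} {a : ℤ → ℂ} (ha : Summable fun n => ‖a n‖)
    (h : ∀ θ, HasSum (fun n => a n * (circleMode n : ℝ → ℂ) θ) (φ θ)) (n : ℤ) :
    circleCoeff φ n = a n := by
  have hi := intervalIntegral.hasSum_integral_of_dominated_convergence (μ := volume)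
    (a := 0) (b := 2 * Real.pi)
    (F := fun m θ => a m * (circleMode m : ℝ → ℂ) θ * (circleMode (-n) : ℝ → ℂ) θ)
    (f := fun θ => φ θ * (circleMode (-n) : ℝ → ℂ) θ) (fun m _ => ‖a m‖)
    (fun m => ((continuous_const.mul (circleMode m).2.1.continuous).mul
      (circleMode (-n)).2.1.continuous).aestronglyMeasurable)
    (fun m => Eventually.of_forall fun θ _ => by simp [norm_circleMode])
    (Eventually.of_forall fun _ _ => ha) (by simp)
    (Eventually.of_forall fun θ _ => (h θ).mul_right _)
  have h2 := hi.mul_left (1 / (2 * Real.pi) : ℂ)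
  have h3 : (fun m => (1 / (2 * Real.pi) : ℂ) * ∫ θ in (0 : ℝ)..(2 * Real.pi),
      a m * (circleMode m : ℝ → ℂ) θ * (circleMode (-n) : ℝ → ℂ) θ) =
      fun m => if m = n then a n else 0 := by
    ext m
    have := circleCoeff_circleMode m n
    rw [circleCoeff] at this
    simp only [mul_assoc, intervalIntegral.integral_const_mul]
    rw [mul_left_comm, this]
    rcases eq_or_ne m n with rfl | hm
    · simp
    · simp [hm, hm.symm]
  rw [h3] at h2
  exact h2.unique (hasSum_ite_eq n (a n))

theorem deriv_mem_circleTest {φ : ℝ → ℂ} (h : φ ∈ CircleTest) : deriv φ ∈ CircleTest := by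
  refine ⟨(contDiff_infty_iff_deriv.1 h.1).2, fun θ => ?_⟩
  rw [← deriv_comp_add_const]
  congr 1
  exact funext h.2

theorem iteratedDeriv_mem_circleTest {φ : ℝ → ℂ} (h : φ ∈ CircleTest) (k : ℕ) :
    iteratedDeriv k φ ∈ CircleTest := by
  induction k with
  | zero => simpa using h
  | succ k ih =>
    rw [iteratedDeriv_succ]
    exact deriv_mem_circleTest ih

theorem circleCoeff_deriv {φ : ℝ → ℂ} (h : φ ∈ CircleTest) (n : ℤ) :
    circleCoeff (deriv φ) n = Complex.I * n * circleCoeff φ n := by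
  have h1 := intervalIntegral.integral_deriv_mul_eq_sub (a := 0) (b := 2 * Real.pi)
    (u := φ) (v := (circleMode (-n) : ℝ → ℂ)) (u' := deriv φ)
    (v' := fun θ => Complex.I * (-n : ℤ) * (circleMode (-n) : ℝ → ℂ) θ)
    (fun θ _ => (h.1.differentiable (by simp) θ).hasDerivAt)
    (fun θ _ => hasDerivAt_circleMode (-n) θ)
    ((deriv_mem_circleTest h).1.continuous.intervalIntegrable _ _)
    ((continuous_const.mul (circleMode (-n)).2.1.continuous).intervalIntegrable _ _)
  have e1 := h.2 0
  have e2 := (circleMode (-n)).2.2 0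
  rw [zero_add] at e1 e2
  rw [e1, e2, sub_self, intervalIntegral.integral_add
    (((deriv_mem_circleTest h).1.continuous.fun_mul
      (circleMode (-n)).2.1.continuous).intervalIntegrable _ _)
    ((h.1.continuous.fun_mul (continuous_const.fun_mul
      (circleMode (-n)).2.1.continuous)).intervalIntegrable _ _)] at h1
  have e3 : ∀ θ, φ θ * (Complex.I * (-n : ℤ) * (circleMode (-n) : ℝ → ℂ) θ) =
      -(Complex.I * n) * (φ θ * (circleMode (-n) : ℝ → ℂ) θ) := by
    intro θ
    push_cast
    ring
  simp only [e3, intervalIntegral.integral_const_mul] at h1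
  rw [circleCoeff, circleCoeff]
  linear_combination (1 / (2 * Real.pi) : ℂ) * h1

theorem circleCoeff_iteratedDeriv {φ : ℝ → ℂ} (h : φ ∈ CircleTest) (k : ℕ) (n : ℤ) :
    circleCoeff (iteratedDeriv k φ) n = (Complex.I * n) ^ k * circleCoeff φ n := by
  induction k with
  | zero => simp
  | succ k ih =>
    rw [iteratedDeriv_succ, circleCoeff_deriv (iteratedDeriv_mem_circleTest h k), ih]
    ring

theorem exists_norm_le_of_mem_circleTest {φ : ℝ → ℂ} (h : φ ∈ CircleTest) :
    ∃ M, ∀ θ, ‖φ θ‖ ≤ M := by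
  obtain ⟨M, hM⟩ := (isCompact_Icc (a := (0 : ℝ)) (b := 2 * Real.pi)).exists_bound_of_continuousOn
    h.1.continuous.continuousOn
  refine ⟨M, fun θ => ?_⟩
  obtain ⟨y, hy, hxy⟩ := h.2.exists_mem_Ico₀ Real.two_pi_pos θ
  rw [hxy]
  exact hM y (Ico_subset_Icc_self hy)

theorem summable_int_one_add_abs_sq_inv : Summable fun n : ℤ => ((1 + |(n : ℝ)|) ^ 2)⁻¹ := by
  have h : Summable fun n : ℕ => ((1 + (n : ℝ)) ^ 2)⁻¹ := by
    have := (summable_nat_add_iff 1).2 (Real.summable_nat_pow_inv (p := 2).2 one_lt_two)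
    refine this.congr fun n => ?_
    push_cast
    ring
  refine Summable.of_nat_of_neg ?_ ?_ <;> simpa using h

theorem summable_pow_mul_circleCoeff {φ : ℝ → ℂ} (h : φ ∈ CircleTest) (k : ℕ) :
    Summable fun n : ℤ => (1 + |(n : ℝ)|) ^ k * ‖circleCoeff φ n‖ := by
  obtain ⟨M, hM⟩ := exists_norm_le_of_mem_circleTest h
  obtain ⟨M', hM'⟩ := exists_norm_le_of_mem_circleTest (iteratedDeriv_mem_circleTest h (k + 2))
  refine Summable.of_nonneg_of_le (fun n => by positivity) (fun n => ?_)
    (summable_int_one_add_abs_sq_inv.mul_left (2 ^ (k + 2 - 1) * (M + M')))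
  have h1 := norm_circleCoeff_le hM n
  have h2 := norm_circleCoeff_le hM' n
  rw [circleCoeff_iteratedDeriv h, norm_mul, norm_pow, norm_mul, Complex.norm_I, one_mul,
    Complex.norm_intCast] at h2
  have h3 := add_pow_le zero_le_one (abs_nonneg (n : ℝ)) (k + 2)
  have h4 : (0 : ℝ) < (1 + |(n : ℝ)|) ^ 2 := by positivity
  rw [← div_eq_mul_inv, le_div_iff₀ h4]
  calc (1 + |(n : ℝ)|) ^ k * ‖circleCoeff φ n‖ * (1 + |(n : ℝ)|) ^ 2
      = (1 + |(n : ℝ)|) ^ (k + 2) * ‖circleCoeff φ n‖ := by ring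
    _ ≤ (2 ^ (k + 2 - 1) * (1 ^ (k + 2) + |(n : ℝ)| ^ (k + 2))) * ‖circleCoeff φ n‖ := by gcongr
    _ = 2 ^ (k + 2 - 1) * (‖circleCoeff φ n‖ + |(n : ℝ)| ^ (k + 2) * ‖circleCoeff φ n‖) := by ring
    _ ≤ 2 ^ (k + 2 - 1) * (M + M') := by gcongr

theorem summable_circleCoeff {φ : ℝ → ℂ} (h : φ ∈ CircleTest) : Summable (circleCoeff φ) := by
  refine Summable.of_norm ((summable_pow_mul_circleCoeff h 0).congr fun n => ?_)
  simp

theorem norm_iteratedDeriv_le_tsum {φ : ℝ → ℂ} (h : φ ∈ CircleTest) {k N : ℕ} (hk : k ≤ N)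
    (θ : ℝ) :
    ‖iteratedDeriv k φ θ‖ ≤ ∑' n : ℤ, (1 + |(n : ℝ)|) ^ N * ‖circleCoeff φ n‖ := by
  have hm := iteratedDeriv_mem_circleTest h k
  have h1 := hasSum_circleCoeff hm.1.continuous hm.2 (summable_circleCoeff hm) θ
  rw [← h1.tsum_eq]
  refine tsum_of_norm_bounded (summable_pow_mul_circleCoeff h N).hasSum fun n => ?_
  rw [norm_mul, norm_circleMode, mul_one, circleCoeff_iteratedDeriv h, norm_mul, norm_pow,
    norm_mul, Complex.norm_I, one_mul, Complex.norm_intCast]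
  gcongr
  calc |(n : ℝ)| ^ k ≤ (1 + |(n : ℝ)|) ^ k := by gcongr; linarith
    _ ≤ (1 + |(n : ℝ)|) ^ N := pow_le_pow_right₀ (by linarith [abs_nonneg (n : ℝ)]) hk

/-- The Fourier coefficient as a linear functional on test functions. -/
noncomputable def circleCoeffLinear (n : ℤ) : CircleTest →ₗ[ℂ] ℂ where
  toFun φ := circleCoeff φ n
  map_add' φ ψ := by
    simp only [circleCoeff, Submodule.coe_add, Pi.add_apply, add_mul]
    rw [intervalIntegral.integral_add
      ((φ.2.1.continuous.fun_mul (circleMode (-n)).2.1.continuous).intervalIntegrable _ _)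
      ((ψ.2.1.continuous.fun_mul (circleMode (-n)).2.1.continuous).intervalIntegrable _ _), mul_add]
  map_smul' c φ := by
    simp only [circleCoeff, Submodule.coe_smul, Pi.smul_apply, smul_eq_mul, RingHom.id_apply,
      mul_assoc, intervalIntegral.integral_const_mul]
    ring

theorem circleCoeff_sub_sum (φ : CircleTest) (S : Finset ℤ) (n : ℤ) :
    circleCoeff (φ - ∑ m ∈ S, circleCoeff φ m • circleMode m : CircleTest) n =
      if n ∈ S then 0 else circleCoeff φ n := by
  change circleCoeffLinear n _ = _
  rw [map_sub, map_sum]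
  have h : ∀ m, circleCoeffLinear n (circleCoeff φ m • circleMode m) =
      if n = m then circleCoeff φ m else 0 := by
    intro m
    rw [map_smul]
    change circleCoeff φ m • circleCoeff (circleMode m) n = _
    rw [circleCoeff_circleMode]
    simp
  simp only [h]
  rw [Finset.sum_ite_eq]
  change circleCoeff φ n - _ = _
  split_ifs <;> simp

/-- A distribution on the circle is the sum of its Fourier series: the Fourier series of a test
function converges together with all derivatives. -/
theorem CircleDistribution.hasSum (T : CircleDistribution) (φ : CircleTest) :
    HasSum (fun n => circleCoeff φ n * T.1 (circleMode n)) (T.1 φ) := by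
  obtain ⟨N, C, hT⟩ := T.2
  rw [HasSum, SummationFilter.unconditional_filter, tendsto_iff_norm_sub_tendsto_zero]
  have h0 := tendsto_tsum_compl_atTop_zero
    (fun n : ℤ => (1 + |(n : ℝ)|) ^ N * ‖circleCoeff φ n‖)
  have h1 := h0.const_mul C
  rw [mul_zero] at h1
  refine squeeze_zero (fun _ => norm_nonneg _) (fun S => ?_) h1
  set ψ : CircleTest := φ - ∑ m ∈ S, circleCoeff φ m • circleMode m with hψ
  have e1 : ∑ n ∈ S, circleCoeff φ n * T.1 (circleMode n) - T.1 φ = -T.1 ψ := by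
    rw [hψ, map_sub, map_sum]
    simp
  have e2 : ∑' n : ℤ, (1 + |(n : ℝ)|) ^ N * ‖circleCoeff ψ n‖ =
      ∑' n : {n // n ∉ S}, (1 + |((n : ℤ) : ℝ)|) ^ N * ‖circleCoeff φ n‖ := by
    refine Eq.trans (tsum_congr fun n => ?_) (tsum_subtype {n : ℤ | n ∉ S}
      fun n : ℤ => (1 + |(n : ℝ)|) ^ N * ‖circleCoeff φ n‖).symm
    rw [hψ, circleCoeff_sub_sum]
    by_cases hn : n ∈ S <;> simp [hn]
  rw [e1, norm_neg, ← e2]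
  exact hT ψ _ fun k hk θ => norm_iteratedDeriv_le_tsum ψ.2 hk θ

theorem iteratedDeriv_circleMode (n : ℤ) (k : ℕ) :
    iteratedDeriv k (circleMode n : ℝ → ℂ) =
      fun θ => (Complex.I * n) ^ k * (circleMode n : ℝ → ℂ) θ := by
  induction k with
  | zero => simp
  | succ k ih =>
    rw [iteratedDeriv_succ, ih]
    ext θ
    rw [((hasDerivAt_circleMode n θ).const_mul _).deriv]
    ring

/-- The Fourier coefficients of a distribution grow at most polynomially. -/
theorem CircleDistribution.exists_norm_le (T : CircleDistribution) :
    ∃ (N : ℕ) (C : ℝ), 0 ≤ C ∧ ∀ n : ℤ, ‖T.1 (circleMode n)‖ ≤ C * (1 + |(n : ℝ)|) ^ N := by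
  obtain ⟨N, C, hT⟩ := T.2
  refine ⟨N, |C|, abs_nonneg C, fun n => ?_⟩
  have h1 := hT (circleMode n) ((1 + |(n : ℝ)|) ^ N) fun k hk θ => by
    rw [iteratedDeriv_circleMode, norm_mul, norm_circleMode, mul_one, norm_pow, norm_mul,
      Complex.norm_I, one_mul, Complex.norm_intCast]
    calc |(n : ℝ)| ^ k ≤ (1 + |(n : ℝ)|) ^ k := by gcongr; linarith
      _ ≤ (1 + |(n : ℝ)|) ^ N := pow_le_pow_right₀ (by linarith [abs_nonneg (n : ℝ)]) hk
  exact h1.trans (mul_le_mul_of_nonneg_right (le_abs_self C) (by positivity))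

/-! ### Uniqueness of the solution -/

theorem SolvesBiharmonicDirichlet.eqOn_zero {Φ : ℂ → ℂ} (h : SolvesBiharmonicDirichlet 0 0 0 Φ) :
    EqOn Φ 0 (ball 0 1) := by
  have h1 : ∀ r ∈ Ioo (0 : ℝ) 1, ∀ θ : ℝ, Φ (r * Complex.exp (θ * Complex.I)) = 0 := by
    intro r hr θ
    have hcoeff : ∀ n, circleCoeff (fun θ => Φ (r * Complex.exp (θ * Complex.I))) n = 0 := by
      intro n
      have := h.dilatePairing_eq_zero (-n) hr
      rwa [dilatePairing_circleMode, neg_neg] at this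
    have hper : Function.Periodic (fun θ : ℝ => Φ (r * Complex.exp (θ * Complex.I)))
        (2 * Real.pi) := by
      intro θ
      have h1 := (circleMode 1).2.2 θ
      simp only [circleMode_apply, Int.cast_one, one_mul] at h1
      simp only [h1]
    have h2 := hasSum_circleCoeff (continuous_circle_slice h.continuousOn ⟨hr.1.le, hr.2⟩) hper
      (by simpa only [funext hcoeff] using summable_zero) θ
    simp only [hcoeff, zero_mul] at h2
    exact h2.unique hasSum_zero
  have h2 : ∀ z ∈ ball (0 : ℂ) 1, z ≠ 0 → Φ z = 0 := by
    intro z hz hz0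
    have := h1 ‖z‖ ⟨norm_pos_iff.2 hz0, by simpa using hz⟩ z.arg
    rwa [Complex.norm_mul_exp_arg_mul_I] at this
  intro z hz
  rcases eq_or_ne z 0 with rfl | hz0
  · have h3 : Tendsto Φ (𝓝[≠] 0) (𝓝 (Φ 0)) :=
      (h.continuousOn.continuousAt (isOpen_ball.mem_nhds hz)).tendsto.mono_left nhdsWithin_le_nhds
    refine tendsto_nhds_unique h3 (tendsto_const_nhds.congr' ?_)
    filter_upwards [self_mem_nhdsWithin, mem_nhdsWithin_of_mem_nhds (isOpen_ball.mem_nhds hz)]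
      with y hy hy'
    exact (h2 y hy' hy).symm
  · exact h2 z hz hz0

theorem dilatePairing_add {Φ Ψ : ℂ → ℂ} (hΦ : ContinuousOn Φ (ball 0 1))
    (hΨ : ContinuousOn Ψ (ball 0 1)) {r : ℝ} (hr : r ∈ Ioo (0 : ℝ) 1) (φ : CircleTest) :
    dilatePairing (Φ + Ψ) r φ = dilatePairing Φ r φ + dilatePairing Ψ r φ := by
  have hr' : r ∈ Ico (0 : ℝ) 1 := ⟨hr.1.le, hr.2⟩
  simp only [dilatePairing, Pi.add_apply, add_mul]
  rw [intervalIntegral.integral_add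
    (((continuous_circle_slice hΦ hr').fun_mul φ.2.1.continuous).intervalIntegrable _ _)
    (((continuous_circle_slice hΨ hr').fun_mul φ.2.1.continuous).intervalIntegrable _ _), mul_add]

theorem dilatePairing_const_mul (c : ℂ) (Φ : ℂ → ℂ) (r : ℝ) (φ : CircleTest) :
    dilatePairing (fun z => c * Φ z) r φ = c * dilatePairing Φ r φ := by
  simp only [dilatePairing, mul_assoc, intervalIntegral.integral_const_mul]
  ring

namespace SolvesBiharmonicDirichlet

variable {g₁ g₂ Φ₁ Φ₂ : ℂ → ℂ} {f₁ f₂ h₁ h₂ : CircleDistribution}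

theorem add (H₁ : SolvesBiharmonicDirichlet g₁ f₁ h₁ Φ₁)
    (H₂ : SolvesBiharmonicDirichlet g₂ f₂ h₂ Φ₂) :
    SolvesBiharmonicDirichlet (g₁ + g₂) (f₁ + f₂) (h₁ + h₂) (Φ₁ + Φ₂) := by
  have key : ∀ φ : CircleTest, ∀ᶠ r in 𝓝[<] (1 : ℝ), dilatePairing Φ₁ r φ + dilatePairing Φ₂ r φ =
      dilatePairing (Φ₁ + Φ₂) r φ := fun φ => by
    filter_upwards [eventually_mem_Ioo_nhdsLT_one] with r hr
    exact (dilatePairing_add H₁.continuousOn H₂.continuousOn hr φ).symm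
  refine ⟨H₁.1.add H₂.1, H₁.2.add H₂.2, H₁.3.add H₂.3 H₁.2 H₂.2 H₁.1 H₂.1, fun φ => ?_,
    fun φ => ?_⟩
  · exact ((H₁.4 φ).add (H₂.4 φ)).congr' (key φ)
  · refine ((H₁.5 φ).add (H₂.5 φ)).congr' ?_
    filter_upwards [key φ] with r hr
    rw [← hr, ← add_div]
    congr 1
    change _ = _ - (f₁.1 φ + f₂.1 φ)
    ring

theorem const_mul (H₁ : SolvesBiharmonicDirichlet g₁ f₁ h₁ Φ₁) (c : ℂ) :
    SolvesBiharmonicDirichlet (fun z => c * g₁ z) (c • f₁) (c • h₁) (fun z => c * Φ₁ z) := by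
  refine ⟨fun z hz => (H₁.1 z hz).imp fun s hs => ⟨hs.1, hs.2.const_mul c⟩,
    continuousOn_const.mul H₁.2, H₁.3.const_mul c, fun φ => ?_, fun φ => ?_⟩
  · simp only [dilatePairing_const_mul]
    exact (H₁.4 φ).const_mul c
  · simp only [dilatePairing_const_mul]
    refine ((H₁.5 φ).const_mul c).congr fun r => ?_
    change _ = (_ - c * f₁.1 φ) / _
    ring

theorem eqOn (H₁ : SolvesBiharmonicDirichlet g₁ f₁ h₁ Φ₁)
    (H₂ : SolvesBiharmonicDirichlet g₁ f₁ h₁ Φ₂) : EqOn Φ₁ Φ₂ (ball 0 1) := by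
  have H := H₁.add (H₂.const_mul (-1))
  have e1 : (g₁ + fun z => -1 * g₁ z) = 0 := by ext; simp
  have e2 : ∀ k : CircleDistribution, k + (-1 : ℂ) • k = 0 := by intro k; module
  rw [e1, e2, e2] at H
  intro z hz
  have := H.eqOn_zero hz
  simp only [Pi.add_apply, Pi.zero_apply] at this
  linear_combination this

end SolvesBiharmonicDirichlet

/-! ### Series of biharmonic modes -/

/-- The harmonic function on the plane that equals `e^{inθ}` on the unit circle: `zⁿ` for `n ≥ 0`
and `z̄^{|n|}` for `n < 0`. -/
noncomputable def harmonicMode (n : ℤ) (z : ℂ) : ℂ :=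
  if 0 ≤ n then z ^ n.natAbs else (starRingEnd ℂ) z ^ n.natAbs

theorem harmonicMode_natCast (n : ℕ) (z : ℂ) : harmonicMode n z = z ^ n := by
  simp [harmonicMode]

theorem harmonicMode_neg_natCast (n : ℕ) (z : ℂ) :
    harmonicMode (-n) z = (starRingEnd ℂ) z ^ n := by
  rcases n with _ | n
  · simp [harmonicMode]
  · rw [harmonicMode, if_neg (by omega), Int.natAbs_neg, Int.natAbs_natCast]

theorem harmonicMode_mul (n : ℤ) (z w : ℂ) :
    harmonicMode n (z * w) = harmonicMode n z * harmonicMode n w := by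
  unfold harmonicMode
  split_ifs
  · rw [mul_pow]
  · rw [map_mul, mul_pow]

theorem norm_harmonicMode (n : ℤ) (z : ℂ) : ‖harmonicMode n z‖ = ‖z‖ ^ n.natAbs := by
  unfold harmonicMode
  split_ifs <;> simp

theorem harmonicMode_ofReal (n : ℤ) (r : ℝ) : harmonicMode n r = (r : ℂ) ^ n.natAbs := by
  unfold harmonicMode
  simp

theorem harmonicMode_exp (n : ℤ) (θ : ℝ) :
    harmonicMode n (Complex.exp (θ * Complex.I)) = (circleMode n : ℝ → ℂ) θ := by
  obtain ⟨m, rfl | rfl⟩ := n.eq_nat_or_neg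
  · rw [harmonicMode_natCast, circleMode_eq_pow]
  · rw [harmonicMode_neg_natCast, circleMode_neg_eq_pow]

theorem harmonicMode_exp_neg (n : ℤ) (θ : ℝ) :
    harmonicMode n (Complex.exp (-(θ * Complex.I))) = (circleMode (-n) : ℝ → ℂ) θ := by
  have h := harmonicMode_exp n (-θ)
  rw [Complex.ofReal_neg, neg_mul] at h
  rw [h, circleMode_apply, circleMode_apply]
  congr 1
  push_cast
  ring

theorem continuous_harmonicMode (n : ℤ) : Continuous (harmonicMode n) := by
  unfold harmonicMode
  split_ifs
  · fun_prop
  · exact Complex.continuous_conj.pow _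

/-- Sequences of at most polynomial growth, such as the Fourier coefficients of a distribution. -/
def PolynomialGrowth (α : ℤ → ℂ) : Prop :=
  ∃ (N : ℕ) (C : ℝ), 0 ≤ C ∧ ∀ n : ℤ, ‖α n‖ ≤ C * (1 + |(n : ℝ)|) ^ N

namespace PolynomialGrowth

variable {α : ℤ → ℂ}

theorem natAbs_mul (hα : PolynomialGrowth α) : PolynomialGrowth fun n => n.natAbs * α n := by
  obtain ⟨N, C, hC, h⟩ := hα
  refine ⟨N + 1, C, hC, fun n => ?_⟩
  rw [norm_mul, Complex.norm_natCast, Nat.cast_natAbs, Int.cast_abs, pow_succ, ← mul_assoc, mul_comm]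
  gcongr
  · exact h n
  · linarith

theorem const_mul (hα : PolynomialGrowth α) (c : ℂ) : PolynomialGrowth fun n => c * α n := by
  obtain ⟨N, C, hC, h⟩ := hα
  refine ⟨N, ‖c‖ * C, by positivity, fun n => ?_⟩
  rw [norm_mul, mul_assoc]
  gcongr
  exact h n

theorem summable_norm_mul_circleCoeff (hα : PolynomialGrowth α) (φ : CircleTest) :
    Summable fun n => ‖α n‖ * ‖circleCoeff φ (-n)‖ := by
  obtain ⟨N, C, hC, h⟩ := hα
  have h1 := ((Equiv.neg ℤ).summable_iff.2 (summable_pow_mul_circleCoeff φ.2 N)).mul_left C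
  refine Summable.of_nonneg_of_le (fun n => by positivity) (fun n => ?_) h1
  simp only [Function.comp_apply, Equiv.neg_apply, Int.cast_neg, abs_neg]
  rw [← mul_assoc]
  gcongr
  exact h n

theorem summable_norm_mul_pow (hα : PolynomialGrowth α) {R : ℝ} (hR0 : 0 ≤ R) (hR : R < 1) :
    Summable fun n => ‖α n‖ * R ^ n.natAbs := by
  obtain ⟨N, C, hC, h⟩ := hα
  have h1 : Summable fun n : ℕ => C * (2 ^ (N - 1) * (1 + (n : ℝ) ^ N)) * R ^ n := by
    have e := ((summable_geometric_of_lt_one hR0 hR).add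
      (summable_pow_mul_geometric_of_norm_lt_one N (by
        rwa [Real.norm_eq_abs, abs_of_nonneg hR0]))).mul_left (C * 2 ^ (N - 1))
    refine e.congr fun n => ?_
    ring
  have h2 : ∀ n : ℤ, ‖α n‖ * R ^ n.natAbs ≤
      C * (2 ^ (N - 1) * (1 + |(n : ℝ)| ^ N)) * R ^ n.natAbs := by
    intro n
    have := add_pow_le zero_le_one (abs_nonneg (n : ℝ)) N
    rw [one_pow] at this
    have h3 := h n
    gcongr
    exact h3.trans (by gcongr)
  refine Summable.of_nonneg_of_le (fun n => by positivity) h2 ?_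
  refine Summable.of_nat_of_neg ?_ ?_ <;> simpa using h1

end PolynomialGrowth

/-- One term of a biharmonic series: `p_n(z) (a + b (1 - |z|²))` with `p_n` the harmonic mode. -/
noncomputable def biharmonicMode (n : ℤ) (a b z : ℂ) : ℂ :=
  harmonicMode n z * (a + b * (1 - (‖z‖ ^ 2 : ℝ)))

/-- The sum `∑ p_n(z) (α_n + β_n (1 - |z|²))`. -/
noncomputable def biharmonicSeries (α β : ℤ → ℂ) (z : ℂ) : ℂ :=
  ∑' n : ℤ, biharmonicMode n (α n) (β n) z

theorem continuous_biharmonicMode (n : ℤ) (a b : ℂ) : Continuous (biharmonicMode n a b) := by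
  have := continuous_harmonicMode n
  unfold biharmonicMode
  fun_prop

theorem norm_biharmonicMode_le (n : ℤ) (a b : ℂ) {R : ℝ} (hR : R ≤ 1) {z : ℂ} (hz : ‖z‖ ≤ R) :
    ‖biharmonicMode n a b z‖ ≤ ‖a‖ * R ^ n.natAbs + ‖b‖ * R ^ n.natAbs := by
  have h1 : ‖(1 - (‖z‖ ^ 2 : ℝ) : ℂ)‖ ≤ 1 := by
    rw [← Complex.ofReal_one, ← Complex.ofReal_sub, Complex.norm_real, Real.norm_eq_abs, abs_le]
    constructor <;> nlinarith [norm_nonneg z]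
  rw [biharmonicMode, norm_mul, norm_harmonicMode, ← add_mul, mul_comm]
  gcongr
  refine (norm_add_le _ _).trans ?_
  rw [norm_mul]
  gcongr
  exact mul_le_of_le_one_right (norm_nonneg _) h1

theorem weakBilaplacianEq_conj_pow_mul (m : ℕ) (a b : ℂ) :
    WeakBilaplacianEq (fun z => (starRingEnd ℂ) z ^ m * (a + b * (1 - (‖z‖ ^ 2 : ℝ)))) 0 := by
  set χ : ℝ → ℂ := fun s => a + b * (1 - (s : ℂ)) with hχ
  have hχs : ContDiff ℝ ∞ χ :=
    contDiff_const.add (contDiff_const.mul (contDiff_const.sub Complex.ofRealCLM.contDiff))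
  have hχd : ∀ s, HasDerivAt χ (-b) s := fun s => by
    have h : HasDerivAt (fun s : ℝ => (s : ℂ)) 1 s := (hasDerivAt_id s).ofReal_comp
    refine (((h.const_sub 1).const_mul b).const_add a).congr_deriv ?_
    ring
  have h1 : (dLaplacian fun y => (starRingEnd ℂ) y ^ m * χ (‖y‖ ^ 2)) =
      fun y => (starRingEnd ℂ) y ^ m * ((fun _ : ℝ => (m + 1) * -b) (‖y‖ ^ 2)) := by
    ext y
    rw [dLaplacian_conj_pow_mul_radial m (χ' := fun _ => -b) ((contDiff_infty.1 hχs 2).contDiffAt)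
      (Eventually.of_forall hχd) (hasDerivAt_const _ _)]
    simp
  have h2 : dLaplacian (dLaplacian fun y => (starRingEnd ℂ) y ^ m * χ (‖y‖ ^ 2)) = 0 := by
    rw [h1]
    ext y
    rw [dLaplacian_conj_pow_mul_radial m (χ' := fun _ => 0) contDiffAt_const
      (Eventually.of_forall fun _ => hasDerivAt_const _ _) (hasDerivAt_const _ _)]
    simp
  have h3 : ContDiff ℝ ∞ fun y => (starRingEnd ℂ) y ^ m * χ (‖y‖ ^ 2) :=
    contDiff_iff_contDiffAt.2 fun z => contDiffAt_conj_pow_mul_radial m (m := ⊤) hχs.contDiffAt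
  have h4 := WeakBilaplacianEq.of_contDiffOn (h3.contDiffOn (s := ball 0 1))
  rw [h2] at h4
  exact h4

theorem weakBilaplacianEq_biharmonicMode (n : ℤ) (a b : ℂ) :
    WeakBilaplacianEq (biharmonicMode n a b) 0 := by
  obtain ⟨m, rfl | rfl⟩ := n.eq_nat_or_neg
  · have h := (weakBilaplacianEq_conj_pow_mul m ((starRingEnd ℂ) a) ((starRingEnd ℂ) b)).conj
    simp only [map_mul, map_add, map_sub, map_pow, Complex.conj_conj, map_one, Complex.conj_ofReal,
      Pi.zero_apply, map_zero] at h
    have e : biharmonicMode m a b = fun z => z ^ m * (a + b * (1 - (‖z‖ ^ 2 : ℝ))) := by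
      ext z
      rw [biharmonicMode, harmonicMode_natCast]
    rw [e]
    exact h
  · have e : biharmonicMode (-m) a b =
        fun z => (starRingEnd ℂ) z ^ m * (a + b * (1 - (‖z‖ ^ 2 : ℝ))) := by
      ext z
      rw [biharmonicMode, harmonicMode_neg_natCast]
    rw [e]
    exact weakBilaplacianEq_conj_pow_mul m a b

theorem biharmonicMode_circle (n : ℤ) (a b : ℂ) {r : ℝ} (hr : 0 ≤ r) (θ : ℝ) :
    biharmonicMode n a b (r * Complex.exp (θ * Complex.I)) =
      (r : ℂ) ^ n.natAbs * (a + b * (1 - (r : ℂ) ^ 2)) * (circleMode n : ℝ → ℂ) θ := by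
  rw [biharmonicMode, norm_circle_mul hr, harmonicMode_mul, harmonicMode_ofReal, harmonicMode_exp]
  push_cast
  ring

section BiharmonicSeries

variable {α β : ℤ → ℂ}

theorem summable_biharmonicMode_bound (hα : PolynomialGrowth α) (hβ : PolynomialGrowth β) {R : ℝ}
    (hR0 : 0 ≤ R) (hR : R < 1) :
    Summable fun n => ‖α n‖ * R ^ n.natAbs + ‖β n‖ * R ^ n.natAbs :=
  (hα.summable_norm_mul_pow hR0 hR).add (hβ.summable_norm_mul_pow hR0 hR)

theorem hasSum_biharmonicSeries (hα : PolynomialGrowth α) (hβ : PolynomialGrowth β) {z : ℂ}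
    (hz : ‖z‖ < 1) : HasSum (fun n => biharmonicMode n (α n) (β n) z) (biharmonicSeries α β z) :=
  (Summable.of_norm_bounded (summable_biharmonicMode_bound hα hβ (norm_nonneg z) hz) fun n =>
    norm_biharmonicMode_le n (α n) (β n) hz.le le_rfl).hasSum

theorem continuousOn_biharmonicSeries (hα : PolynomialGrowth α) (hβ : PolynomialGrowth β) :
    ContinuousOn (biharmonicSeries α β) (ball 0 1) := by
  intro z hz
  obtain ⟨R, hzR, hR⟩ := exists_between (mem_ball_zero_iff.1 hz)
  have hR0 : 0 ≤ R := (norm_nonneg z).trans hzR.le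
  have h : ContinuousOn (biharmonicSeries α β) (ball 0 R) :=
    continuousOn_tsum (fun n => (continuous_biharmonicMode n (α n) (β n)).continuousOn)
      (summable_biharmonicMode_bound hα hβ hR0 hR) fun n y hy =>
        norm_biharmonicMode_le n (α n) (β n) hR.le (mem_ball_zero_iff.1 hy).le
  exact (h.continuousAt (isOpen_ball.mem_nhds (mem_ball_zero_iff.2 hzR))).continuousWithinAt

theorem weakBilaplacianEq_biharmonicSeries (hα : PolynomialGrowth α) (hβ : PolynomialGrowth β) :
    WeakBilaplacianEq (biharmonicSeries α β) 0 := by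
  rw [weakBilaplacianEq_iff]
  intro φ hφ hc hs
  obtain ⟨R, hR0, hR, hsR⟩ : ∃ R : ℝ, 0 ≤ R ∧ R < 1 ∧ ∀ z ∈ tsupport φ, ‖z‖ ≤ R := by
    rcases (tsupport φ).eq_empty_or_nonempty with he | hne
    · exact ⟨0, le_rfl, one_pos, by simp [he]⟩
    · obtain ⟨y, hy, hy'⟩ := IsCompact.exists_isMaxOn hc hne continuous_norm.continuousOn
      exact ⟨‖y‖, norm_nonneg y, mem_ball_zero_iff.1 (hs hy), fun z hz => hy' hz⟩
  set ψ := dLaplacian (dLaplacian φ) with hψ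
  have hψc : Continuous ψ := hφ.dLaplacian.dLaplacian.continuous
  have hψs : HasCompactSupport ψ := hc.dLaplacian.dLaplacian
  have hψz : ∀ z, R < ‖z‖ → ψ z = 0 := fun z hz =>
    image_eq_zero_of_notMem_tsupport fun h => not_lt.2 (hsR z
      ((tsupport_dLaplacian_subset _).trans (tsupport_dLaplacian_subset φ) h)) hz
  have hsum := summable_biharmonicMode_bound hα hβ hR0 hR
  have h := hasSum_integral_of_dominated_convergence (μ := (volume : Measure ℂ))
    (F := fun n z => biharmonicMode n (α n) (β n) z * ψ z)
    (f := fun z => biharmonicSeries α β z * ψ z)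
    (fun n z => (‖α n‖ * R ^ n.natAbs + ‖β n‖ * R ^ n.natAbs) * ‖ψ z‖)
    (fun n => ((continuous_biharmonicMode n _ _).mul hψc).aestronglyMeasurable)
    (fun n => Eventually.of_forall fun z => by
      rcases le_or_gt ‖z‖ R with hz | hz
      · rw [norm_mul]
        gcongr
        exact norm_biharmonicMode_le n _ _ hR.le hz
      · simp [hψz z hz])
    (Eventually.of_forall fun z => hsum.mul_right _)
    (by
      simp only [tsum_mul_right]
      exact (hψc.integrable_of_hasCompactSupport hψs).norm.const_mul _)
    (Eventually.of_forall fun z => by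
      rcases le_or_gt ‖z‖ R with hz | hz
      · exact (hasSum_biharmonicSeries hα hβ (hz.trans_lt hR)).mul_right _
      · simp only [hψz z hz, mul_zero]
        exact hasSum_zero)
  have h0 : ∀ n, ∫ z, biharmonicMode n (α n) (β n) z * ψ z = 0 := fun n => by
    have := weakBilaplacianEq_iff.1 (weakBilaplacianEq_biharmonicMode n (α n) (β n)) φ hφ hc hs
    simpa using this
  simp only [h0] at h
  rw [h.unique hasSum_zero]
  simp

theorem hasSum_dilatePairing_biharmonicSeries (hα : PolynomialGrowth α) (hβ : PolynomialGrowth β)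
    {r : ℝ} (hr : r ∈ Ioo (0 : ℝ) 1) (φ : CircleTest) :
    HasSum (fun n => (r : ℂ) ^ n.natAbs * (α n + β n * (1 - (r : ℂ) ^ 2)) * circleCoeff φ (-n))
      (dilatePairing (biharmonicSeries α β) r φ) := by
  obtain ⟨M, hM⟩ := exists_norm_le_of_mem_circleTest φ.2
  have hr0 := hr.1.le
  have hsum := summable_biharmonicMode_bound hα hβ hr0 hr.2
  have h := intervalIntegral.hasSum_integral_of_dominated_convergence (μ := volume)
    (a := 0) (b := 2 * Real.pi)
    (F := fun n θ => biharmonicMode n (α n) (β n) (r * Complex.exp (θ * Complex.I)) *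
      (φ : ℝ → ℂ) θ)
    (f := fun θ => biharmonicSeries α β (r * Complex.exp (θ * Complex.I)) * (φ : ℝ → ℂ) θ)
    (fun n _ => (‖α n‖ * r ^ n.natAbs + ‖β n‖ * r ^ n.natAbs) * M)
    (fun n => (((continuous_biharmonicMode n _ _).comp (by fun_prop)).mul
      φ.2.1.continuous).aestronglyMeasurable)
    (fun n => Eventually.of_forall fun θ _ => by
      rw [norm_mul]
      exact mul_le_mul (norm_biharmonicMode_le n _ _ hr.2.le (norm_circle_mul hr0 θ).le) (hM θ)
        (norm_nonneg _) (by positivity))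
    (Eventually.of_forall fun _ _ => hsum.mul_right _) (by simp)
    (Eventually.of_forall fun θ _ => (hasSum_biharmonicSeries hα hβ
      ((norm_circle_mul hr.1.le θ).trans_lt hr.2)).mul_right _)
  have h2 := h.mul_left (1 / (2 * Real.pi) : ℂ)
  refine h2.congr_fun ?_
  intro n
  simp only [biharmonicMode_circle _ _ _ hr.1.le, mul_assoc, intervalIntegral.integral_const_mul]
  rw [circleCoeff, neg_neg]
  simp only [mul_comm ((φ : ℝ → ℂ) _)]
  ring

theorem sub_one_div_one_sub_eq_neg_sum {r : ℝ} (hr : r < 1) (k : ℕ) :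
    ((r : ℂ) ^ k - 1) / (1 - r) = -∑ i ∈ Finset.range k, (r : ℂ) ^ i := by
  have h1 : (r : ℂ) ≠ 1 := by exact_mod_cast hr.ne
  rw [geom_sum_eq h1, ← neg_sub (r : ℂ) 1, div_neg]

/-- A series of biharmonic modes solves the homogeneous equation; its boundary value has the
coefficients `α_n`, its inward normal derivative the coefficients `2 β_n - |n| α_n`. -/
theorem solves_biharmonicSeries (hα : PolynomialGrowth α) (hβ : PolynomialGrowth β)
    {f h : CircleDistribution}
    (hf : ∀ φ : CircleTest, HasSum (fun n => α n * circleCoeff φ (-n)) (f.1 φ))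
    (hh : ∀ φ : CircleTest,
      HasSum (fun n => (2 * β n - n.natAbs * α n) * circleCoeff φ (-n)) (h.1 φ)) :
    SolvesBiharmonicDirichlet 0 f h (biharmonicSeries α β) := by
  have hco : Tendsto (fun r : ℝ => (r : ℂ)) (𝓝[<] 1) (𝓝 1) :=
    (Complex.continuous_ofReal.tendsto' 1 1 (by simp)).mono_left nhdsWithin_le_nhds
  refine ⟨locallyIntegrableOn_zero, continuousOn_biharmonicSeries hα hβ,
    weakBilaplacianEq_biharmonicSeries hα hβ, fun φ => ?_, fun φ => ?_⟩
  · have h1 : Tendsto (fun r : ℝ => ∑' n : ℤ, (r : ℂ) ^ n.natAbs *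
        (α n + β n * (1 - (r : ℂ) ^ 2)) * circleCoeff φ (-n)) (𝓝[<] 1)
        (𝓝 (∑' n : ℤ, α n * circleCoeff φ (-n))) := by
      refine tendsto_tsum_of_dominated_convergence
        (bound := fun n => ‖α n‖ * ‖circleCoeff φ (-n)‖ + ‖β n‖ * ‖circleCoeff φ (-n)‖)
        ((hα.summable_norm_mul_circleCoeff φ).add (hβ.summable_norm_mul_circleCoeff φ))
        (fun n => ?_) ?_
      · have e : Tendsto (fun r : ℝ => (r : ℂ) ^ n.natAbs *
            (α n + β n * (1 - (r : ℂ) ^ 2)) * circleCoeff φ (-n)) (𝓝[<] 1)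
            (𝓝 (1 ^ n.natAbs * (α n + β n * (1 - 1 ^ 2)) * circleCoeff φ (-n))) :=
          ((hco.pow _).mul ((((hco.pow 2).const_sub 1).const_mul _).const_add _)).mul_const _
        simpa using e
      · filter_upwards [eventually_mem_Ioo_nhdsLT_one] with r hr n
        have hr0 := hr.1
        have hr2 : |1 - r ^ 2| ≤ 1 := by
          rw [abs_le]
          constructor <;> nlinarith [hr.1, hr.2]
        rw [norm_mul, norm_mul, norm_pow, Complex.norm_real, Real.norm_eq_abs, abs_of_pos hr.1,
          ← add_mul]
        gcongr
        refine (mul_le_of_le_one_left (norm_nonneg _) (pow_le_one₀ hr.1.le hr.2.le)).trans ?_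
        refine (norm_add_le _ _).trans ?_
        gcongr
        rw [norm_mul]
        refine mul_le_of_le_one_right (norm_nonneg _) ?_
        rw [← Complex.ofReal_pow, ← Complex.ofReal_one, ← Complex.ofReal_sub, Complex.norm_real]
        exact hr2
    rw [(hf φ).tsum_eq] at h1
    refine h1.congr' ?_
    filter_upwards [eventually_mem_Ioo_nhdsLT_one] with r hr
    exact (hasSum_dilatePairing_biharmonicSeries hα hβ hr φ).tsum_eq
  · have h1 : Tendsto (fun r : ℝ => ∑' n : ℤ, ((r : ℂ) ^ n.natAbs * β n * (1 + r) -
        (∑ i ∈ Finset.range n.natAbs, (r : ℂ) ^ i) * α n) * circleCoeff φ (-n)) (𝓝[<] 1)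
        (𝓝 (∑' n : ℤ, (2 * β n - n.natAbs * α n) * circleCoeff φ (-n))) := by
      refine tendsto_tsum_of_dominated_convergence
        (bound := fun n => 2 * (‖β n‖ * ‖circleCoeff φ (-n)‖) +
          ‖n.natAbs * α n‖ * ‖circleCoeff φ (-n)‖)
        (((hβ.summable_norm_mul_circleCoeff φ).mul_left 2).add
          (hα.natAbs_mul.summable_norm_mul_circleCoeff φ)) (fun n => ?_) ?_
      · have e : Tendsto (fun r : ℝ => ((r : ℂ) ^ n.natAbs * β n * (1 + r) -
            (∑ i ∈ Finset.range n.natAbs, (r : ℂ) ^ i) * α n) * circleCoeff φ (-n)) (𝓝[<] 1)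
            (𝓝 ((1 ^ n.natAbs * β n * (1 + 1) -
            (∑ i ∈ Finset.range n.natAbs, (1 : ℂ) ^ i) * α n) * circleCoeff φ (-n))) :=
          ((((hco.pow _).mul_const _).mul (hco.const_add 1)).sub
            ((tendsto_finsetSum _ fun i _ => hco.pow i).mul_const _)).mul_const _
        simp only [one_pow, one_mul, Finset.sum_const, Finset.card_range, nsmul_eq_mul,
          mul_one, one_add_one_eq_two] at e
        rwa [mul_comm (β n)] at e
      · filter_upwards [eventually_mem_Ioo_nhdsLT_one] with r hr n
        have hr0 := hr.1
        have hnr : ‖(r : ℂ)‖ = r := by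
          rw [Complex.norm_real, Real.norm_eq_abs, abs_of_pos hr.1]
        have h2 : ‖∑ i ∈ Finset.range n.natAbs, (r : ℂ) ^ i‖ ≤ n.natAbs := by
          refine (norm_sum_le _ _).trans ?_
          refine (Finset.sum_le_card_nsmul _ _ 1 fun i _ => ?_).trans (by simp)
          rw [norm_pow, hnr]
          exact pow_le_one₀ hr.1.le hr.2.le
        have h3 : ‖(1 + r : ℂ)‖ ≤ 2 := by
          refine (norm_add_le _ _).trans ?_
          rw [norm_one, hnr]
          linarith [hr.2]
        rw [norm_mul, ← mul_assoc, ← add_mul]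
        gcongr
        refine (norm_sub_le _ _).trans ?_
        rw [norm_mul, norm_mul, norm_mul, norm_mul, norm_pow, hnr, Complex.norm_natCast]
        refine add_le_add ?_ (by gcongr)
        calc r ^ n.natAbs * ‖β n‖ * ‖(1 + r : ℂ)‖ ≤ 1 * ‖β n‖ * 2 := by
              gcongr
              exact pow_le_one₀ hr.1.le hr.2.le
          _ = 2 * ‖β n‖ := by ring
    rw [(hh φ).tsum_eq] at h1
    refine h1.congr' ?_
    filter_upwards [eventually_mem_Ioo_nhdsLT_one] with r hr
    have hr1 : (1 - r : ℂ) ≠ 0 := sub_ne_zero.2 (by exact_mod_cast hr.2.ne')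
    have h2 := ((hasSum_dilatePairing_biharmonicSeries hα hβ hr φ).sub (hf φ)).div_const (1 - r : ℂ)
    rw [← h2.tsum_eq]
    refine tsum_congr fun n => ?_
    have h3 := sub_one_div_one_sub_eq_neg_sum hr.2 n.natAbs
    rw [div_eq_iff hr1] at h3
    rw [eq_div_iff hr1]
    linear_combination -(α n * circleCoeff φ (-n)) * h3

end BiharmonicSeries

/-! ### The kernels `F₀` and `H₀` -/

theorem hasSum_int_of_nat_of_succ {F : ℤ → ℂ} {a b : ℂ} (h1 : HasSum (fun n : ℕ => F n) a)
    (h2 : HasSum (fun n : ℕ => F (-((n + 1 : ℕ) : ℤ))) b) : HasSum F (a + b) := by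
  refine HasSum.of_nat_of_neg_add_one h1 ?_
  simpa using h2

theorem one_sub_ne_zero_of_norm_lt_one {w : ℂ} (hw : ‖w‖ < 1) : 1 - w ≠ 0 := by
  intro h
  rw [← sub_eq_zero.1 h] at hw
  simp at hw

theorem norm_conj_lt_one {w : ℂ} (hw : ‖w‖ < 1) : ‖(starRingEnd ℂ) w‖ < 1 := by simpa using hw

theorem norm_one_sub_sq (w : ℂ) :
    ((‖1 - w‖ ^ 2 : ℝ) : ℂ) = (1 - w) * (1 - (starRingEnd ℂ) w) := by
  have := Complex.mul_conj' (1 - w)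
  simp only [map_sub, map_one] at this
  rw [this]
  push_cast
  rfl

theorem norm_sq_eq_mul_conj (w : ℂ) : ((‖w‖ ^ 2 : ℝ) : ℂ) = w * (starRingEnd ℂ) w := by
  rw [Complex.mul_conj']
  push_cast
  rfl

/-- The Poisson kernel is the sum of the harmonic modes. -/
theorem hasSum_harmonicMode {w : ℂ} (hw : ‖w‖ < 1) :
    HasSum (fun n => harmonicMode n w)
      ((1 - w * (starRingEnd ℂ) w) / ((1 - w) * (1 - (starRingEnd ℂ) w))) := by
  have hw' := norm_conj_lt_one hw
  have h1 := hasSum_geometric_of_norm_lt_one hw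
  have h2 := (hasSum_geometric_of_norm_lt_one hw').mul_left ((starRingEnd ℂ) w)
  have h := hasSum_int_of_nat_of_succ (F := fun n => harmonicMode n w)
    (h1.congr_fun fun n => harmonicMode_natCast n w)
    (h2.congr_fun fun n => (harmonicMode_neg_natCast (n + 1) w).trans (pow_succ' _ _))
  have e1 := one_sub_ne_zero_of_norm_lt_one hw
  have e2 := one_sub_ne_zero_of_norm_lt_one hw'
  have e3 : (1 - w * (starRingEnd ℂ) w) / ((1 - w) * (1 - (starRingEnd ℂ) w)) =
      (1 - w)⁻¹ + (starRingEnd ℂ) w * (1 - (starRingEnd ℂ) w)⁻¹ := by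
    field_simp
    ring
  rw [e3]
  exact h

theorem hasSum_natAbs_mul_harmonicMode {w : ℂ} (hw : ‖w‖ < 1) :
    HasSum (fun n : ℤ => (n.natAbs : ℂ) * harmonicMode n w)
      (w / (1 - w) ^ 2 + (starRingEnd ℂ) w / (1 - (starRingEnd ℂ) w) ^ 2) := by
  have h1 := hasSum_coe_mul_geometric_of_norm_lt_one hw
  have h2 : HasSum (fun n : ℕ => ((n + 1 : ℕ) : ℂ) * (starRingEnd ℂ) w ^ (n + 1))
      ((starRingEnd ℂ) w / (1 - (starRingEnd ℂ) w) ^ 2) := by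
    refine (hasSum_nat_add_iff (f := fun n : ℕ => (n : ℂ) * (starRingEnd ℂ) w ^ n) 1).2 ?_
    simpa using hasSum_coe_mul_geometric_of_norm_lt_one (norm_conj_lt_one hw)
  refine hasSum_int_of_nat_of_succ (F := fun n : ℤ => (n.natAbs : ℂ) * harmonicMode n w)
    (h1.congr_fun fun n => ?_) (h2.congr_fun fun n => ?_)
  · rw [harmonicMode_natCast, Int.natAbs_natCast]
  · rw [harmonicMode_neg_natCast, Int.natAbs_neg, Int.natAbs_natCast]

/-- `H₀ = ∑ p_n · (1 - |w|²) / 2`. -/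
theorem hasSum_kernelH {w : ℂ} (hw : ‖w‖ < 1) :
    HasSum (fun n => biharmonicMode n 0 (1 / 2) w) (kernelH w : ℂ) := by
  have h := (hasSum_harmonicMode hw).mul_left ((1 / 2) * (1 - w * (starRingEnd ℂ) w))
  have hv : (kernelH w : ℂ) = (1 / 2) * (1 - w * (starRingEnd ℂ) w) *
      ((1 - w * (starRingEnd ℂ) w) / ((1 - w) * (1 - (starRingEnd ℂ) w))) := by
    rw [kernelH]
    push_cast
    have e1 := norm_one_sub_sq w
    have e2 := norm_sq_eq_mul_conj w
    push_cast at e1 e2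
    rw [e1, e2]
    ring
  rw [hv]
  refine h.congr_fun fun n => ?_
  rw [biharmonicMode, norm_sq_eq_mul_conj]
  ring

/-- `F₀ = ∑ p_n · (1 + |n| (1 - |w|²) / 2)`. -/
theorem hasSum_kernelF {w : ℂ} (hw : ‖w‖ < 1) :
    HasSum (fun n : ℤ => biharmonicMode n 1 (1 / 2 * n.natAbs) w) (kernelF w : ℂ) := by
  have h := (hasSum_harmonicMode hw).add ((hasSum_natAbs_mul_harmonicMode hw).mul_left
    ((1 / 2) * (1 - w * (starRingEnd ℂ) w)))
  have hv : (kernelF w : ℂ) = (1 - w * (starRingEnd ℂ) w) / ((1 - w) * (1 - (starRingEnd ℂ) w)) +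
      (1 / 2) * (1 - w * (starRingEnd ℂ) w) *
        (w / (1 - w) ^ 2 + (starRingEnd ℂ) w / (1 - (starRingEnd ℂ) w) ^ 2) := by
    rw [kernelF, kernelH, show ‖1 - w‖ ^ 4 = (‖1 - w‖ ^ 2) ^ 2 by ring]
    push_cast
    have e1 := norm_one_sub_sq w
    have e2 := norm_sq_eq_mul_conj w
    push_cast at e1 e2
    rw [e1, e2]
    have e3 := one_sub_ne_zero_of_norm_lt_one hw
    have e4 := one_sub_ne_zero_of_norm_lt_one (norm_conj_lt_one hw)
    generalize (starRingEnd ℂ) w = v at e4 ⊢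
    field_simp
    ring
  rw [hv]
  refine h.congr_fun fun n => ?_
  rw [biharmonicMode, norm_sq_eq_mul_conj]
  ring

theorem norm_rot (z : ℂ) (θ : ℝ) : ‖z * Complex.exp (-(θ * Complex.I))‖ = ‖z‖ := by
  rw [norm_mul, ← neg_mul, ← Complex.ofReal_neg, Complex.norm_exp_ofReal_mul_I, mul_one]

theorem biharmonicMode_rot (n : ℤ) (a b z : ℂ) (θ : ℝ) :
    biharmonicMode n a b (z * Complex.exp (-(θ * Complex.I))) =
      biharmonicMode n a b z * (circleMode (-n) : ℝ → ℂ) θ := by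
  rw [biharmonicMode, biharmonicMode, norm_rot, harmonicMode_mul, harmonicMode_exp_neg]
  ring

/-- A distribution applied to the rotated kernel `∑ biharmonicMode n (a n) (b n)` is a biharmonic
series. -/
theorem CircleDistribution.apply_eq_biharmonicSeries (T : CircleDistribution) {K : ℂ → ℂ}
    {a b : ℤ → ℂ} (ha : PolynomialGrowth a) (hb : PolynomialGrowth b)
    (hK : ∀ w : ℂ, ‖w‖ < 1 → HasSum (fun n => biharmonicMode n (a n) (b n) w) (K w)) {z : ℂ}
    (hz : ‖z‖ < 1) (φ : CircleTest)
    (hφ : ∀ θ : ℝ, (φ : ℝ → ℂ) θ = K (z * Complex.exp (-(θ * Complex.I)))) :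
    T.1 φ = biharmonicSeries (fun n => a n * T.1 (circleMode (-n)))
      (fun n => b n * T.1 (circleMode (-n))) z := by
  have hs : Summable fun n => ‖biharmonicMode n (a n) (b n) z‖ :=
    Summable.of_nonneg_of_le (fun _ => norm_nonneg _)
      (fun n => norm_biharmonicMode_le n (a n) (b n) hz.le le_rfl)
      (summable_biharmonicMode_bound ha hb (norm_nonneg z) hz)
  have hcoeff : ∀ n, circleCoeff φ n = biharmonicMode (-n) (a (-n)) (b (-n)) z := by
    refine circleCoeff_eq_of_hasSum ((Equiv.neg ℤ).summable_iff.2 hs) fun θ => ?_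
    have h1 := hK _ ((norm_rot z θ).trans_lt hz)
    rw [← hφ] at h1
    simp only [biharmonicMode_rot] at h1
    refine ((Equiv.neg ℤ).hasSum_iff.2 h1).congr_fun fun n => ?_
    simp
  have h := (Equiv.neg ℤ).hasSum_iff.2 (CircleDistribution.hasSum T φ)
  rw [← h.tsum_eq, biharmonicSeries]
  refine tsum_congr fun n => ?_
  simp only [Function.comp_apply, Equiv.neg_apply, hcoeff, neg_neg, biharmonicMode]
  ring

theorem CircleDistribution.polynomialGrowth (T : CircleDistribution) :
    PolynomialGrowth fun n => T.1 (circleMode (-n)) := by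
  obtain ⟨N, C, hC, h⟩ := CircleDistribution.exists_norm_le T
  refine ⟨N, C, hC, fun n => ?_⟩
  simpa using h (-n)

theorem polynomialGrowth_const (c : ℂ) : PolynomialGrowth fun _ => c :=
  ⟨0, ‖c‖, norm_nonneg c, fun _ => by simp⟩

theorem SolvesBiharmonicDirichlet.congr {g Φ Ψ : ℂ → ℂ} {f h : CircleDistribution}
    (H : SolvesBiharmonicDirichlet g f h Φ) (he : EqOn Φ Ψ (ball 0 1)) :
    SolvesBiharmonicDirichlet g f h Ψ := by
  have key : ∀ φ : CircleTest, ∀ᶠ r in 𝓝[<] (1 : ℝ), dilatePairing Φ r φ = dilatePairing Ψ r φ :=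
    fun φ => by
      filter_upwards [eventually_mem_Ioo_nhdsLT_one] with r hr
      simp only [dilatePairing, he (circle_mul_mem_ball ⟨hr.1.le, hr.2⟩ _)]
  refine ⟨H.1, H.2.congr he.symm, H.3.congr he, fun φ => (H.4 φ).congr' (key φ), fun φ =>
    (H.5 φ).congr' ?_⟩
  filter_upwards [key φ] with r hr
  rw [hr]

theorem hasSum_apply_circleMode_neg (T : CircleDistribution) (φ : CircleTest) :
    HasSum (fun n => T.1 (circleMode (-n)) * circleCoeff φ (-n)) (T.1 φ) := by
  refine ((Equiv.neg ℤ).hasSum_iff.2 (CircleDistribution.hasSum T φ)).congr_fun fun n => ?_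
  simp [mul_comm]

theorem solves_operatorF (f : CircleDistribution) :
    SolvesBiharmonicDirichlet 0 f 0 (operatorF f) := by
  have hgr := CircleDistribution.polynomialGrowth f
  refine SolvesBiharmonicDirichlet.congr (Φ := biharmonicSeries
    (fun n => 1 * f.1 (circleMode (-n))) fun n => (1 / 2 * n.natAbs) * f.1 (circleMode (-n)))
    (solves_biharmonicSeries (hgr.const_mul 1) ?_ (fun φ => ?_) fun φ => ?_) fun z hz => ?_
  · simpa only [mul_assoc] using hgr.natAbs_mul.const_mul (1 / 2)
  · simpa only [one_mul] using hasSum_apply_circleMode_neg f φ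
  · refine hasSum_zero.congr_fun fun n => ?_
    ring
  · have hz' := mem_ball_zero_iff.1 hz
    rw [operatorF, dif_pos hz']
    refine (CircleDistribution.apply_eq_biharmonicSeries f
      (K := fun w => (kernelF w : ℂ)) (a := fun _ => 1) (b := fun n => 1 / 2 * n.natAbs) (polynomialGrowth_const 1) ?_
      (fun w => hasSum_kernelF) hz' _ fun θ => rfl).symm
    simpa using (polynomialGrowth_const 1).natAbs_mul.const_mul (1 / 2)

theorem solves_operatorH (h : CircleDistribution) :
    SolvesBiharmonicDirichlet 0 0 h (operatorH h) := by
  have hgr := CircleDistribution.polynomialGrowth h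
  refine SolvesBiharmonicDirichlet.congr (Φ := biharmonicSeries
    (fun n => 0 * h.1 (circleMode (-n))) fun n => (1 / 2) * h.1 (circleMode (-n)))
    (solves_biharmonicSeries (hgr.const_mul 0) (hgr.const_mul (1 / 2)) (fun φ => ?_) fun φ => ?_)
    fun z hz => ?_
  · refine hasSum_zero.congr_fun fun n => ?_
    ring
  · refine (hasSum_apply_circleMode_neg h φ).congr_fun fun n => ?_
    ring
  · have hz' := mem_ball_zero_iff.1 hz
    rw [operatorH, dif_pos hz']
    exact (CircleDistribution.apply_eq_biharmonicSeries h
      (K := fun w => (kernelH w : ℂ)) (a := fun _ => 0) (b := fun _ => 1 / 2) (polynomialGrowth_const 0)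
      (polynomialGrowth_const (1 / 2)) (fun w => hasSum_kernelH) hz' _ fun θ => rfl).symm

/-! ### Almansi functions -/

theorem WeakBilaplacianEq.congr_right {Φ g k : ℂ → ℂ} (h : WeakBilaplacianEq Φ g)
    (hgk : EqOn g k (ball 0 1)) : WeakBilaplacianEq Φ k := by
  intro φ hφ hc hs
  rw [h φ hφ hc hs]
  exact setIntegral_congr_fun measurableSet_ball fun z hz => by simp only [hgk hz]

theorem DifferentiableOn.contDiffOn_real {F : ℂ → ℂ} {U : Set ℂ} (hU : IsOpen U)
    (hF : DifferentiableOn ℂ F U) : ContDiffOn ℝ ∞ F U :=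
  ((hF.contDiffOn hU : ContDiffOn ℂ ∞ F U)).restrict_scalars ℝ

theorem contDiffOn_conj_mul_add {F E : ℂ → ℂ} {U : Set ℂ} (hU : IsOpen U)
    (hF : DifferentiableOn ℂ F U) (hE : DifferentiableOn ℂ E U) :
    ContDiffOn ℝ ∞ (fun z => (starRingEnd ℂ) z * F z + E z) U :=
  (contDiff_conj.contDiffOn.mul (hF.contDiffOn_real hU)).add (hE.contDiffOn_real hU)

theorem dLaplacian_conj_mul_add {F E : ℂ → ℂ} {U : Set ℂ} (hU : IsOpen U)
    (hF : DifferentiableOn ℂ F U) (hE : DifferentiableOn ℂ E U) :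
    EqOn (dLaplacian fun z => (starRingEnd ℂ) z * F z + E z) (deriv F) U := by
  intro z hz
  have hd : ∀ G : ℂ → ℂ, DifferentiableOn ℂ G U → ∀ y ∈ U, HasWirtingerAt G (deriv G y) 0 y :=
    fun G hG y hy => HasWirtingerAt.of_hasDerivAt
      ((hG.differentiableAt (hU.mem_nhds hy)).hasDerivAt)
  refine dLaplacian_eq_of_hasWirtingerAt (a := fun y => (starRingEnd ℂ) y * deriv F y + deriv E y)
    (b := F) (p := (starRingEnd ℂ) z * deriv (deriv F) z + deriv (deriv E) z)
    (((contDiffOn_infty.1 (contDiffOn_conj_mul_add hU hF hE) 2).contDiffAt (hU.mem_nhds hz))) ?_ ?_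
  · filter_upwards [hU.mem_nhds hz] with y hy
    exact (((HasWirtingerAt.conj y).mul (hd F hF y hy)).add (hd E hE y hy)).congr
      (by ring) (by ring)
  · exact (((HasWirtingerAt.conj z).mul (hd _ (hF.deriv hU) z hz)).add
      (hd _ (hE.deriv hU) z hz)).congr (by ring) (by ring)

/-- Functions `z̄ F + E` with `F`, `E` holomorphic are biharmonic. -/
theorem weakBilaplacianEq_conj_mul_add {F E : ℂ → ℂ} (hF : DifferentiableOn ℂ F (ball 0 1))
    (hE : DifferentiableOn ℂ E (ball 0 1)) :
    WeakBilaplacianEq (fun z => (starRingEnd ℂ) z * F z + E z) 0 := by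
  refine (WeakBilaplacianEq.of_contDiffOn (contDiffOn_conj_mul_add isOpen_ball hF hE)).congr_right
    fun z hz => ?_
  have h0 : DifferentiableOn ℂ (0 : ℂ → ℂ) (ball 0 1) := differentiableOn_const 0
  have h1 := dLaplacian_eqOn_of_isOpen isOpen_ball (dLaplacian_conj_mul_add isOpen_ball hF hE) hz
  have h2 := dLaplacian_conj_mul_add isOpen_ball h0 (hF.deriv isOpen_ball) hz
  simp only [Pi.zero_apply, mul_zero, zero_add] at h2
  rw [h1]
  refine h2.trans ?_
  simp

/-! ### The regular part of the Green function -/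

/-- The regular part of the biharmonic Green function; subtracting the fundamental solution
`|z - ζ|² log |z - ζ|²` from it gives `G(z, ζ)`. -/
noncomputable def regularGreen (ζ z : ℂ) : ℝ :=
  ‖z - ζ‖ ^ 2 * Real.log (‖1 - (starRingEnd ℂ) ζ * z‖ ^ 2) - (1 - ‖z‖ ^ 2) * (1 - ‖ζ‖ ^ 2)

theorem norm_conj_mul_lt_one {z ζ : ℂ} (hz : ‖z‖ < 1) (hζ : ‖ζ‖ < 1) :
    ‖(starRingEnd ℂ) ζ * z‖ < 1 := by
  rw [norm_mul, RCLike.norm_conj]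
  nlinarith [norm_nonneg z, norm_nonneg ζ]

/-- This holds at `z = ζ` too, where both logarithms are multiplied by zero. -/
theorem biharmonicGreen_eq {z ζ : ℂ} (hz : ‖z‖ < 1) (hζ : ‖ζ‖ < 1) :
    biharmonicGreen z ζ = regularGreen ζ z - ‖z - ζ‖ ^ 2 * Real.log (‖z - ζ‖ ^ 2) := by
  rw [biharmonicGreen, regularGreen]
  rcases eq_or_ne z ζ with rfl | h
  · simp
  · have h1 : ‖z - ζ‖ ≠ 0 := norm_ne_zero_iff.2 (sub_ne_zero.2 h)
    have h2 : ‖1 - (starRingEnd ℂ) ζ * z‖ ≠ 0 :=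
      norm_ne_zero_iff.2 (one_sub_ne_zero_of_norm_lt_one (norm_conj_mul_lt_one hz hζ))
    rw [norm_div, div_pow, Real.log_div (pow_ne_zero 2 h2) (pow_ne_zero 2 h1)]
    ring

theorem weakBilaplacianEq_regularGreen {ζ : ℂ} (hζ : ‖ζ‖ < 1) :
    WeakBilaplacianEq (fun z => (regularGreen ζ z : ℂ)) 0 := by
  set k : ℂ := 1 - (‖ζ‖ ^ 2 : ℝ) with hk
  set l : ℂ → ℂ := fun z => Complex.log (1 - (starRingEnd ℂ) ζ * z) with hl
  have hld : DifferentiableOn ℂ l (ball 0 1) := by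
    intro z hz
    have h1 := norm_conj_mul_lt_one (mem_ball_zero_iff.1 hz) hζ
    have h2 : 1 - (starRingEnd ℂ) ζ * z ∈ Complex.slitPlane := by
      have := Complex.mem_slitPlane_of_norm_lt_one (z := -((starRingEnd ℂ) ζ * z))
        (by rwa [norm_neg])
      rwa [← sub_eq_add_neg] at this
    have h3 : DifferentiableAt ℂ (fun z => 1 - (starRingEnd ℂ) ζ * z) z := by fun_prop
    exact (h3.clog h2).differentiableWithinAt
  set F : ℂ → ℂ := fun z => (z - ζ) * l z + k / 2 * z with hF
  set E : ℂ → ℂ := fun z => -(starRingEnd ℂ) ζ * ((z - ζ) * l z) - k / 2 with hE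
  have hFd : DifferentiableOn ℂ F (ball 0 1) := by fun_prop
  have hEd : DifferentiableOn ℂ E (ball 0 1) := by fun_prop
  set A : ℂ → ℂ := fun z => (starRingEnd ℂ) z * F z + E z with hA
  have h1 : WeakBilaplacianEq A 0 := weakBilaplacianEq_conj_mul_add hFd hEd
  have hAc : ContinuousOn A (ball 0 1) := (contDiffOn_conj_mul_add isOpen_ball hFd hEd).continuousOn
  have h2 : WeakBilaplacianEq (fun z => (starRingEnd ℂ) (A z)) 0 := by
    have := h1.conj
    simp only [Pi.zero_apply, map_zero] at this
    exact this
  have h3 := h1.add h2 hAc (Complex.continuous_conj.comp_continuousOn hAc)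
    locallyIntegrableOn_zero locallyIntegrableOn_zero
  rw [add_zero] at h3
  refine h3.congr fun z hz => ?_
  have hlog : l z + (starRingEnd ℂ) (l z) =
      (Real.log (‖1 - (starRingEnd ℂ) ζ * z‖ ^ 2) : ℝ) := by
    rw [Complex.add_conj, Complex.log_re, Real.log_pow]
    push_cast
    rfl
  have e1 : ((‖z - ζ‖ ^ 2 : ℝ) : ℂ) = (z - ζ) * ((starRingEnd ℂ) z - (starRingEnd ℂ) ζ) := by
    rw [norm_sq_eq_mul_conj, map_sub]
  have e2 := norm_sq_eq_mul_conj z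
  have hkc : (starRingEnd ℂ) k = k := by
    simp [hk]
  rw [regularGreen, Complex.ofReal_sub, Complex.ofReal_mul, ← hlog, e1, Complex.ofReal_mul,
    Complex.ofReal_sub, Complex.ofReal_sub, e2, Complex.ofReal_one, ← hk]
  simp only [Pi.add_apply, hA, hF, hE, map_add, map_sub, map_mul, map_div₀, map_neg, hkc,
    Complex.conj_conj, map_ofNat]
  ring

/-! ### The fundamental solution of the bilaplacian -/

/-- `Δ² ((s + ε) log (s + ε)) = 2 ε² / (s + ε)³` with `s = |z|²`: smooth approximations to the
fundamental solution, whose bilaplacians form an approximate identity. -/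
theorem dLaplacian_dLaplacian_regularized {ε : ℝ} (hε : 0 < ε) (z : ℂ) :
    dLaplacian (dLaplacian fun y => (((‖y‖ ^ 2 + ε) * Real.log (‖y‖ ^ 2 + ε) : ℝ) : ℂ)) z =
      ((2 * ε ^ 2 / (‖z‖ ^ 2 + ε) ^ 3 : ℝ) : ℂ) := by
  have hpos : ∀ y : ℂ, ∀ᶠ s in 𝓝 (‖y‖ ^ 2), 0 < s + ε := fun y => by
    have h : ContinuousAt (fun s : ℝ => s + ε) (‖y‖ ^ 2) := by fun_prop
    exact h.eventually (lt_mem_nhds (by positivity))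
  have hlog : ∀ s : ℝ, 0 < s + ε → HasDerivAt (fun s => Real.log (s + ε)) (1 / (s + ε)) s :=
    fun s hs => ((hasDerivAt_id s).add_const ε).log hs.ne'
  have hlin : ∀ s : ℝ, HasDerivAt (fun s => s + ε) 1 s := fun s => (hasDerivAt_id s).add_const ε
  have hclog : ∀ y : ℂ, ContDiffAt ℝ 2 (fun s => Real.log (s + ε)) (‖y‖ ^ 2) := fun y =>
    (contDiffAt_id.add contDiffAt_const).log (by change ‖y‖ ^ 2 + ε ≠ 0; positivity)
  have h1 : (dLaplacian fun y => (((‖y‖ ^ 2 + ε) * Real.log (‖y‖ ^ 2 + ε) : ℝ) : ℂ)) =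
      fun y => (((Real.log (‖y‖ ^ 2 + ε) + 2 - ε / (‖y‖ ^ 2 + ε) : ℝ)) : ℂ) := by
    ext y
    have hy : (0 : ℝ) < ‖y‖ ^ 2 + ε := by positivity
    have := dLaplacian_conj_pow_mul_radial 0 (z := y)
      (χ := fun s => (((s + ε) * Real.log (s + ε) : ℝ) : ℂ))
      (χ' := fun s => ((Real.log (s + ε) + 1 : ℝ) : ℂ)) (χ'' := ((1 / (‖y‖ ^ 2 + ε) : ℝ) : ℂ))
      (Complex.ofRealCLM.contDiff.contDiffAt.comp (‖y‖ ^ 2)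
        ((contDiffAt_id.add contDiffAt_const).mul (hclog y)))
      (by
        filter_upwards [hpos y] with s hs
        refine HasDerivAt.ofReal_comp ?_
        refine ((hlin s).mul (hlog s hs)).congr_deriv ?_
        field_simp)
      (HasDerivAt.ofReal_comp ((hlog _ hy).add_const 1))
    simp only [pow_zero, one_mul, Nat.cast_zero, zero_add] at this
    rw [this]
    norm_cast
    field_simp
    ring
  have hz : (0 : ℝ) < ‖z‖ ^ 2 + ε := by positivity
  have hinv : ∀ s : ℝ, 0 < s + ε → HasDerivAt (fun s => ε / (s + ε)) (-(ε / (s + ε) ^ 2)) s := by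
    intro s hs
    refine ((hasDerivAt_const s ε).div (hlin s) hs.ne').congr_deriv ?_
    field_simp
    ring
  have hinv2 : ∀ s : ℝ, 0 < s + ε →
      HasDerivAt (fun s => ε / (s + ε) ^ 2) (-(2 * ε / (s + ε) ^ 3)) s := by
    intro s hs
    refine ((hasDerivAt_const s ε).fun_div ((hlin s).fun_pow 2) (pow_ne_zero 2 hs.ne')).congr_deriv ?_
    field_simp
    ring
  have hinv1 : ∀ s : ℝ, 0 < s + ε → HasDerivAt (fun s => 1 / (s + ε)) (-(1 / (s + ε) ^ 2)) s := by
    intro s hs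
    refine ((hasDerivAt_const s 1).div (hlin s) hs.ne').congr_deriv ?_
    field_simp
    ring
  have := dLaplacian_conj_pow_mul_radial 0 (z := z)
    (χ := fun s => ((Real.log (s + ε) + 2 - ε / (s + ε) : ℝ) : ℂ))
    (χ' := fun s => ((1 / (s + ε) + ε / (s + ε) ^ 2 : ℝ) : ℂ))
    (χ'' := ((-(1 / (‖z‖ ^ 2 + ε) ^ 2) + -(2 * ε / (‖z‖ ^ 2 + ε) ^ 3) : ℝ) : ℂ))
    (Complex.ofRealCLM.contDiff.contDiffAt.comp (‖z‖ ^ 2)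
      (((hclog z).add contDiffAt_const).sub
        (contDiffAt_const.div (contDiffAt_id.add contDiffAt_const) hz.ne')))
    (by
      filter_upwards [hpos z] with s hs
      refine HasDerivAt.ofReal_comp ?_
      refine (((hlog s hs).add_const 2).sub (hinv s hs)).congr_deriv ?_
      ring)
    (HasDerivAt.ofReal_comp ((hinv1 _ hz).add (hinv2 _ hz)))
  simp only [pow_zero, one_mul, Nat.cast_zero, zero_add] at this
  rw [h1, this]
  norm_cast
  field_simp
  ring

theorem integral_inv_one_add_norm_sq_pow :
    ∫ z : ℂ, 2 / Real.pi * ((1 + ‖z‖ ^ 2) ^ 3)⁻¹ = 1 := by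
  have h1 := integral_fun_norm_addHaar (volume : Measure ℂ)
    (fun y : ℝ => 2 / Real.pi * ((1 + y ^ 2) ^ 3)⁻¹)
  have h2 : ∫ y in Ioi (0 : ℝ), y * (2 / Real.pi * ((1 + y ^ 2) ^ 3)⁻¹) = 1 / (2 * Real.pi) := by
    have hd : ∀ y ∈ Ici (0 : ℝ), HasDerivAt (fun y : ℝ => -(1 / (2 * Real.pi)) * ((1 + y ^ 2) ^ 2)⁻¹)
        (y * (2 / Real.pi * ((1 + y ^ 2) ^ 3)⁻¹)) y := by
      intro y _
      have hp : (1 + y ^ 2) ≠ 0 := by positivity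
      have e1 : HasDerivAt (fun y : ℝ => (1 + y ^ 2) ^ 2) (2 * (1 + y ^ 2) * (2 * y)) y := by
        refine (((hasDerivAt_pow 2 y).const_add 1).pow 2).congr_deriv ?_
        norm_num
      refine ((e1.inv (pow_ne_zero 2 hp)).const_mul _).congr_deriv ?_
      have := Real.pi_ne_zero
      field_simp
    have ht : Tendsto (fun y : ℝ => -(1 / (2 * Real.pi)) * ((1 + y ^ 2) ^ 2)⁻¹) atTop
        (𝓝 (-(1 / (2 * Real.pi)) * 0)) := by
      refine Tendsto.const_mul _ (tendsto_inv_atTop_zero.comp ?_)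
      exact (tendsto_pow_atTop two_ne_zero).comp
        (tendsto_atTop_add_const_left _ _ (tendsto_pow_atTop two_ne_zero))
    rw [integral_Ioi_of_hasDerivAt_of_nonneg' hd (fun y hy => ?_) ht]
    · norm_num
    · have : (0 : ℝ) < y := hy
      positivity
  rw [h1, Complex.finrank_real_complex]
  simp only [Nat.add_one_sub_one, pow_one, smul_eq_mul]
  rw [h2]
  simp only [Measure.real, Complex.volume_ball]
  have := Real.pi_ne_zero
  simp

theorem tendsto_integral_approxIdentity {φ : ℂ → ℂ} (hφ : Continuous φ)
    (hc : HasCompactSupport φ) :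
    Tendsto (fun c : ℝ => ∫ z, ((2 * (c⁻¹ ^ 2) ^ 2 / (‖z‖ ^ 2 + c⁻¹ ^ 2) ^ 3 : ℝ) : ℂ) * φ z) atTop
      (𝓝 (Real.pi * φ 0)) := by
  have h := tendsto_integral_comp_smul_smul_of_integrable (μ := (volume : Measure ℂ))
    (φ := fun z : ℂ => 2 / Real.pi * ((1 + ‖z‖ ^ 2) ^ 3)⁻¹) (fun z => by positivity)
    integral_inv_one_add_norm_sq_pow ?_ (hφ.integrable_of_hasCompactSupport hc) hφ.continuousAt
  · refine (h.const_mul (Real.pi : ℂ)).congr' ?_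
    filter_upwards [eventually_gt_atTop 0] with c hc0
    rw [← integral_const_mul]
    refine integral_congr_ae (Eventually.of_forall fun z => ?_)
    have hn : ‖c • z‖ = c * ‖z‖ := by rw [norm_smul, Real.norm_eq_abs, abs_of_pos hc0]
    simp only [hn]
    simp only [Complex.finrank_real_complex, Complex.real_smul, ← mul_assoc]
    congr 1
    norm_cast
    have := Real.pi_ne_zero
    have h1 : (1 + c ^ 2 * ‖z‖ ^ 2) ≠ 0 := by positivity
    field_simp
    ring
  · have h1 : Tendsto (fun t : ℝ => 2 / Real.pi * (1 + t ^ 2)⁻¹) atTop (𝓝 (2 / Real.pi * 0)) :=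
      Tendsto.const_mul _ (tendsto_inv_atTop_zero.comp
        (tendsto_atTop_add_const_left _ _ (tendsto_pow_atTop two_ne_zero)))
    rw [mul_zero] at h1
    refine squeeze_zero (fun z => by positivity) (fun z => ?_)
      (h1.comp (tendsto_norm_cobounded_atTop (E := ℂ)))
    simp only [Complex.finrank_real_complex, Function.comp_apply]
    rw [mul_left_comm]
    gcongr
    rw [← div_eq_mul_inv, div_le_iff₀ (by positivity), pow_succ' _ 2, ← mul_assoc,
      inv_mul_cancel₀ (by positivity), one_mul]
    nlinarith [sq_nonneg ‖z‖]

theorem dLaplacian_comp_add_right (f : ℂ → ℂ) (c z : ℂ) :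
    dLaplacian (fun y => f (y + c)) z = dLaplacian f (z + c) := by
  simp only [dLaplacian, InnerProductSpace.laplacian_eq_iteratedFDeriv_complexPlane,
    iteratedFDeriv_comp_add_right]

theorem integral_fundamentalSolution_zero {φ : ℂ → ℂ} (hφ : ContDiff ℝ ∞ φ)
    (hc : HasCompactSupport φ) :
    ∫ z, ((‖z‖ ^ 2 * Real.log (‖z‖ ^ 2) : ℝ) : ℂ) * dLaplacian (dLaplacian φ) z =
      Real.pi * φ 0 := by
  set ψ := dLaplacian (dLaplacian φ) with hψ
  have hψc : Continuous ψ := hφ.dLaplacian.dLaplacian.continuous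
  have hψs : HasCompactSupport ψ := hc.dLaplacian.dLaplacian
  obtain ⟨R, hR⟩ := hψs.isBounded.subset_closedBall (0 : ℂ)
  have hxlogx : Continuous fun x : ℝ => x * Real.log x := Real.continuous_mul_log
  obtain ⟨M, hM⟩ := (isCompact_Icc (a := (0 : ℝ)) (b := R ^ 2 + 1)).exists_bound_of_continuousOn
    hxlogx.continuousOn
  have h1 : ∀ ε : ℝ, 0 < ε →
      ∫ z, (((‖z‖ ^ 2 + ε) * Real.log (‖z‖ ^ 2 + ε) : ℝ) : ℂ) * ψ z =
        ∫ z, ((2 * ε ^ 2 / (‖z‖ ^ 2 + ε) ^ 3 : ℝ) : ℂ) * φ z := by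
    intro ε hε
    have hs : ContDiff ℝ ∞ fun y : ℂ => (((‖y‖ ^ 2 + ε) * Real.log (‖y‖ ^ 2 + ε) : ℝ) : ℂ) := by
      have e : ContDiff ℝ ∞ fun y : ℂ => ‖y‖ ^ 2 + ε := (contDiff_norm_sq ℝ).add contDiff_const
      exact Complex.ofRealCLM.contDiff.comp (e.mul (e.log fun y => by positivity))
    rw [hψ, integral_mul_dLaplacian_dLaplacian isOpen_univ hs.contDiffOn hφ hc (subset_univ _)]
    simp only [dLaplacian_dLaplacian_regularized hε]
  have hε0 : Tendsto (fun c : ℝ => c⁻¹ ^ 2) atTop (𝓝 0) := by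
    simpa using (tendsto_inv_atTop_zero (𝕜 := ℝ)).pow 2
  have h2 : Tendsto (fun c : ℝ => ∫ z,
      (((‖z‖ ^ 2 + c⁻¹ ^ 2) * Real.log (‖z‖ ^ 2 + c⁻¹ ^ 2) : ℝ) : ℂ) * ψ z) atTop
      (𝓝 (∫ z, ((‖z‖ ^ 2 * Real.log (‖z‖ ^ 2) : ℝ) : ℂ) * ψ z)) := by
    refine tendsto_integral_filter_of_dominated_convergence (fun z => M * ‖ψ z‖)
      (Eventually.of_forall fun c => ?_) ?_ ((hψc.integrable_of_hasCompactSupport hψs).norm.const_mul M)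
      (Eventually.of_forall fun z => ?_)
    · refine Continuous.aestronglyMeasurable (Continuous.mul (Complex.continuous_ofReal.comp ?_) hψc)
      exact hxlogx.comp (by fun_prop)
    · filter_upwards [eventually_ge_atTop 1] with c hc1
      refine Eventually.of_forall fun z => ?_
      by_cases hz : z ∈ tsupport ψ
      · rw [norm_mul, Complex.norm_real]
        gcongr
        refine hM _ ⟨by positivity, ?_⟩
        have hz1 : ‖z‖ ≤ R := mem_closedBall_zero_iff.1 (hR hz)
        have hc2 : c⁻¹ ^ 2 ≤ 1 := pow_le_one₀ (by positivity) (inv_le_one_of_one_le₀ hc1)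
        gcongr
      · simp [image_eq_zero_of_notMem_tsupport hz]
    · refine Tendsto.mul_const _ ((Complex.continuous_ofReal.tendsto _).comp ?_)
      have := (hxlogx.tendsto (‖z‖ ^ 2 + 0)).comp (hε0.const_add (‖z‖ ^ 2))
      rwa [add_zero] at this
  refine tendsto_nhds_unique h2 ((tendsto_integral_approxIdentity hφ.continuous hc).congr' ?_)
  filter_upwards [eventually_gt_atTop 0] with c hc0
  exact (h1 _ (by positivity)).symm

/-- `|z - ζ|² log |z - ζ|²` is a fundamental solution: its bilaplacian is `π` times the point mass
at `ζ`. -/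
theorem integral_fundamentalSolution {φ : ℂ → ℂ} (hφ : ContDiff ℝ ∞ φ)
    (hc : HasCompactSupport φ) (ζ : ℂ) :
    ∫ z, ((‖z - ζ‖ ^ 2 * Real.log (‖z - ζ‖ ^ 2) : ℝ) : ℂ) * dLaplacian (dLaplacian φ) z =
      Real.pi * φ ζ := by
  have h := integral_fundamentalSolution_zero (φ := fun z => φ (z + ζ))
    (hφ.comp (contDiff_id.add contDiff_const)) (hc.comp_homeomorph (Homeomorph.addRight ζ))
  simp only [funext fun z => dLaplacian_comp_add_right φ ζ z,
    dLaplacian_comp_add_right (dLaplacian φ) ζ, zero_add] at h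
  rw [← h, ← integral_add_right_eq_self _ ζ]
  simp only [add_sub_cancel_right]

/-! ### Estimates for the Green function -/

/-- With `q = (1 - |z|²) (1 - |ζ|²)` and `d = |z - ζ|²` this gives
`G(z, ζ) = d (log (1 + q / d) - q / d)`. -/
theorem norm_one_sub_conj_mul_sq (z ζ : ℂ) :
    ‖1 - (starRingEnd ℂ) ζ * z‖ ^ 2 = ‖z - ζ‖ ^ 2 + (1 - ‖z‖ ^ 2) * (1 - ‖ζ‖ ^ 2) := by
  simp only [Complex.sq_norm, Complex.normSq_apply]
  simp
  ring

theorem biharmonicGreen_eq_log_one_add {z ζ : ℂ} (h : z ≠ ζ) :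
    biharmonicGreen z ζ = ‖z - ζ‖ ^ 2 *
      (Real.log (1 + (1 - ‖z‖ ^ 2) * (1 - ‖ζ‖ ^ 2) / ‖z - ζ‖ ^ 2) -
        (1 - ‖z‖ ^ 2) * (1 - ‖ζ‖ ^ 2) / ‖z - ζ‖ ^ 2) := by
  have h1 : ‖z - ζ‖ ≠ 0 := norm_ne_zero_iff.2 (sub_ne_zero.2 h)
  rw [biharmonicGreen, norm_div, div_pow, norm_one_sub_conj_mul_sq, add_div,
    div_self (pow_ne_zero 2 h1)]
  generalize Real.log _ = L
  field_simp

theorem one_sub_norm_sq_pos {z : ℂ} (hz : ‖z‖ < 1) : 0 < 1 - ‖z‖ ^ 2 := by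
  nlinarith [norm_nonneg z]

theorem abs_biharmonicGreen_le {z ζ : ℂ} (hz : ‖z‖ < 1) (hζ : ‖ζ‖ < 1) :
    |biharmonicGreen z ζ| ≤ (1 - ‖z‖ ^ 2) * (1 - ‖ζ‖ ^ 2) := by
  have hq : 0 < (1 - ‖z‖ ^ 2) * (1 - ‖ζ‖ ^ 2) :=
    mul_pos (one_sub_norm_sq_pos hz) (one_sub_norm_sq_pos hζ)
  rcases eq_or_ne z ζ with rfl | h
  · rw [biharmonicGreen, sub_self, norm_zero]
    simp only [ne_eq, OfNat.ofNat_ne_zero, not_false_eq_true, zero_pow, zero_mul, zero_sub, abs_neg]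
    rw [abs_of_pos hq]
  · have h1 : 0 < ‖z - ζ‖ ^ 2 := by
      have := norm_pos_iff.2 (sub_ne_zero.2 h)
      positivity
    rw [biharmonicGreen_eq_log_one_add h]
    set q := (1 - ‖z‖ ^ 2) * (1 - ‖ζ‖ ^ 2)
    set d := ‖z - ζ‖ ^ 2
    have ht : 0 < q / d := by positivity
    have h2 : Real.log (1 + q / d) ≤ q / d := by
      have := Real.log_le_sub_one_of_pos (x := 1 + q / d) (by positivity)
      linarith
    have h3 : 0 ≤ Real.log (1 + q / d) := Real.log_nonneg (by linarith)
    rw [abs_of_nonpos (mul_nonpos_of_nonneg_of_nonpos h1.le (by linarith))]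
    calc -(d * (Real.log (1 + q / d) - q / d)) ≤ d * (q / d) := by nlinarith
      _ = q := by field_simp

theorem abs_biharmonicGreen_le_div {z ζ : ℂ} (hz : ‖z‖ < 1) (hζ : ‖ζ‖ < 1) (h : z ≠ ζ) :
    |biharmonicGreen z ζ| ≤ ((1 - ‖z‖ ^ 2) * (1 - ‖ζ‖ ^ 2)) ^ 2 / ‖z - ζ‖ ^ 2 := by
  have hq : 0 < (1 - ‖z‖ ^ 2) * (1 - ‖ζ‖ ^ 2) :=
    mul_pos (one_sub_norm_sq_pos hz) (one_sub_norm_sq_pos hζ)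
  have h1 : 0 < ‖z - ζ‖ ^ 2 := by
    have := norm_pos_iff.2 (sub_ne_zero.2 h)
    positivity
  rw [biharmonicGreen_eq_log_one_add h]
  set q := (1 - ‖z‖ ^ 2) * (1 - ‖ζ‖ ^ 2)
  set d := ‖z - ζ‖ ^ 2
  have ht : 0 < q / d := by positivity
  have h2 : Real.log (1 + q / d) ≤ q / d := by
    have := Real.log_le_sub_one_of_pos (x := 1 + q / d) (by positivity)
    linarith
  -- `log (1 + t) ≥ t / (1 + t) ≥ t - t²`
  have h3 : q / d - (q / d) ^ 2 ≤ Real.log (1 + q / d) := by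
    refine le_trans ?_ (Real.one_sub_inv_le_log_of_pos (by positivity))
    have : 1 - (1 + q / d)⁻¹ = q / d / (1 + q / d) := by
      field_simp
      ring
    rw [this, le_div_iff₀ (by positivity)]
    nlinarith [pow_pos ht 3]
  rw [abs_of_nonpos (mul_nonpos_of_nonneg_of_nonpos h1.le (by linarith))]
  calc -(d * (Real.log (1 + q / d) - q / d)) ≤ d * (q / d) ^ 2 := by nlinarith
    _ = q ^ 2 / d := by field_simp

/-- The Green function vanishes to second order at the boundary, uniformly in the pole: either
`1 - |ζ|²` is comparable with `1 - |z|²`, or it is controlled by `|z - ζ|`. -/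
theorem abs_biharmonicGreen_le_sq {z ζ : ℂ} (hz : ‖z‖ < 1) (hζ : ‖ζ‖ < 1) :
    |biharmonicGreen z ζ| ≤ 16 * (1 - ‖z‖ ^ 2) ^ 2 := by
  have hs := one_sub_norm_sq_pos hz
  have ht := one_sub_norm_sq_pos hζ
  have htri : ‖z‖ ≤ ‖z - ζ‖ + ‖ζ‖ := by simpa using norm_add_le (z - ζ) ζ
  have h1 : 1 - ‖ζ‖ ^ 2 ≤ 2 * (‖z - ζ‖ + (1 - ‖z‖ ^ 2)) := by
    nlinarith [norm_nonneg z, norm_nonneg ζ]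
  rcases le_or_gt ‖z - ζ‖ (1 - ‖z‖ ^ 2) with h | h
  · refine (abs_biharmonicGreen_le hz hζ).trans ?_
    nlinarith
  · have hne : z ≠ ζ := by
      rintro rfl
      rw [sub_self, norm_zero] at h
      linarith
    refine (abs_biharmonicGreen_le_div hz hζ hne).trans ?_
    have hd : 0 < ‖z - ζ‖ := hs.trans h
    rw [div_le_iff₀ (by positivity), mul_pow, mul_right_comm]
    have h2 : (1 - ‖ζ‖ ^ 2) ^ 2 ≤ (4 * ‖z - ζ‖) ^ 2 := pow_le_pow_left₀ ht.le (by linarith) 2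
    nlinarith [sq_nonneg (1 - ‖z‖ ^ 2)]

/-! ### The Green potential -/

theorem measurable_biharmonicGreen : Measurable fun p : ℂ × ℂ => biharmonicGreen p.1 p.2 := by
  have h : Measurable fun z : ℂ => (starRingEnd ℂ) z := Complex.continuous_conj.measurable
  have h2 : Measurable fun p : ℂ × ℂ => (starRingEnd ℂ) p.2 := h.comp measurable_snd
  unfold biharmonicGreen
  fun_prop

theorem abs_biharmonicGreen_le_one {z ζ : ℂ} (hz : ‖z‖ < 1) (hζ : ‖ζ‖ < 1) :
    |biharmonicGreen z ζ| ≤ 1 := by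
  refine (abs_biharmonicGreen_le hz hζ).trans ?_
  have h1 := one_sub_norm_sq_pos hz
  have h2 := one_sub_norm_sq_pos hζ
  nlinarith [sq_nonneg ‖z‖, sq_nonneg ‖ζ‖]

theorem continuousOn_regularGreen {ζ : ℂ} (hζ : ‖ζ‖ < 1) :
    ContinuousOn (regularGreen ζ) (ball 0 1) := by
  unfold regularGreen
  refine ContinuousOn.sub (ContinuousOn.mul (by fun_prop) (ContinuousOn.log (by fun_prop)
    fun z hz => ?_)) (by fun_prop)
  exact pow_ne_zero 2 (norm_ne_zero_iff.2 (one_sub_ne_zero_of_norm_lt_one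
    (norm_conj_mul_lt_one (mem_ball_zero_iff.1 hz) hζ)))

theorem continuous_fundamentalSolution (ζ : ℂ) :
    Continuous fun z : ℂ => ‖z - ζ‖ ^ 2 * Real.log (‖z - ζ‖ ^ 2) :=
  Real.continuous_mul_log.comp (by fun_prop : Continuous fun z : ℂ => ‖z - ζ‖ ^ 2)

theorem continuousOn_biharmonicGreen {ζ : ℂ} (hζ : ‖ζ‖ < 1) :
    ContinuousOn (fun z => biharmonicGreen z ζ) (ball 0 1) :=
  ((continuousOn_regularGreen hζ).sub (continuous_fundamentalSolution ζ).continuousOn).congr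
    fun _ hz => biharmonicGreen_eq (mem_ball_zero_iff.1 hz) hζ

/-- `Δ²_z G(z, ζ)` is minus the point mass at `ζ`; the factor `π` appears since the integral is with
respect to Lebesgue measure instead of `dA`. -/
theorem integral_biharmonicGreen_mul {φ : ℂ → ℂ} (hφ : ContDiff ℝ ∞ φ) (hc : HasCompactSupport φ)
    (hs : tsupport φ ⊆ ball (0 : ℂ) 1) {ζ : ℂ} (hζ : ‖ζ‖ < 1) :
    ∫ z in ball (0 : ℂ) 1, (biharmonicGreen z ζ : ℂ) * dLaplacian (dLaplacian φ) z =
      -(Real.pi * φ ζ) := by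
  have hsψ : tsupport (dLaplacian (dLaplacian φ)) ⊆ ball 0 1 :=
    ((tsupport_dLaplacian_subset _).trans (tsupport_dLaplacian_subset φ)).trans hs
  have h1 := weakBilaplacianEq_iff.1 (weakBilaplacianEq_regularGreen hζ) φ hφ hc hs
  simp only [Pi.zero_apply, zero_mul, integral_zero] at h1
  have h2 := integral_fundamentalSolution hφ hc ζ
  have e : ∀ z ∈ ball (0 : ℂ) 1, (biharmonicGreen z ζ : ℂ) * dLaplacian (dLaplacian φ) z =
      (regularGreen ζ z : ℂ) * dLaplacian (dLaplacian φ) z -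
        ((‖z - ζ‖ ^ 2 * Real.log (‖z - ζ‖ ^ 2) : ℝ) : ℂ) * dLaplacian (dLaplacian φ) z := by
    intro z hz
    rw [biharmonicGreen_eq (mem_ball_zero_iff.1 hz) hζ]
    push_cast
    ring
  have i1 : Integrable fun z => (regularGreen ζ z : ℂ) * dLaplacian (dLaplacian φ) z :=
    integrable_mul_dLaplacian_dLaplacian isOpen_ball
      (Complex.continuous_ofReal.comp_continuousOn (continuousOn_regularGreen hζ)) hφ hc hs
  have i2 : Integrable fun z => ((‖z - ζ‖ ^ 2 * Real.log (‖z - ζ‖ ^ 2) : ℝ) : ℂ) *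
      dLaplacian (dLaplacian φ) z :=
    integrable_mul_dLaplacian_dLaplacian isOpen_ball
      (Complex.continuous_ofReal.comp (continuous_fundamentalSolution ζ)).continuousOn hφ hc hs
  rw [setIntegral_congr_fun measurableSet_ball e,
    setIntegral_eq_integral_of_forall_compl_eq_zero, integral_sub i1 i2, h1, h2, zero_sub]
  intro z hz
  rw [image_eq_zero_of_notMem_tsupport fun h => hz (hsψ h)]
  ring

theorem greenPotential_eq (g : ℂ → ℂ) (z : ℂ) :
    greenPotential g z =
      (1 / Real.pi : ℝ) • ∫ ζ in ball (0 : ℂ) 1, (biharmonicGreen z ζ : ℂ) * g ζ :=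
  setIntegral_normalizedArea _ _

theorem integrableOn_normalizedArea {F : ℂ → ℂ} {s : Set ℂ} (h : IntegrableOn F s) :
    IntegrableOn F s normalizedArea := by
  rw [IntegrableOn, normalizedArea, Measure.restrict_smul]
  exact h.smul_measure ENNReal.ofReal_ne_top

section Continuous

variable {g : ℂ → ℂ}

theorem integrableOn_of_continuousOn_closedBall (hg : ContinuousOn g (closedBall 0 1)) :
    IntegrableOn g (ball 0 1) :=
  (hg.integrableOn_compact (isCompact_closedBall 0 1)).mono_set ball_subset_closedBall

theorem integrableOn_biharmonicGreen_mul (hg : ContinuousOn g (closedBall 0 1)) {z : ℂ}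
    (hz : z ∈ ball (0 : ℂ) 1) :
    IntegrableOn (fun ζ => (biharmonicGreen z ζ : ℂ) * g ζ) (ball (0 : ℂ) 1) := by
  refine (integrableOn_of_continuousOn_closedBall hg).bdd_mul (c := 1) ?_ ?_
  · exact (Complex.measurable_ofReal.comp (measurable_biharmonicGreen.comp
      measurable_prodMk_left)).aestronglyMeasurable
  · refine (ae_restrict_iff' measurableSet_ball).2 (Eventually.of_forall fun ζ hζ => ?_)
    rw [Complex.norm_real]
    exact abs_biharmonicGreen_le_one (mem_ball_zero_iff.1 hz) (mem_ball_zero_iff.1 hζ)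

theorem continuousOn_greenPotential (hg : ContinuousOn g (closedBall 0 1)) :
    ContinuousOn (greenPotential g) (ball 0 1) := by
  have h : ContinuousOn (fun z => ∫ ζ in ball (0 : ℂ) 1, (biharmonicGreen z ζ : ℂ) * g ζ)
      (ball 0 1) := by
    refine continuousOn_of_dominated (bound := fun ζ => ‖g ζ‖)
      (fun z hz => (integrableOn_biharmonicGreen_mul hg hz).aestronglyMeasurable) (fun z hz => ?_)
      (integrableOn_of_continuousOn_closedBall hg).norm ?_
    · refine (ae_restrict_iff' measurableSet_ball).2 (Eventually.of_forall fun ζ hζ => ?_)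
      rw [norm_mul, Complex.norm_real]
      exact mul_le_of_le_one_left (norm_nonneg _)
        (abs_biharmonicGreen_le_one (mem_ball_zero_iff.1 hz) (mem_ball_zero_iff.1 hζ))
    · refine (ae_restrict_iff' measurableSet_ball).2 (Eventually.of_forall fun ζ hζ => ?_)
      exact (Complex.continuous_ofReal.comp_continuousOn
        (continuousOn_biharmonicGreen (mem_ball_zero_iff.1 hζ))).mul continuousOn_const
  exact (h.const_smul (1 / Real.pi : ℝ)).congr fun z _ => greenPotential_eq g z

/-- `Δ² G[g] = -g`, by Fubini's theorem. -/
theorem weakBilaplacianEq_greenPotential (hg : ContinuousOn g (closedBall 0 1)) :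
    WeakBilaplacianEq (greenPotential g) (fun z => -1 * g z) := by
  rw [weakBilaplacianEq_iff]
  intro φ hφ hc hs
  set ψ := dLaplacian (dLaplacian φ) with hψ
  have hψc : Continuous ψ := hφ.dLaplacian.dLaplacian.continuous
  have hψs : HasCompactSupport ψ := hc.dLaplacian.dLaplacian
  have hsψ : tsupport ψ ⊆ ball 0 1 :=
    ((tsupport_dLaplacian_subset _).trans (tsupport_dLaplacian_subset φ)).trans hs
  set μ : Measure ℂ := volume.restrict (ball (0 : ℂ) 1) with hμ
  have hpi : (Real.pi : ℂ) ≠ 0 := Complex.ofReal_ne_zero.2 Real.pi_ne_zero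
  have e1 : ∫ z, greenPotential g z * ψ z = ∫ z in ball (0 : ℂ) 1, greenPotential g z * ψ z := by
    rw [setIntegral_eq_integral_of_forall_compl_eq_zero]
    intro z hz
    rw [image_eq_zero_of_notMem_tsupport fun h => hz (hsψ h), mul_zero]
  have e2 : ∀ z, greenPotential g z * ψ z =
      (1 / Real.pi : ℂ) * ∫ ζ, (biharmonicGreen z ζ : ℂ) * g ζ * ψ z ∂μ := by
    intro z
    rw [greenPotential_eq, Complex.real_smul, integral_mul_const, mul_assoc]
    push_cast
    rfl
  have hint : Integrable (Function.uncurry fun z ζ : ℂ => (biharmonicGreen z ζ : ℂ) * g ζ * ψ z)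
      (μ.prod μ) := by
    have h1 : Integrable (fun p : ℂ × ℂ => ψ p.1 * g p.2) (μ.prod μ) :=
      (hψc.integrable_of_hasCompactSupport hψs).restrict.mul_prod
        (integrableOn_of_continuousOn_closedBall hg)
    have h2 : Integrable (fun p : ℂ × ℂ => (biharmonicGreen p.1 p.2 : ℂ) * (ψ p.1 * g p.2))
        (μ.prod μ) := by
      refine h1.bdd_mul (c := 1)
        (Complex.measurable_ofReal.comp measurable_biharmonicGreen).aestronglyMeasurable ?_
      rw [hμ, Measure.prod_restrict]
      refine (ae_restrict_iff' (measurableSet_ball.prod measurableSet_ball)).2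
        (Eventually.of_forall fun p hp => ?_)
      rw [Complex.norm_real]
      exact abs_biharmonicGreen_le_one (mem_ball_zero_iff.1 hp.1) (mem_ball_zero_iff.1 hp.2)
    refine h2.congr (Eventually.of_forall fun p => ?_)
    simp only [Function.uncurry]
    ring
  rw [e1]
  simp only [e2]
  rw [integral_const_mul, ← hμ, integral_integral_swap hint]
  have e3 : ∀ ζ ∈ ball (0 : ℂ) 1, ∫ z, (biharmonicGreen z ζ : ℂ) * g ζ * ψ z ∂μ =
      -(Real.pi : ℂ) * (g ζ * φ ζ) := by
    intro ζ hζ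
    have := integral_biharmonicGreen_mul hφ hc hs (mem_ball_zero_iff.1 hζ)
    simp only [mul_right_comm _ (g ζ)]
    rw [integral_mul_const, this]
    ring
  rw [hμ, setIntegral_congr_fun measurableSet_ball e3, integral_const_mul, ← mul_assoc,
    setIntegral_eq_integral_of_forall_compl_eq_zero (fun ζ hζ => by
      rw [image_eq_zero_of_notMem_tsupport fun h => hζ (hs h), mul_zero])]
  simp only [mul_assoc, integral_const_mul]
  field_simp

theorem exists_norm_greenPotential_le (hg : ContinuousOn g (closedBall 0 1)) :
    ∃ C, 0 ≤ C ∧ ∀ z ∈ ball (0 : ℂ) 1, ‖greenPotential g z‖ ≤ C * (1 - ‖z‖ ^ 2) ^ 2 := by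
  refine ⟨1 / Real.pi * (16 * ∫ ζ in ball (0 : ℂ) 1, ‖g ζ‖), by positivity, fun z hz => ?_⟩
  rw [greenPotential_eq, norm_smul, Real.norm_eq_abs, abs_of_pos (by positivity), mul_assoc]
  gcongr
  rw [mul_right_comm, ← integral_const_mul]
  refine norm_integral_le_of_norm_le ((integrableOn_of_continuousOn_closedBall hg).norm.const_mul _)
    ((ae_restrict_iff' measurableSet_ball).2 (Eventually.of_forall fun ζ hζ => ?_))
  rw [norm_mul, Complex.norm_real]
  gcongr
  exact abs_biharmonicGreen_le_sq (mem_ball_zero_iff.1 hz) (mem_ball_zero_iff.1 hζ)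

theorem norm_dilatePairing_le {Φ : ℂ → ℂ} {r B M : ℝ} {φ : CircleTest}
    (hB : ∀ θ : ℝ, ‖Φ (r * Complex.exp (θ * Complex.I))‖ ≤ B)
    (hM : ∀ θ, ‖(φ : ℝ → ℂ) θ‖ ≤ M) : ‖dilatePairing Φ r φ‖ ≤ B * M := by
  have hB0 : 0 ≤ B := (norm_nonneg _).trans (hB 0)
  have h := norm_circleCoeff_le (φ := fun θ => Φ (r * Complex.exp (θ * Complex.I)) *
    (φ : ℝ → ℂ) θ) (M := B * M) (fun θ => by
      rw [norm_mul]
      exact mul_le_mul (hB θ) (hM θ) (norm_nonneg _) hB0) 0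
  have e : circleCoeff (fun θ => Φ (r * Complex.exp (θ * Complex.I)) * (φ : ℝ → ℂ) θ) 0 =
      dilatePairing Φ r φ := by
    rw [circleCoeff, dilatePairing]
    simp [circleMode_apply]
  rwa [e] at h

theorem solves_greenPotential (hg : ContinuousOn g (closedBall 0 1)) :
    SolvesBiharmonicDirichlet (fun z => -1 * g z) 0 0 (greenPotential g) := by
  obtain ⟨C, hC0, hC⟩ := exists_norm_greenPotential_le hg
  have key : ∀ φ : CircleTest, Tendsto (fun r : ℝ => dilatePairing (greenPotential g) r φ /
      (1 - r : ℂ)) (𝓝[<] 1) (𝓝 0) := by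
    intro φ
    obtain ⟨M, hM⟩ := exists_norm_le_of_mem_circleTest φ.2
    have h1 : Tendsto (fun r : ℝ => C * M * ((1 - r) * (1 + r) ^ 2)) (𝓝[<] 1)
        (𝓝 (C * M * ((1 - 1) * (1 + 1) ^ 2))) :=
      (Continuous.tendsto (by fun_prop) 1).mono_left nhdsWithin_le_nhds
    rw [sub_self, zero_mul, mul_zero] at h1
    refine squeeze_zero_norm' ?_ h1
    filter_upwards [eventually_mem_Ioo_nhdsLT_one] with r hr
    have h2 : 0 < 1 - r := by linarith [hr.2]
    have h3 : ‖(1 - r : ℂ)‖ = 1 - r := by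
      rw [← Complex.ofReal_one, ← Complex.ofReal_sub, Complex.norm_real, Real.norm_eq_abs,
        abs_of_pos h2]
    rw [norm_div, h3, div_le_iff₀ h2]
    refine (norm_dilatePairing_le (fun θ => ?_) hM).trans
      (le_of_eq (?_ : C * (1 - r ^ 2) ^ 2 * M = _))
    · have := hC _ (circle_mul_mem_ball ⟨hr.1.le, hr.2⟩ θ)
      rwa [norm_circle_mul hr.1.le] at this
    · ring
  refine ⟨?_, continuousOn_greenPotential hg, weakBilaplacianEq_greenPotential hg, fun φ => ?_,
    fun φ => ?_⟩
  · exact (continuousOn_const.mul (hg.mono ball_subset_closedBall)).locallyIntegrableOn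
      measurableSet_ball
  · have h1 : Tendsto (fun r : ℝ => (1 - r : ℂ)) (𝓝[<] 1) (𝓝 0) := by
      have : Continuous fun r : ℝ => (1 - r : ℂ) := by fun_prop
      exact (this.tendsto' 1 0 (by simp)).mono_left nhdsWithin_le_nhds
    have h2 := (key φ).mul h1
    rw [mul_zero] at h2
    refine h2.congr' ?_
    filter_upwards [eventually_mem_Ioo_nhdsLT_one] with r hr
    exact div_mul_cancel₀ _ (sub_ne_zero.2 (by exact_mod_cast hr.2.ne'))
  · refine (key φ).congr fun r => ?_
    change _ = (_ - 0) / _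
    rw [sub_zero]

theorem solves_neg_greenPotential (hg : ContinuousOn g (closedBall 0 1)) :
    SolvesBiharmonicDirichlet g 0 0 fun z => -greenPotential g z := by
  have h := (solves_greenPotential hg).const_mul (-1)
  simpa using h

end Continuous

/-! ### Solutions smooth up to the boundary -/

/-- The Laplacian of a function smooth up to the boundary is smooth up to the boundary. Derivatives
within the closed disk are used, as `dLaplacian w` may be arbitrary on the circle itself. -/
theorem exists_contDiffOn_closedBall_eqOn_dLaplacian {w : ℂ → ℂ}
    (hw : ContDiffOn ℝ ∞ w (closedBall 0 1)) :
    ∃ v : ℂ → ℂ, ContDiffOn ℝ ∞ v (closedBall 0 1) ∧ EqOn v (dLaplacian w) (ball 0 1) := by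
  have hu : UniqueDiffOn ℝ (closedBall (0 : ℂ) 1) :=
    uniqueDiffOn_convex (convex_closedBall (0 : ℂ) 1) (by
      rw [interior_closedBall _ one_ne_zero]
      exact ⟨0, mem_ball_self one_pos⟩)
  have hd : ∀ (f : ℂ → ℂ) (v : ℂ), ContDiffOn ℝ ∞ f (closedBall 0 1) →
      ContDiffOn ℝ ∞ (fun z => fderivWithin ℝ f (closedBall 0 1) z v) (closedBall 0 1) :=
    fun f v hf => (hf.fderivWithin hu (m := ∞) (by simp)).clm_apply contDiffOn_const
  have he : ∀ (f : ℂ → ℂ) (v : ℂ), ∀ z ∈ ball (0 : ℂ) 1,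
      fderivWithin ℝ f (closedBall 0 1) z v = fderiv ℝ f z v := fun f v z hz => by
    rw [fderivWithin_of_mem_nhds (mem_of_superset (isOpen_ball.mem_nhds hz) ball_subset_closedBall)]
  refine ⟨fun z => 1 / 4 * (fderivWithin ℝ (fun y => fderivWithin ℝ w (closedBall 0 1) y 1)
    (closedBall 0 1) z 1 + fderivWithin ℝ (fun y => fderivWithin ℝ w (closedBall 0 1) y Complex.I)
    (closedBall 0 1) z Complex.I), contDiffOn_const.mul ((hd _ _ (hd _ _ hw)).add
      (hd _ _ (hd _ _ hw))), fun z hz => ?_⟩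
  rw [dLaplacian_eqOn isOpen_ball (hw.mono ball_subset_closedBall) hz]
  simp only
  rw [he _ _ z hz, he _ _ z hz]
  have hloc : ∀ v : ℂ, (fun y => fderivWithin ℝ w (closedBall 0 1) y v) =ᶠ[𝓝 z]
      fun y => fderiv ℝ w y v := fun v => by
    filter_upwards [isOpen_ball.mem_nhds hz] with y hy using he w v y hy
  rw [(hloc 1).fderiv_eq, (hloc Complex.I).fderiv_eq]

theorem WeakBilaplacianEq.ae_eq {Φ g k : ℂ → ℂ} (hg : WeakBilaplacianEq Φ g)
    (hk : WeakBilaplacianEq Φ k) (hgl : LocallyIntegrableOn g (ball (0 : ℂ) 1))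
    (hkl : LocallyIntegrableOn k (ball (0 : ℂ) 1)) :
    ∀ᵐ z : ℂ, z ∈ ball (0 : ℂ) 1 → g z = k z := by
  rw [weakBilaplacianEq_iff] at hg hk
  have h := isOpen_ball.ae_eq_zero_of_integral_contDiff_smul_eq_zero (hgl.sub hkl)
    fun η hη hc hs => by
      have hsub : tsupport (fun z => (η z : ℂ)) ⊆ tsupport η :=
        closure_mono fun z hz => by simpa using hz
      have hs' := hsub.trans hs
      have hη' : ContDiff ℝ ∞ fun z => (η z : ℂ) := Complex.ofRealCLM.contDiff.comp hη
      have hc' : HasCompactSupport fun z => (η z : ℂ) :=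
        hc.of_isClosed_subset (isClosed_tsupport _) hsub
      have e : ∫ z, (g z * (η z : ℂ) - k z * (η z : ℂ)) = 0 := by
        rw [integral_sub (hgl.integrable_mul hη'.continuous hc' hs')
          (hkl.integrable_mul hη'.continuous hc' hs'), ← hg _ hη' hc' hs', ← hk _ hη' hc' hs',
          sub_self]
      rw [← e]
      refine integral_congr_ae (Eventually.of_forall fun z => ?_)
      simp only [Pi.sub_apply, Complex.real_smul]
      ring
  filter_upwards [h] with z hz hzb
  exact sub_eq_zero.1 (hz hzb)

theorem ae_restrict_normalizedArea {g k : ℂ → ℂ}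
    (h : ∀ᵐ z : ℂ, z ∈ ball (0 : ℂ) 1 → g z = k z) :
    g =ᵐ[normalizedArea.restrict (ball 0 1)] k := by
  rw [normalizedArea, Measure.restrict_smul]
  exact Measure.ae_smul_measure ((ae_restrict_iff' measurableSet_ball).2 h) _

/-- A solution that is smooth up to the boundary and has zero boundary data is a Green
potential. -/
theorem SolvesBiharmonicDirichlet.eq_neg_greenPotential {g w : ℂ → ℂ}
    (hw : ContDiffOn ℝ ∞ w (closedBall 0 1)) (H : SolvesBiharmonicDirichlet g 0 0 w) :
    ∀ z ∈ ball (0 : ℂ) 1, IntegrableOn (fun ζ => (biharmonicGreen z ζ : ℂ) * g ζ)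
      (ball (0 : ℂ) 1) normalizedArea ∧ w z = -greenPotential g z := by
  obtain ⟨v, hv, hvw⟩ := exists_contDiffOn_closedBall_eqOn_dLaplacian hw
  obtain ⟨k, hk, hkv⟩ := exists_contDiffOn_closedBall_eqOn_dLaplacian hv
  -- `k` is a representative of `g` that is continuous up to the boundary
  have hweak : WeakBilaplacianEq w k :=
    (WeakBilaplacianEq.of_contDiffOn (hw.mono ball_subset_closedBall)).congr_right fun z hz =>
      ((hkv hz).trans (dLaplacian_eqOn_of_isOpen isOpen_ball hvw hz)).symm
  have hkl : LocallyIntegrableOn k (ball (0 : ℂ) 1) :=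
    (hk.continuousOn.mono ball_subset_closedBall).locallyIntegrableOn measurableSet_ball
  have hae := ae_restrict_normalizedArea (H.3.ae_eq hweak H.1 hkl)
  have hsol : SolvesBiharmonicDirichlet k 0 0 w := ⟨hkl, H.2, hweak, H.4, H.5⟩
  intro z hz
  have hmul : (fun ζ => (biharmonicGreen z ζ : ℂ) * k ζ)
      =ᵐ[normalizedArea.restrict (ball 0 1)] fun ζ => (biharmonicGreen z ζ : ℂ) * g ζ := by
    filter_upwards [hae] with ζ hζ
    rw [hζ]
  refine ⟨(integrableOn_normalizedArea (integrableOn_biharmonicGreen_mul hk.continuousOn hz)).congr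
    hmul, ?_⟩
  exact (hsol.eqOn (solves_neg_greenPotential hk.continuousOn) hz).trans
    (congrArg Neg.neg (integral_congr_ae hmul))

theorem solves_operatorF_add_operatorH (f h : CircleDistribution) :
    SolvesBiharmonicDirichlet 0 f h (operatorF f + operatorH h) := by
  simpa using (solves_operatorF f).add (solves_operatorH h)

theorem theorem1p1 :
    (∀ (f h : CircleDistribution) (g u w : ℂ → ℂ),
      SolvesBiharmonicDirichlet 0 f h u →
      ContDiffOn ℝ ∞ w (closedBall (0 : ℂ) 1) →
      SolvesBiharmonicDirichlet g 0 0 w →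
        (∀ z ∈ ball (0 : ℂ) 1, u z = operatorF f z + operatorH h z) ∧
        (∀ z ∈ ball (0 : ℂ) 1, IntegrableOn (fun ζ => (biharmonicGreen z ζ : ℂ) * g ζ)
          (ball (0 : ℂ) 1) normalizedArea ∧ w z = -greenPotential g z) ∧
        SolvesBiharmonicDirichlet g f h (u + w) ∧
        (∀ Φ : ℂ → ℂ, SolvesBiharmonicDirichlet g f h Φ →
          EqOn Φ (u + w) (ball (0 : ℂ) 1))) ∧
    (∀ (f h : CircleDistribution) (g : ℂ → ℂ),
      ContinuousOn g (closedBall (0 : ℂ) 1) →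
        (∀ z ∈ ball (0 : ℂ) 1, IntegrableOn (fun ζ => (biharmonicGreen z ζ : ℂ) * g ζ)
          (ball (0 : ℂ) 1) normalizedArea) ∧
        SolvesBiharmonicDirichlet g f h
          (fun z => operatorF f z + operatorH h z - greenPotential g z)) := by
  refine ⟨fun f h g u w hu hw hgw => ?_, fun f h g hg => ⟨fun z hz => ?_, ?_⟩⟩
  · have hsum : SolvesBiharmonicDirichlet g f h (u + w) := by simpa using hu.add hgw
    exact ⟨hu.eqOn (solves_operatorF_add_operatorH f h), hgw.eq_neg_greenPotential hw, hsum,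
      fun Φ hΦ => hΦ.eqOn hsum⟩
  · exact integrableOn_normalizedArea (integrableOn_biharmonicGreen_mul hg hz)
  · have H := (solves_operatorF_add_operatorH f h).add (solves_neg_greenPotential hg)
    simp only [zero_add, add_zero] at H
    exact H.congr fun z _ => (sub_eq_add_neg _ _).symm
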